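/- Let $H$ and $H'$ be complex Hilbert spaces and let $p\in(1,\infty)$, $p\neq 2$. For a complex Hilbert space $K$, let $C_p(K)$ be the space of compact operators $a$ on $K$ whose singular values $\sigma_n(a)$ (the eigenvalues of $|a|=(a^*a)^{1/2}$ repeated according to multiplicity) satisfy $\|a\|_p:=\left(\sum_n\sigma_n(a)^p\right)^{1/p}<\infty$; let $S(C_p(K))$ be its unit sphere $\{a\in C_p(K):\|a\|_p=1\}$, and let $\mathcal U_{\min}(K)$ be the set of rank-one partial isometries on $K$. For $e\in\mathcal U_{\min}(K)$ and a bounded operator $x$ on $K$ put $P_2(e)(x):=ee^*xe^*e$, and let $\varphi_e(x)$ be the unique complex number with $P_2(e)(x)=\varphi_e(x)\,e$. Let $\mathbb T=\{\lambda\in\mathbb C:|\lambda|=1\}$. Let $\Delta:S(C_p(H))\to S(C_p(H'))$ be a surjective isometry, that is, a surjective map with $\|\Delta(a)-\Delta(b)\|_p=\|a-b\|_p$ for all $a,b\in S(C_p(H))$. Then $\Delta(e)\in\mathcal U_{\min}(H')$ for every $e\in\mathcal U_{\min}(H)$, and $\Delta$ satisfies at least one of the two conditions 1. $\Delta(\lambda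 w)=\lambda\,\Delta(w)$ for all $\lambda\in\mathbb T$ and $w\in\mathcal U_{\min}(H)$; 2. $\Delta(\lambda w)=\overline{\lambda}\,\Delta(w)$ for all $\lambda\in\mathbb T$ and $w\in\mathcal U_{\min}(H)$. Moreover, for all $e,v\in\mathcal U_{\min}(H)$: (a) if condition 1 holds, then $P_2(\Delta(e))(\Delta(v))=\varphi_e(v)\,\Delta(e)$, equivalently $\varphi_{\Delta(e)}(\Delta(v))=\varphi_e(v)$; (b) if condition 2 holds, then $P_2(\Delta(e))(\Delta(v))=\overline{\varphi_e(v)}\,\Delta(e)$, equivalently $\varphi_{\Delta(e)}(\Delta(v))=\overline{\varphi_e(v)}$. -/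

import Mathlib

open scoped ENNReal

namespace SchattenTingley

variable {H : Type*} [NormedAddCommGroup H] [InnerProductSpace ℂ H] [CompleteSpace H]

/-- Multiplicity of the number `μ` as a singular value of the operator `a`, that is, the dimension
of the eigenspace of `|a| = (a* a)^{1/2}` for the eigenvalue `μ`. For compact `a` and `μ > 0` this
eigenspace is finite dimensional. -/
noncomputable def singularMultiplicity (a : H →L[ℂ] H) (μ : ℝ) : ℕ :=
  Module.finrank ℂ
    (Module.End.eigenspace ((CFC.abs a : H →L[ℂ] H) : Module.End ℂ H) (μ : ℂ))

/-- The sum `∑ σₙ(a) ^ p` of the `p`-th powers of the singular values of a compact operator `a`,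
each positive singular value being repeated according to its multiplicity. -/
noncomputable def singularPowSum (p : ℝ) (a : H →L[ℂ] H) : ℝ≥0∞ :=
  ∑' μ : {μ : ℝ // 0 < μ}, (singularMultiplicity a μ : ℝ≥0∞) * ENNReal.ofReal ((μ : ℝ) ^ p)

/-- Membership in the `p`-Schatten–von Neumann class `C_p(H)`: the operator is compact and its
singular values are `p`-summable. -/
def MemSchatten (p : ℝ) (a : H →L[ℂ] H) : Prop :=
  IsCompactOperator a ∧ singularPowSum p a < ∞

/-- The norm `‖a‖_p = (∑ σₙ(a) ^ p) ^ (1 / p)` of an operator `a` in `C_p(H)`. -/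
noncomputable def schattenNorm (p : ℝ) (a : H →L[ℂ] H) : ℝ :=
  (singularPowSum p a).toReal ^ (1 / p)

theorem singularPowSum_circle_smul (p : ℝ) (c : Circle) (a : H →L[ℂ] H) :
    singularPowSum p ((c : ℂ) • a) = singularPowSum p a := by
  have h : CFC.abs ((c : ℂ) • a) = CFC.abs a := by
    have h1 : star ((c : ℂ) • a) * ((c : ℂ) • a) = star a * a := by
      rw [star_smul, smul_mul_smul_comm]
      have : star (c : ℂ) * (c : ℂ) = 1 := by
        rw [Complex.star_def, ← Complex.normSq_eq_conj_mul_self, Circle.normSq_coe]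
        simp
      rw [this, one_smul]
    rw [CFC.abs, CFC.abs, h1]
  have h' : ∀ μ : ℝ, singularMultiplicity ((c : ℂ) • a) μ = singularMultiplicity a μ := fun μ => by
    rw [singularMultiplicity, h, singularMultiplicity]
  simp only [singularPowSum, h']

variable (H) in
/-- The unit sphere `S(C_p(H))` of `C_p(H)`. -/
def SchattenSphere (p : ℝ) : Type _ :=
  {a : H →L[ℂ] H // MemSchatten p a ∧ schattenNorm p a = 1}

/-- Multiplication of the elements of the unit sphere by complex numbers of modulus one. -/
noncomputable instance (p : ℝ) : SMul Circle (SchattenSphere H p) where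
  smul c a := ⟨(c : ℂ) • a.1, by
    refine ⟨⟨a.2.1.1.smul (c : ℂ), ?_⟩, ?_⟩
    · rw [singularPowSum_circle_smul]; exact a.2.1.2
    · rw [schattenNorm, singularPowSum_circle_smul]; exact a.2.2⟩

/-- A minimal partial isometry: `e e* e = e`, and `e` has rank one. -/
def IsMinimalPartialIsometry (e : H →L[ℂ] H) : Prop :=
  e * star e * e = e ∧ Module.finrank ℂ (LinearMap.range (e : H →ₗ[ℂ] H)) = 1

/-- The Peirce 2-projection `P₂(e)(x) = e e* x e* e` associated with a partial isometry `e`. -/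
noncomputable def peirceTwo (e x : H →L[ℂ] H) : H →L[ℂ] H :=
  e * star e * x * (star e * e)

/-- If `e` is a minimal partial isometry, then `P₂(e)(x)` is a multiple of `e` by exactly one
complex number. -/
theorem existsUnique_peirceTwo_eq_smul {e : H →L[ℂ] H} (he : IsMinimalPartialIsometry e)
    (x : H →L[ℂ] H) : ∃! c : ℂ, peirceTwo e x = c • e := by
  obtain ⟨h1, h2⟩ := he
  obtain ⟨u, hu0, hu⟩ := finrank_eq_one_iff'.1 h2
  have hf : ∀ y, ∃ c : ℂ, e y = c • (u : H) := fun y => by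
    obtain ⟨c, hc⟩ := hu ⟨e y, ⟨y, rfl⟩⟩
    exact ⟨c, by simpa using (congrArg Subtype.val hc).symm⟩
  obtain ⟨⟨u, y₀, hy₀⟩, hu0'⟩ : ∃ w : LinearMap.range (e : H →ₗ[ℂ] H), w = u := ⟨u, rfl⟩
  subst hu0'
  have hne : u ≠ 0 := fun h => hu0 (Subtype.ext h)
  obtain ⟨c, hc⟩ := hf (star e (x (star e u)))
  refine ⟨c, ?_, ?_⟩
  · ext y
    obtain ⟨d, hd⟩ := hf y
    simp only at hd hc
    simp only [peirceTwo, mul_apply_eq_comp, smul_apply, hd,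
      map_smul, hc]
    exact smul_comm _ _ _
  · intro c' hc'
    have hval : peirceTwo e x y₀ = c • u := by
      have : e y₀ = u := hy₀
      simp only [peirceTwo, mul_apply_eq_comp, this]
      exact hc
    have : c' • u = c • u := by
      rw [← hval, hc', smul_apply]
      exact congrArg (c' • ·) hy₀.symm
    exact smul_left_injective ℂ hne this

open Classical in
/-- For a minimal partial isometry `e`, the unique complex number `φ_e(x)` such that
`P₂(e)(x) = φ_e(x) e` (and `0` by convention if `e` is not a minimal partial isometry). -/
noncomputable def peirceCoeff (e x : H →L[ℂ] H) : ℂ :=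
  if he : IsMinimalPartialIsometry e then (existsUnique_peirceTwo_eq_smul he x).choose else 0

theorem peirceTwo_eq_peirceCoeff_smul {e : H →L[ℂ] H} (he : IsMinimalPartialIsometry e)
    (x : H →L[ℂ] H) : peirceTwo e x = peirceCoeff e x • e := by
  rw [peirceCoeff, dif_pos he]
  exact (existsUnique_peirceTwo_eq_smul he x).choose_spec.1

section Maps

variable {H' : Type*} [NormedAddCommGroup H'] [InnerProductSpace ℂ H'] [CompleteSpace H']

/-- `Δ : S(C_p(H)) → S(C_p(H'))` preserves the distance `‖a - b‖_p`. -/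
def IsSphereIsometry {p : ℝ} (Δ : SchattenSphere H p → SchattenSphere H' p) : Prop :=
  ∀ a b, schattenNorm p ((Δ a).1 - (Δ b).1) = schattenNorm p (a.1 - b.1)

/-- `Δ (λ w) = λ Δ(w)` for every `λ` of modulus one and every minimal partial isometry `w`. -/
def IsComplexHomogeneous {p : ℝ} (Δ : SchattenSphere H p → SchattenSphere H' p) : Prop :=
  ∀ (c : Circle) (w : SchattenSphere H p), IsMinimalPartialIsometry w.1 →
    (Δ (c • w)).1 = (c : ℂ) • (Δ w).1

/-- `Δ (λ w) = conj(λ) Δ(w)` for every `λ` of modulus one and every minimal partial isometry `w`. -/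
def IsConjugateHomogeneous {p : ℝ} (Δ : SchattenSphere H p → SchattenSphere H' p) : Prop :=
  ∀ (c : Circle) (w : SchattenSphere H p), IsMinimalPartialIsometry w.1 →
    (Δ (c • w)).1 = (starRingEnd ℂ (c : ℂ)) • (Δ w).1

end Maps

end SchattenTingley

/-! Everything is recovered from distances. For `1 < p` the norm is strictly convex
(`eq_of_singularPowSum_add`), so `-a` is the only point of the sphere at distance 2 from `a`. Hence
`Δ(-a) = -Δ(a)`, and `Δ` preserves `‖a + b‖_p` as well as `‖a - b‖_p`.

For `p ≠ 2` the Clarkson–McCarthy inequality between `‖a + b‖^p + ‖a - b‖^p` and `2(‖a‖^p + ‖b‖^p)`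
is an equality only when `a b* = 0 = a* b`. On the sphere orthogonality therefore means `‖a + b‖^p =
‖a - b‖^p = 2` and is preserved by `Δ` in both directions. The inequality comes from the column
operator `T x = (a x, b x)`: the eigenvalues of `T*T` are compared with the singular values of `a*`,
`b*` and of `a ± b` through (sub)stochastic matrices and Jensen's inequality for `t ↦ t^(p/2)`. The
case of equality in Jensen gives orthogonality (`mul_star_eq_zero_of_pair_eq`).

Orthogonality detects rank one. Whatever is orthogonal to everything orthogonal to a minimal `e`
lies in `ℂ e` (`eq_smul_of_forall_orthogonal`), while a point of the sphere that is not minimal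
dominates two orthogonal minimal partial isometries (`exists_orthogonal_pair`). So `Δ` preserves
minimality and maps the circle through `w` into the line of `Δ(w)`, isometrically, hence linearly or
conjugate linearly.

For minimal `e`, `v` and `|c| = 1` the squared singular values of `e - c v` are two numbers with sum
`2 - 2 Re(c φ_e(v))` and product independent of `c`. Letting `c` vary, the distances determine
`φ_e(v)` (`re_mul_peirceCoeff_eq`); this gives (a) and (b) from homogeneity on the single circle
through `v`. Finally, a linear `e` and a conjugate linear `v` must satisfy `φ_e(v) = 0`, and any two
minimal partial isometries are linked by a third one with nonzero coefficients to both, so the same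
alternative holds everywhere. -/

namespace SchattenTingley

/-! ### Jensen's inequality and majorization for power sums -/

section Jensen

open scoped NNReal

theorem rpow_tangent_lt_of_one_lt {q x t : ℝ} (hq : 1 < q) (hx : 0 ≤ x) (ht : 0 ≤ t) (h : t ≠ x) :
    q * x ^ (q - 1) * t < t ^ q + (q - 1) * x ^ q := by
  rcases hx.eq_or_lt with rfl | hx
  · have ht' : 0 < t := lt_of_le_of_ne ht (Ne.symm h)
    rw [Real.zero_rpow (by linarith), Real.zero_rpow (by linarith)]
    have := Real.rpow_pos_of_pos ht' q
    linarith
  · have h1 : -1 ≤ t / x - 1 := by linarith [div_nonneg ht hx.le]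
    have h2 : t / x - 1 ≠ 0 := by
      intro h2
      exact h ((div_eq_one_iff_eq hx.ne').1 (by linarith))
    have h3 := one_add_mul_self_lt_rpow_one_add h1 h2 hq
    rw [add_sub_cancel, Real.div_rpow ht hx.le, lt_div_iff₀ (Real.rpow_pos_of_pos hx q)] at h3
    have h4 : x ^ q = x ^ (q - 1) * x := by
      rw [← Real.rpow_add_one hx.ne']; congr 1; ring
    have h5 : (1 + q * (t / x - 1)) * x ^ q = x ^ q + q * x ^ (q - 1) * t - q * x ^ q := by
      rw [h4]; field_simp; ring
    linarith

theorem rpow_lt_tangent_of_lt_one {q x t : ℝ} (hq0 : 0 < q) (hq : q < 1) (hx : 0 < x) (ht : 0 ≤ t)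
    (h : t ≠ x) : t ^ q < q * x ^ (q - 1) * t + (1 - q) * x ^ q := by
  have h1 : -1 ≤ t / x - 1 := by linarith [div_nonneg ht hx.le]
  have h2 : t / x - 1 ≠ 0 := by
    intro h2
    exact h ((div_eq_one_iff_eq hx.ne').1 (by linarith))
  have h3 := rpow_one_add_lt_one_add_mul_self h1 h2 hq0 hq
  rw [add_sub_cancel, Real.div_rpow ht hx.le, div_lt_iff₀ (Real.rpow_pos_of_pos hx q)] at h3
  have h4 : x ^ q = x ^ (q - 1) * x := by
    rw [← Real.rpow_add_one hx.ne']; congr 1; ring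
  have h5 : (1 + q * (t / x - 1)) * x ^ q = x ^ q + q * x ^ (q - 1) * t - q * x ^ q := by
    rw [h4]; field_simp; ring
  linarith

theorem nnrpow_tangent_lt {q : ℝ} (hq : 1 < q) {Q R : ℝ≥0} (hQ : (Q : ℝ) = q) (hR : R + 1 = Q)
    {x t : ℝ≥0} (h : t ≠ x) : Q * x ^ (q - 1) * t < t ^ q + R * x ^ q := by
  have hR' : (R : ℝ) = q - 1 := by rw [← hQ, ← hR]; simp
  rw [← NNReal.coe_lt_coe]
  push_cast
  rw [hQ, hR']
  exact rpow_tangent_lt_of_one_lt hq x.2 t.2 (by simpa using h)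

theorem nnrpow_lt_tangent {q : ℝ} (hq0 : 0 < q) {Q R : ℝ≥0} (hQ : (Q : ℝ) = q)
    (hR : R + Q = 1) (hq : q < 1) {x t : ℝ≥0} (hx : 0 < x) (h : t ≠ x) :
    t ^ q < Q * x ^ (q - 1) * t + R * x ^ q := by
  have hR' : (R : ℝ) = 1 - q := by
    have := congrArg NNReal.toReal hR
    push_cast at this
    linarith
  rw [← NNReal.coe_lt_coe]
  push_cast
  rw [hQ, hR']
  exact rpow_lt_tangent_of_lt_one hq0 hq (by simpa using hx) t.2 (by simpa using h)

theorem nnrpow_sub_one_mul {q : ℝ} {x : ℝ≥0} (hx : 0 < x) : x ^ (q - 1) * x = x ^ q := by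
  rw [← NNReal.rpow_add_one hx.ne']; congr 1; ring

variable {I J : Type*}

/-- Jensen's inequality for `t ↦ t ^ q`, `1 < q`, and weights of total mass at most one, with the
case of equality. -/
theorem rpow_le_tsum_mul_rpow {q : ℝ} (hq : 1 < q) {w : I → ℝ≥0∞} {t : I → ℝ≥0} {x : ℝ≥0}
    (hw : ∑' i, w i ≤ 1) (hx : (x : ℝ≥0∞) ≤ ∑' i, w i * t i) :
    ((x ^ q : ℝ≥0) : ℝ≥0∞) ≤ ∑' i, w i * (t i ^ q : ℝ≥0) ∧
    (∑' i, w i * (t i ^ q : ℝ≥0) = (x ^ q : ℝ≥0) → ∀ i, w i ≠ 0 → t i = x) := by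
  obtain ⟨Q, hQ⟩ : ∃ Q : ℝ≥0, (Q : ℝ) = q := ⟨⟨q, by linarith⟩, rfl⟩
  -- `R = q - 1`. The constant term `R x^q` stays on the larger side of the tangent inequality:
  -- nothing is subtracted in `ℝ≥0∞`, and total mass at most one suffices.
  obtain ⟨R, hR⟩ : ∃ R : ℝ≥0, R + 1 = Q := 
    ⟨Q - 1, tsub_add_cancel_of_le (by rw [← NNReal.coe_le_coe, hQ]; exact hq.le)⟩
  have hlt : ∀ i, t i ≠ x →
      ((Q * x ^ (q - 1) * t i : ℝ≥0) : ℝ≥0∞) < ((t i ^ q + R * x ^ q : ℝ≥0) : ℝ≥0∞) :=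
    fun i hi => ENNReal.coe_lt_coe.2 (nnrpow_tangent_lt hq hQ hR hi)
  have hle : ∀ i,
      ((Q * x ^ (q - 1) * t i : ℝ≥0) : ℝ≥0∞) ≤ ((t i ^ q + R * x ^ q : ℝ≥0) : ℝ≥0∞) := by
    intro i
    by_cases hi : t i = x
    · rw [hi]
      rcases eq_zero_or_pos x with rfl | hx0
      · simp
      · rw [mul_assoc, nnrpow_sub_one_mul hx0, ← hR, add_mul, one_mul, add_comm]
    · exact (hlt i hi).le
  have h1 : ((Q * x ^ q : ℝ≥0) : ℝ≥0∞) ≤ ∑' i, w i * ((Q * x ^ (q - 1) * t i : ℝ≥0) : ℝ≥0∞) := by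
    rcases eq_zero_or_pos x with rfl | hx0
    · rw [NNReal.zero_rpow (by linarith)]; simp
    calc ((Q * x ^ q : ℝ≥0) : ℝ≥0∞) = ((Q * x ^ (q - 1) : ℝ≥0) : ℝ≥0∞) * x := by
          rw [← ENNReal.coe_mul, mul_assoc, nnrpow_sub_one_mul hx0]
      _ ≤ ((Q * x ^ (q - 1) : ℝ≥0) : ℝ≥0∞) * ∑' i, w i * t i := by gcongr
      _ = _ := by
          rw [← ENNReal.tsum_mul_left]
          refine tsum_congr fun i => ?_
          rw [ENNReal.coe_mul (Q * x ^ (q - 1))]; ring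
  have h2 : ∑' i, w i * ((t i ^ q + R * x ^ q : ℝ≥0) : ℝ≥0∞)
      ≤ (∑' i, w i * (t i ^ q : ℝ≥0)) + ((R * x ^ q : ℝ≥0) : ℝ≥0∞) := by
    simp_rw [ENNReal.coe_add, mul_add]
    rw [ENNReal.tsum_add, ENNReal.tsum_mul_right]
    gcongr
    exact mul_le_of_le_one_left' hw
  have h3 : ((Q * x ^ q : ℝ≥0) : ℝ≥0∞)
      = ((x ^ q : ℝ≥0) : ℝ≥0∞) + ((R * x ^ q : ℝ≥0) : ℝ≥0∞) := by
    rw [← ENNReal.coe_add, ← hR, add_mul, one_mul, add_comm]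
  refine ⟨?_, fun heq i hwi => ?_⟩
  · have := h1.trans ((ENNReal.tsum_le_tsum fun i => mul_le_mul_right (hle i) (w i)).trans h2)
    rw [h3] at this
    exact (ENNReal.add_le_add_iff_right ENNReal.coe_ne_top).1 this
  · by_contra hi
    rw [heq, ← h3] at h2
    have hwt : w i ≠ ∞ := ((ENNReal.le_tsum i).trans_lt (hw.trans_lt ENNReal.one_lt_top)).ne
    have h4 := ENNReal.tsum_lt_tsum (i := i)
      (f := fun i => w i * ((Q * x ^ (q - 1) * t i : ℝ≥0) : ℝ≥0∞))
      (g := fun i => w i * ((t i ^ q + R * x ^ q : ℝ≥0) : ℝ≥0∞))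
      (((ENNReal.tsum_le_tsum fun i => mul_le_mul_right (hle i) (w i)).trans h2).trans_lt
        ENNReal.coe_lt_top).ne (fun i => mul_le_mul_right (hle i) (w i))
      ((ENNReal.mul_lt_mul_iff_right hwi hwt).2 (hlt i hi))
    exact (h1.trans_lt (h4.trans_le h2)).false

/-- Jensen's inequality for `t ↦ t ^ q`, `0 < q < 1`, and weights of total mass at most one, with
the case of equality. -/
theorem tsum_mul_rpow_le_rpow {q : ℝ} (hq0 : 0 < q) (hq : q < 1) {w : I → ℝ≥0∞} {t : I → ℝ≥0}
    {x : ℝ≥0} (hw : ∑' i, w i ≤ 1) (hx : ∑' i, w i * t i = x) :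
    ∑' i, w i * (t i ^ q : ℝ≥0) ≤ ((x ^ q : ℝ≥0) : ℝ≥0∞) ∧
    (∑' i, w i * (t i ^ q : ℝ≥0) = (x ^ q : ℝ≥0) → ∀ i, w i ≠ 0 → t i = x) := by
  -- For `q < 1` the graph has no finite slope at `0`. If `x = 0`, the first moment vanishes, so `t`
  -- is zero wherever the weight is not.
  rcases eq_zero_or_pos x with rfl | hx0
  · have h0 : ∀ i, w i * (t i : ℝ≥0∞) = 0 := ENNReal.tsum_eq_zero.1 (by simpa using hx)
    have h1 : ∀ i, w i ≠ 0 → t i = 0 := fun i hi => by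
      simpa [hi] using h0 i
    refine ⟨le_of_eq ?_, fun _ => h1⟩
    rw [NNReal.zero_rpow hq0.ne', ENNReal.coe_zero, ENNReal.tsum_eq_zero]
    intro i
    by_cases hi : w i = 0
    · simp [hi]
    · rw [h1 i hi, NNReal.zero_rpow hq0.ne']; simp
  obtain ⟨Q, hQ⟩ : ∃ Q : ℝ≥0, (Q : ℝ) = q := ⟨⟨q, hq0.le⟩, rfl⟩
  obtain ⟨R, hR⟩ : ∃ R : ℝ≥0, R + Q = 1 := 
    ⟨1 - Q, tsub_add_cancel_of_le (by rw [← NNReal.coe_le_coe, hQ]; exact hq.le)⟩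
  have hlt : ∀ i, t i ≠ x →
      ((t i ^ q : ℝ≥0) : ℝ≥0∞) < ((Q * x ^ (q - 1) * t i + R * x ^ q : ℝ≥0) : ℝ≥0∞) :=
    fun i hi => ENNReal.coe_lt_coe.2 (nnrpow_lt_tangent hq0 hQ hR hq hx0 hi)
  have hle : ∀ i,
      ((t i ^ q : ℝ≥0) : ℝ≥0∞) ≤ ((Q * x ^ (q - 1) * t i + R * x ^ q : ℝ≥0) : ℝ≥0∞) := by
    intro i
    by_cases hi : t i = x
    · rw [hi, mul_assoc, nnrpow_sub_one_mul hx0, ← add_mul, add_comm Q, hR, one_mul]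
    · exact (hlt i hi).le
  have h2 : ∑' i, w i * ((Q * x ^ (q - 1) * t i + R * x ^ q : ℝ≥0) : ℝ≥0∞)
      ≤ ((x ^ q : ℝ≥0) : ℝ≥0∞) := by
    calc ∑' i, w i * ((Q * x ^ (q - 1) * t i + R * x ^ q : ℝ≥0) : ℝ≥0∞)
        = ∑' i, (((Q * x ^ (q - 1) : ℝ≥0) : ℝ≥0∞) * (w i * t i)
            + w i * ((R * x ^ q : ℝ≥0) : ℝ≥0∞)) := by
          refine tsum_congr fun i => ?_
          rw [ENNReal.coe_add, ENNReal.coe_mul (Q * x ^ (q - 1))]; ring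
      _ = ((Q * x ^ (q - 1) : ℝ≥0) : ℝ≥0∞) * x + (∑' i, w i) * ((R * x ^ q : ℝ≥0) : ℝ≥0∞) := by
          rw [ENNReal.tsum_add, ENNReal.tsum_mul_left, ENNReal.tsum_mul_right, hx]
      _ ≤ ((Q * x ^ (q - 1) : ℝ≥0) : ℝ≥0∞) * x + ((R * x ^ q : ℝ≥0) : ℝ≥0∞) := by
          gcongr
          exact mul_le_of_le_one_left' hw
      _ = _ := by
          rw [← ENNReal.coe_mul, ← ENNReal.coe_add, mul_assoc, nnrpow_sub_one_mul hx0, ← add_mul,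
            add_comm Q, hR, one_mul]
  refine ⟨(ENNReal.tsum_le_tsum fun i => mul_le_mul_right (hle i) (w i)).trans h2,
    fun heq i hwi => ?_⟩
  by_contra hi
  have hwt : w i ≠ ∞ := ((ENNReal.le_tsum i).trans_lt (hw.trans_lt ENNReal.one_lt_top)).ne
  have h4 := ENNReal.tsum_lt_tsum (i := i)
    (f := fun i => w i * ((t i ^ q : ℝ≥0) : ℝ≥0∞))
    (g := fun i => w i * ((Q * x ^ (q - 1) * t i + R * x ^ q : ℝ≥0) : ℝ≥0∞))
    (by rw [heq]; exact ENNReal.coe_ne_top) (fun i => mul_le_mul_right (hle i) (w i))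
    ((ENNReal.mul_lt_mul_iff_right hwi hwt).2 (hlt i hi))
  rw [heq] at h4
  exact (h4.trans_le h2).false

theorem eq_of_tsum_eq_of_le {f g : I → ℝ≥0∞} (h : ∀ i, f i ≤ g i) (hf : ∑' i, f i ≠ ∞)
    (heq : ∑' i, g i ≤ ∑' i, f i) (i : I) : f i = g i := by
  by_contra hi
  exact ((ENNReal.tsum_lt_tsum hf h (lt_of_le_of_ne (h i) hi)).trans_le heq).false

/-- Majorization of `q`-th power sums, `1 < q`, under a doubly substochastic matrix. -/
theorem tsum_rpow_le_of_substochastic {q : ℝ} (hq : 1 < q) {w : J → I → ℝ≥0∞} {t : I → ℝ≥0}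
    {x : J → ℝ≥0} (hrow : ∀ j, ∑' i, w j i ≤ 1) (hcol : ∀ i, ∑' j, w j i ≤ 1)
    (hx : ∀ j, (x j : ℝ≥0∞) ≤ ∑' i, w j i * t i) :
    ∑' j, ((x j ^ q : ℝ≥0) : ℝ≥0∞) ≤ ∑' i, ((t i ^ q : ℝ≥0) : ℝ≥0∞) := by
  calc ∑' j, ((x j ^ q : ℝ≥0) : ℝ≥0∞) ≤ ∑' j, ∑' i, w j i * (t i ^ q : ℝ≥0) :=
        ENNReal.tsum_le_tsum fun j => (rpow_le_tsum_mul_rpow hq (hrow j) (hx j)).1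
    _ = ∑' i, (∑' j, w j i) * (t i ^ q : ℝ≥0) := by
        rw [ENNReal.tsum_comm]; simp_rw [ENNReal.tsum_mul_right]
    _ ≤ _ := ENNReal.tsum_le_tsum fun i => mul_le_of_le_one_left' (hcol i)

/-- Equality of the finite total sums forces equality in Jensen's inequality in every row, and
strict convexity then makes `t` constant on the support of the row. -/
theorem substochastic_eq_of_tsum_rpow_eq {q : ℝ} (hq : 1 < q) {w : J → I → ℝ≥0∞} {t : I → ℝ≥0}
    {x : J → ℝ≥0} (hrow : ∀ j, ∑' i, w j i ≤ 1) (hcol : ∀ i, ∑' j, w j i ≤ 1)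
    (hx : ∀ j, (x j : ℝ≥0∞) ≤ ∑' i, w j i * t i) (hfin : ∑' i, ((t i ^ q : ℝ≥0) : ℝ≥0∞) ≠ ∞)
    (heq : ∑' i, ((t i ^ q : ℝ≥0) : ℝ≥0∞) ≤ ∑' j, ((x j ^ q : ℝ≥0) : ℝ≥0∞)) :
    ∀ j i, w j i ≠ 0 → t i = x j := by
  have hle := tsum_rpow_le_of_substochastic hq hrow hcol hx
  have h2 : ∑' j, ∑' i, w j i * (t i ^ q : ℝ≥0) = ∑' i, (∑' j, w j i) * (t i ^ q : ℝ≥0) := by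
    rw [ENNReal.tsum_comm]; simp_rw [ENNReal.tsum_mul_right]
  have h3 : ∑' i, (∑' j, w j i) * (t i ^ q : ℝ≥0) ≤ ∑' i, ((t i ^ q : ℝ≥0) : ℝ≥0∞) :=
    ENNReal.tsum_le_tsum fun i => mul_le_of_le_one_left' (hcol i)
  intro j
  refine (rpow_le_tsum_mul_rpow hq (hrow j) (hx j)).2 (Eq.symm ?_)
  exact eq_of_tsum_eq_of_le (fun j => (rpow_le_tsum_mul_rpow hq (hrow j) (hx j)).1)
    (hle.trans_lt hfin.lt_top).ne ((h2.trans_le h3).trans heq) j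

/-- Majorization of `q`-th power sums, `0 < q < 1`. -/
theorem tsum_rpow_le_of_stochastic {q : ℝ} (hq0 : 0 < q) (hq : q < 1) {w : J → I → ℝ≥0∞}
    {t : I → ℝ≥0} {x : J → ℝ≥0} (hrow : ∀ j, ∑' i, w j i ≤ 1)
    (hcol : ∀ i, t i ≠ 0 → ∑' j, w j i = 1) (hx : ∀ j, ∑' i, w j i * t i = x j) :
    ∑' i, ((t i ^ q : ℝ≥0) : ℝ≥0∞) ≤ ∑' j, ((x j ^ q : ℝ≥0) : ℝ≥0∞) ∧
    (∑' j, ((x j ^ q : ℝ≥0) : ℝ≥0∞) ≤ ∑' i, ((t i ^ q : ℝ≥0) : ℝ≥0∞) →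
      ∑' i, ((t i ^ q : ℝ≥0) : ℝ≥0∞) ≠ ∞ → ∀ j i, w j i ≠ 0 → t i = x j) := by
  have h2 : ∑' i, ((t i ^ q : ℝ≥0) : ℝ≥0∞) = ∑' j, ∑' i, w j i * (t i ^ q : ℝ≥0) := by
    rw [ENNReal.tsum_comm]; simp_rw [ENNReal.tsum_mul_right]
    refine tsum_congr fun i => ?_
    by_cases hi : t i = 0
    · rw [hi, NNReal.zero_rpow hq0.ne']; simp
    · rw [hcol i hi, one_mul]
  have h3 := fun j => tsum_mul_rpow_le_rpow hq0 hq (hrow j) (hx j)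
  refine ⟨h2.trans_le (ENNReal.tsum_le_tsum fun j => (h3 j).1), fun heq hfin j => (h3 j).2 ?_⟩
  exact eq_of_tsum_eq_of_le (fun j => (h3 j).1) (h2 ▸ hfin) (heq.trans_eq h2) j

end Jensen

end SchattenTingley

/-! ### Eigenvector bases and singular values -/

namespace SchattenTingley

open scoped NNReal InnerProductSpace

variable {H : Type*} [NormedAddCommGroup H] [InnerProductSpace ℂ H]

theorem HilbertBasis.tsum_enorm_inner_sq {ι : Type*} (b : HilbertBasis ι ℂ H) (x : H) :
    ∑' i, ‖⟪b i, x⟫_ℂ‖ₑ ^ 2 = ‖x‖ₑ ^ 2 := by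
  have h : HasSum (fun i => ‖⟪b i, x⟫_ℂ‖ ^ 2) (‖x‖ ^ 2) := by
    have h1 := Complex.hasSum_re (b.hasSum_inner_mul_inner x x)
    have h2 : (fun i => (⟪x, b i⟫_ℂ * ⟪b i, x⟫_ℂ).re) = fun i => ‖⟪b i, x⟫_ℂ‖ ^ 2 := by
      funext i
      rw [← inner_conj_symm, ← Complex.normSq_eq_conj_mul_self, Complex.ofReal_re,
        Complex.normSq_eq_norm_sq]
    rw [h2] at h1
    rwa [← inner_self_eq_norm_sq (𝕜 := ℂ)]
  have h3 := ENNReal.ofReal_tsum_of_nonneg (fun i => by positivity) h.summable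
  rw [h.tsum_eq] at h3
  simp_rw [ENNReal.ofReal_pow (norm_nonneg _), ofReal_norm] at h3
  exact h3.symm

theorem HilbertBasis.ext_inner {ι : Type*} (b : HilbertBasis ι ℂ H) {x y : H}
    (h : ∀ i, ⟪b i, x⟫_ℂ = ⟪b i, y⟫_ℂ) : x = y := by
  refine b.repr.injective (lp.ext (funext fun i => ?_))
  rw [b.repr_apply_apply, b.repr_apply_apply, h]

theorem HilbertBasis.ext_clm {ι : Type*} (b : HilbertBasis ι ℂ H) {S T : H →L[ℂ] H}
    (h : ∀ i, S (b i) = T (b i)) : S = T := by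
  ext x
  refine ((b.hasSum_repr x).mapL S).unique ?_
  convert (b.hasSum_repr x).mapL T using 2 with i
  rw [map_smul, map_smul, h]

theorem Orthonormal.tsum_enorm_inner_sq_le {ι : Type*} {v : ι → H} (hv : Orthonormal ℂ v) (x : H) :
    ∑' i, ‖⟪v i, x⟫_ℂ‖ₑ ^ 2 ≤ ‖x‖ₑ ^ 2 := by
  have h3 := ENNReal.ofReal_tsum_of_nonneg (fun i => by positivity)
    (hv.inner_products_summable (x := x))
  simp_rw [ENNReal.ofReal_pow (norm_nonneg _), ofReal_norm] at h3
  rw [← h3, ← ofReal_norm, ← ENNReal.ofReal_pow (norm_nonneg _)]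
  exact ENNReal.ofReal_le_ofReal (hv.tsum_inner_products_le (x := x))

/-- Hilbert bases of the eigenspaces are put together; the union is complete because the eigenspaces
of a compact self-adjoint operator have dense span. -/
theorem exists_hilbertBasis_eigenvectors [CompleteSpace H] {R : H →L[ℂ] H} (hc : IsCompactOperator R)
    (hs : IsSelfAdjoint R) :
    ∃ (s : Set H) (b : HilbertBasis s ℂ H) (r : s → ℝ), ∀ i, R (b i) = (r i : ℂ) • b i := by
  have hsym : (R : H →ₗ[ℂ] H).IsSymmetric := ContinuousLinearMap.isSelfAdjoint_iff_isSymmetric.1 hs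
  let E : ℂ → Submodule ℂ H := fun μ => Module.End.eigenspace (R : Module.End ℂ H) μ
  have hE : ∀ μ, IsClosed (E μ : Set H) := fun μ => by
    have : (E μ : Set H) = {x | R x = μ • x} := by
      ext x; simp [E]
    rw [this]
    exact isClosed_eq R.continuous (continuous_const_smul μ)
  have hcomp : ∀ μ, CompleteSpace (E μ) := fun μ => (hE μ).completeSpace_coe
  choose w b hb using fun μ => exists_hilbertBasis ℂ (E μ)
  let v : (Σ μ, w μ) → H := fun i => (b i.1 i.2 : H)
  have hv : Orthonormal ℂ v :=
    hsym.orthogonalFamily_eigenspaces.orthonormal_sigma_orthonormal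
      (fun μ => (b μ).orthonormal)
  have hspan : (Submodule.span ℂ (Set.range v))ᗮ = ⊥ := by
    rw [← ContinuousLinearMap.orthogonalComplement_iSup_eigenspaces_eq_bot hc hsym, eq_comm]
    apply le_antisymm
    · apply Submodule.orthogonal_le
      rw [Submodule.span_le]
      rintro _ ⟨i, rfl⟩
      exact Submodule.mem_iSup_of_mem i.1 (b i.1 i.2).2
    · intro x hx
      rw [Submodule.mem_orthogonal] at hx ⊢
      intro u hu
      refine Submodule.iSup_induction (fun μ => E μ) (motive := fun u => ⟪u, x⟫_ℂ = 0) hu ?_ ?_ ?_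
      · intro μ u hu
        have h1 := (b μ).hasSum_repr ⟨u, hu⟩
        have h2 := h1.mapL ((innerSL ℂ x).comp (E μ).subtypeL)
        have h3 : ⟪x, u⟫_ℂ = 0 := by
          refine h2.unique ?_
          convert hasSum_zero with i
          simp only [map_smul, ContinuousLinearMap.comp_apply, Submodule.subtypeL_apply,
            innerSL_apply_apply]
          have := hx (v ⟨μ, i⟩) (Submodule.subset_span ⟨_, rfl⟩)
          rw [inner_eq_zero_symm.1 this, smul_zero]
        exact inner_eq_zero_symm.1 h3
      · simp
      · intro y z hy hz
        rw [inner_add_left, hy, hz, add_zero]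
  have hRv : ∀ i, R (v i) = i.1 • v i := fun i =>
    Module.End.mem_eigenspace_iff.1 (b i.1 i.2).2
  have hvr : Orthonormal ℂ (fun x : Set.range v => (x : H)) := hv.toSubtypeRange
  have hvr' : (Submodule.span ℂ (Set.range (fun x : Set.range v => (x : H))))ᗮ = ⊥ := by
    rwa [Subtype.range_coe]
  refine ⟨Set.range v, HilbertBasis.mkOfOrthogonalEqBot hvr hvr',
    fun i => (⟪(i : H), R i⟫_ℂ).re, ?_⟩
  rintro ⟨_, i, rfl⟩
  rw [HilbertBasis.coe_mkOfOrthogonalEqBot]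
  simp only
  have h1 : ⟪v i, R (v i)⟫_ℂ = i.1 := by
    rw [hRv, inner_smul_right, inner_self_eq_norm_sq_to_K, hv.1 i]; simp
  have h2 : (starRingEnd ℂ) i.1 = i.1 := by
    rw [← h1, inner_conj_symm]
    exact hsym _ _
  rw [h1, hRv, ← Complex.conj_eq_iff_re.1 h2, Complex.ofReal_re]

/-- For `s > 0` the vector `y = A x - s x` satisfies `A y = -s y`, which is incompatible with
positivity of `A` unless `y = 0`. This yields eigenvectors of a positive square root without
functional calculus. -/
theorem apply_eq_smul_of_sq_apply_eq {A : H →L[ℂ] H} (hA : 0 ≤ A) {s : ℝ} (hs : 0 ≤ s) {x : H}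
    (h : A (A x) = ((s ^ 2 : ℝ) : ℂ) • x) : A x = (s : ℂ) • x := by
  have hpos := (ContinuousLinearMap.nonneg_iff_isPositive A).1 hA
  rcases hs.eq_or_lt with rfl | hs
  · have h1 : ⟪A x, A x⟫_ℂ = 0 := by
      have := hpos.isSymmetric x (A x)
      simp only [ContinuousLinearMap.coe_coe] at this
      rw [this, h]; simp
    simp [inner_self_eq_zero.1 h1]
  · set y := A x - (s : ℂ) • x with hy
    have h1 : A y = -((s : ℂ) • y) := by
      rw [hy, map_sub, map_smul, h, smul_sub, smul_smul]
      push_cast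
      rw [pow_two]; abel
    have h2 : 0 ≤ (⟪A y, y⟫_ℂ).re := hpos.re_inner_nonneg_left y
    rw [h1, inner_neg_left, inner_smul_left, Complex.conj_ofReal, Complex.neg_re, Complex.re_ofReal_mul] at h2
    have h3 : (⟪y, y⟫_ℂ).re = ‖y‖ ^ 2 := inner_self_eq_norm_sq (𝕜 := ℂ) y
    rw [h3] at h2
    have h4 : ‖y‖ ^ 2 = 0 := by nlinarith [sq_nonneg ‖y‖]
    have h5 : y = 0 := by simpa using h4
    exact sub_eq_zero.1 h5

variable [CompleteSpace H]

/-- The Hilbert basis `g` consists of eigenvectors of `a* a`. -/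
def IsSingularBasis {ι : Type*} (a : H →L[ℂ] H) (g : HilbertBasis ι ℂ H) : Prop :=
  ∀ i, star a (a (g i)) = ((‖a (g i)‖ ^ 2 : ℝ) : ℂ) • g i

theorem inner_star_apply_left (a : H →L[ℂ] H) (x y : H) : ⟪star a x, y⟫_ℂ = ⟪x, a y⟫_ℂ := by
  rw [ContinuousLinearMap.star_eq_adjoint, ContinuousLinearMap.adjoint_inner_left]

theorem inner_star_apply_right (a : H →L[ℂ] H) (x y : H) : ⟪x, star a y⟫_ℂ = ⟪a x, y⟫_ℂ := by
  rw [ContinuousLinearMap.star_eq_adjoint, ContinuousLinearMap.adjoint_inner_right]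

theorem IsSingularBasis.of_eigen {ι : Type*} {a : H →L[ℂ] H} {g : HilbertBasis ι ℂ H} {r : ι → ℝ}
    (h : ∀ i, star a (a (g i)) = (r i : ℂ) • g i) : IsSingularBasis a g := by
  intro i
  have h1 : ⟪g i, star a (a (g i))⟫_ℂ = (‖a (g i)‖ ^ 2 : ℝ) := by
    rw [inner_star_apply_right, inner_self_eq_norm_sq_to_K]; simp
  have h2 : ⟪g i, star a (a (g i))⟫_ℂ = r i := by
    rw [h, inner_smul_right, inner_self_eq_norm_sq_to_K, g.orthonormal.1 i]; simp
  rw [← h1, h2, h]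

theorem isCompactOperator_star_mul_self {a : H →L[ℂ] H} (ha : IsCompactOperator a) :
    IsCompactOperator (star a * a : H →L[ℂ] H) :=
  ha.clm_comp (star a)

theorem exists_isSingularBasis {a : H →L[ℂ] H} (ha : IsCompactOperator a) :
    ∃ (s : Set H) (g : HilbertBasis s ℂ H), IsSingularBasis a g := by
  obtain ⟨s, g, r, h⟩ := exists_hilbertBasis_eigenvectors (isCompactOperator_star_mul_self ha)
    (IsSelfAdjoint.star_mul_self a)
  exact ⟨s, g, IsSingularBasis.of_eigen h⟩

theorem IsSingularBasis.inner_apply_eq_zero {ι : Type*} {a : H →L[ℂ] H} {g : HilbertBasis ι ℂ H}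
    (h : IsSingularBasis a g) {i j : ι} (hij : i ≠ j) : ⟪a (g i), a (g j)⟫_ℂ = 0 := by
  rw [← inner_star_apply_right, h j, inner_smul_right, g.orthonormal.2 hij, mul_zero]

theorem IsSingularBasis.abs_apply {ι : Type*} {a : H →L[ℂ] H} {g : HilbertBasis ι ℂ H}
    (h : IsSingularBasis a g) (i : ι) : CFC.abs a (g i) = (‖a (g i)‖ : ℂ) • g i := by
  refine apply_eq_smul_of_sq_apply_eq (CFC.abs_nonneg a) (norm_nonneg _) ?_
  have h1 : CFC.abs a * CFC.abs a = star a * a := CFC.abs_mul_abs a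
  have h2 := congrArg (fun T : H →L[ℂ] H => T (g i)) h1
  exact h2.trans (h i)

/-- An eigenvector of `|a|` for `μ` is orthogonal to every `g i` with a different eigenvalue, so
only the `g i` with `‖a (g i)‖ = μ` occur in its expansion. -/
theorem IsSingularBasis.eigenspace_abs_eq_span {ι : Type*} {a : H →L[ℂ] H}
    {g : HilbertBasis ι ℂ H} (ha : IsCompactOperator a) (h : IsSingularBasis a g) {μ : ℝ}
    (hμ : 0 < μ) :
    Finite {i // ‖a (g i)‖ = μ} ∧
      singularMultiplicity a μ = Nat.card {i // ‖a (g i)‖ = μ} := by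
  set E := Module.End.eigenspace ((CFC.abs a : H →L[ℂ] H) : Module.End ℂ H) (μ : ℂ) with hE
  set S : Set H := Set.range fun i : {i // ‖a (g i)‖ = μ} => g i with hS
  have habs : ∀ x ∈ E, CFC.abs a x = (μ : ℂ) • x := fun x hx =>
    Module.End.mem_eigenspace_iff.1 hx
  have hsub : S ⊆ E := by
    rintro _ ⟨⟨i, hi⟩, rfl⟩
    simp only [hE, SetLike.mem_coe, Module.End.mem_eigenspace_iff]
    exact (h.abs_apply i).trans (by rw [hi])
  -- The eigenspace of `|a|` for `μ` lies in that of the compact operator `a* a` for `μ²`.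
  have hfd : FiniteDimensional ℂ E := by
    have h1 := ContinuousLinearMap.finite_dimensional_eigenspace (isCompactOperator_star_mul_self ha)
      ((μ : ℂ) ^ 2) (by simpa using hμ.ne')
    refine Submodule.finiteDimensional_of_le (S₂ := Module.End.eigenspace
      (star a * a : H →L[ℂ] H).toLinearMap ((μ : ℂ) ^ 2)) ?_
    intro x hx
    rw [Module.End.mem_eigenspace_iff]
    have h2 := congrArg (fun T : H →L[ℂ] H => T x) (CFC.abs_mul_abs a)
    refine h2.symm.trans ?_
    change CFC.abs a (CFC.abs a x) = _
    rw [habs x hx, map_smul, habs x hx, smul_smul, pow_two]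
  have hli : LinearIndependent ℂ fun i : {i // ‖a (g i)‖ = μ} => g i :=
    g.orthonormal.linearIndependent.comp _ Subtype.val_injective
  have hfin : Finite {i // ‖a (g i)‖ = μ} := by
    have : LinearIndependent ℂ fun i : {i // ‖a (g i)‖ = μ} => (⟨g i, hsub ⟨i, rfl⟩⟩ : E) :=
      LinearIndependent.of_comp E.subtype hli
    exact this.finite
  refine ⟨hfin, ?_⟩
  have hspan : E = Submodule.span ℂ S := by
    refine le_antisymm ?_ (Submodule.span_le.2 hsub)
    intro x hx
    have hzero : ∀ i, ‖a (g i)‖ ≠ μ → ⟪g i, x⟫_ℂ = 0 := by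
      intro i hi
      have h1 : ⟪CFC.abs a (g i), x⟫_ℂ = ⟪g i, CFC.abs a x⟫_ℂ :=
        ((ContinuousLinearMap.nonneg_iff_isPositive _).1 (CFC.abs_nonneg a)).isSymmetric (g i) x
      rw [h.abs_apply, habs x hx, inner_smul_left, inner_smul_right, Complex.conj_ofReal] at h1
      have h2 : ((‖a (g i)‖ : ℂ) - μ) * ⟪g i, x⟫_ℂ = 0 := by rw [sub_mul, h1, sub_self]
      rcases mul_eq_zero.1 h2 with h3 | h3
      · exact absurd (by exact_mod_cast sub_eq_zero.1 h3) hi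
      · exact h3
    have h4 := g.hasSum_repr x
    have hfs : {i | ‖a (g i)‖ = μ}.Finite := hfin
    have h5 : HasSum (fun i => g.repr x i • g i) (∑ i ∈ hfs.toFinset, g.repr x i • g i) := by
      refine hasSum_sum_of_ne_finset_zero fun i hi => ?_
      rw [g.repr_apply_apply, hzero i (by simpa using hi), zero_smul]
    rw [h4.unique h5]
    refine Submodule.sum_mem _ fun i hi => Submodule.smul_mem _ _ (Submodule.subset_span ?_)
    exact ⟨⟨i, by simpa using hi⟩, rfl⟩
  have := Fintype.ofFinite {i // ‖a (g i)‖ = μ}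
  rw [singularMultiplicity, ← hE, hspan, hS, finrank_span_eq_card hli, Nat.card_eq_fintype_card]

/-- Grouping the basis by the value of `‖a (g i)‖` recovers the multiplicities. All later estimates
of power sums go through this formula. -/
theorem IsSingularBasis.singularPowSum_eq {ι : Type*} {a : H →L[ℂ] H} {g : HilbertBasis ι ℂ H}
    (h : IsSingularBasis a g) (ha : IsCompactOperator a) {p : ℝ} (hp : 0 < p) :
    singularPowSum p a = ∑' i, ‖a (g i)‖ₑ ^ p := by
  rw [← ENNReal.tsum_fiberwise (fun i => ‖a (g i)‖ₑ ^ p) (fun i => ‖a (g i)‖), singularPowSum]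
  have hsupp : Function.support (fun μ : ℝ => ∑' b : (fun i => ‖a (g i)‖) ⁻¹' {μ},
      ‖a (g b)‖ₑ ^ p) ⊆ {μ | 0 < μ} := by
    intro μ hμ
    simp only [Function.mem_support, ne_eq, ENNReal.tsum_eq_zero, not_forall] at hμ
    obtain ⟨⟨i, hi⟩, hi'⟩ := hμ
    simp only [Set.mem_preimage, Set.mem_singleton_iff] at hi
    rw [Set.mem_ofPred, ← hi, norm_pos_iff]
    intro h0
    simp [h0, hp] at hi'
  rw [← tsum_subtype_eq_of_support_subset hsupp]
  refine tsum_congr fun μ => ?_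
  obtain ⟨hfin, hcard⟩ := h.eigenspace_abs_eq_span ha μ.2
  have hfin' : Finite ((fun i => ‖a (g i)‖) ⁻¹' {(μ : ℝ)}) := hfin
  have h1 : ∀ b : (fun i => ‖a (g i)‖) ⁻¹' {(μ : ℝ)},
      ‖a (g b)‖ₑ ^ p = ENNReal.ofReal ((μ : ℝ) ^ p) := by
    rintro ⟨i, hi⟩
    simp only [Set.mem_preimage, Set.mem_singleton_iff] at hi
    rw [← ofReal_norm, hi, ENNReal.ofReal_rpow_of_pos μ.2]
  rw [tsum_congr h1, ENNReal.tsum_const, hcard]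
  congr 1
  rw [ENat.card_eq_coe_natCard]
  rfl

end SchattenTingley

/-! ### The column operator `x ↦ (a x, b x)` and its rows -/

namespace SchattenTingley

open scoped NNReal InnerProductSpace

variable {H : Type*} [NormedAddCommGroup H] [InnerProductSpace ℂ H] [CompleteSpace H]

/-- Since `‖a* x‖² ≤ ‖a a* x‖ ‖x‖`, a finite net for the image of the unit ball under the compact
operator `a a*` yields one for its image under `a*`. -/
theorem isCompactOperator_star {a : H →L[ℂ] H} (ha : IsCompactOperator a) :
    IsCompactOperator (star a : H →L[ℂ] H) := by
  have h1 : IsCompactOperator (a * star a : H →L[ℂ] H) := ha.comp_clm (star a)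
  have h2 := h1.isCompact_closure_image_ball (𝕜₁ := ℂ) (f := ((a * star a : H →L[ℂ] H) : H →ₗ[ℂ] H)) 1
  have h3 : TotallyBounded ((a * star a : H →L[ℂ] H) '' Metric.ball 0 1) :=
    h2.totallyBounded.subset subset_closure
  refine (isCompactOperator_iff_isCompact_closure_image_ball (𝕜₁ := ℂ)
    ((star a : H →L[ℂ] H) : H →ₗ[ℂ] H) one_pos).2 ?_
  refine TotallyBounded.isCompact_of_isClosed (TotallyBounded.closure ?_) isClosed_closure
  rw [Metric.totallyBounded_iff]
  intro ε hε
  -- Two points of the unit ball are at distance below `2`, and `(ε² / 2) * 2 = ε²`.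
  obtain ⟨t, hts, htf, htc⟩ := Metric.finite_approx_of_totallyBounded h3 (ε ^ 2 / 2) (by positivity)
  have hts' : ∀ y ∈ t, ∃ x ∈ Metric.ball (0 : H) 1, (a * star a : H →L[ℂ] H) x = y :=
    fun y hy => hts hy
  choose! u hu huy using hts'
  refine ⟨(fun y => star a (u y)) '' t, htf.image _, ?_⟩
  rintro _ ⟨x, hx, rfl⟩
  obtain ⟨y, hy, hxy⟩ := Set.mem_iUnion₂.1 (htc ⟨x, hx, rfl⟩)
  refine Set.mem_iUnion₂.2 ⟨_, ⟨y, hy, rfl⟩, ?_⟩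
  rw [Metric.mem_ball, dist_eq_norm] at hxy ⊢
  simp only [ContinuousLinearMap.coe_coe]
  rw [← map_sub]
  have h4 : ‖star a (x - u y)‖ ^ 2 ≤ ‖a (star a (x - u y))‖ * ‖x - u y‖ := by
    have h5 := inner_self_eq_norm_sq (𝕜 := ℂ) (star a (x - u y))
    rw [inner_star_apply_right] at h5
    rw [← h5]
    exact (RCLike.re_le_norm _).trans (norm_inner_le_norm _ _)
  have h6 : ‖a (star a (x - u y))‖ < ε ^ 2 / 2 := by
    have h7 : (a * star a : H →L[ℂ] H) (x - u y) = (a * star a : H →L[ℂ] H) x - y := by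
      rw [map_sub, huy y hy]
    change ‖(a * star a : H →L[ℂ] H) (x - u y)‖ < _
    rwa [h7]
  have h8 : ‖x - u y‖ < 2 := by
    have h9 := hu y hy
    rw [mem_ball_zero_iff] at hx h9
    linarith [norm_sub_le x (u y)]
  refine lt_of_pow_lt_pow_left₀ 2 hε.le ?_
  nlinarith [norm_nonneg (x - u y), norm_nonneg (a (star a (x - u y)))]

/-- The Hilbert basis `g` consists of eigenvectors of `a* a + b* b`. -/
def IsPairBasis {ι : Type*} (a b : H →L[ℂ] H) (g : HilbertBasis ι ℂ H) : Prop :=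
  ∀ i, star a (a (g i)) + star b (b (g i))
    = ((‖a (g i)‖ ^ 2 + ‖b (g i)‖ ^ 2 : ℝ) : ℂ) • g i

/-- The eigenvalue of `a* a + b* b` at the basis vector `g i`. -/
noncomputable def pairValue {ι : Type*} (a b : H →L[ℂ] H) (g : HilbertBasis ι ℂ H) (i : ι) : ℝ≥0 :=
  ‖a (g i)‖₊ ^ 2 + ‖b (g i)‖₊ ^ 2

omit [CompleteSpace H] in
theorem coe_pairValue {ι : Type*} (a b : H →L[ℂ] H) (g : HilbertBasis ι ℂ H) (i : ι) :
    (pairValue a b g i : ℝ≥0∞) = ‖a (g i)‖ₑ ^ 2 + ‖b (g i)‖ₑ ^ 2 := by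
  rw [pairValue]; push_cast; rfl

omit [CompleteSpace H] in
theorem pairValue_eq_zero {ι : Type*} {a b : H →L[ℂ] H} {g : HilbertBasis ι ℂ H} {i : ι} :
    pairValue a b g i = 0 ↔ a (g i) = 0 ∧ b (g i) = 0 := by
  simp [pairValue]

theorem exists_isPairBasis {a b : H →L[ℂ] H} (ha : IsCompactOperator a)
    (hb : IsCompactOperator b) :
    ∃ (s : Set H) (g : HilbertBasis s ℂ H), IsPairBasis a b g := by
  obtain ⟨s, g, r, h⟩ := exists_hilbertBasis_eigenvectors
    (R := star a * a + star b * b)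
    ((isCompactOperator_star_mul_self ha).add (isCompactOperator_star_mul_self hb))
    ((IsSelfAdjoint.star_mul_self a).add (IsSelfAdjoint.star_mul_self b))
  refine ⟨s, g, fun i => ?_⟩
  have h0 : star a (a (g i)) + star b (b (g i)) = (r i : ℂ) • g i := h i
  have h1 : ⟪g i, star a (a (g i)) + star b (b (g i))⟫_ℂ
      = (‖a (g i)‖ ^ 2 + ‖b (g i)‖ ^ 2 : ℝ) := by
    rw [inner_add_right, inner_star_apply_right, inner_star_apply_right,
      inner_self_eq_norm_sq_to_K, inner_self_eq_norm_sq_to_K]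
    simp
  have h2 : ⟪g i, star a (a (g i)) + star b (b (g i))⟫_ℂ = r i := by
    rw [h0, inner_smul_right, inner_self_eq_norm_sq_to_K, g.orthonormal.1 i]; simp
  rw [← h1, h2, h0]

theorem IsPairBasis.inner_add_inner {ι : Type*} {a b : H →L[ℂ] H} {g : HilbertBasis ι ℂ H}
    (h : IsPairBasis a b g) (x : H) (j : ι) :
    ⟪a x, a (g j)⟫_ℂ + ⟪b x, b (g j)⟫_ℂ = (pairValue a b g j : ℂ) * ⟪x, g j⟫_ℂ := by
  rw [← inner_star_apply_right, ← inner_star_apply_right, ← inner_add_right, h j, inner_smul_right,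
    pairValue]
  push_cast; rfl

/-- Bessel's inequality in `H ⊕ H`: the vectors `(a (g j), b (g j))` are orthogonal with squared
length `pairValue a b g j`, and those of length zero contribute nothing. -/
theorem IsPairBasis.tsum_le {ι : Type*} {a b : H →L[ℂ] H} {g : HilbertBasis ι ℂ H}
    (h : IsPairBasis a b g) (y z : H) :
    ∑' j, ‖⟪y, a (g j)⟫_ℂ + ⟪z, b (g j)⟫_ℂ‖ₑ ^ 2 / (pairValue a b g j : ℝ≥0∞)
      ≤ ‖y‖ₑ ^ 2 + ‖z‖ₑ ^ 2 := by
  set t := pairValue a b g with ht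
  have htpos : ∀ j : {j // t j ≠ 0}, 0 < √(t j : ℝ) := fun j =>
    Real.sqrt_pos.2 (NNReal.coe_pos.2 (pos_iff_ne_zero.2 j.2))
  let v : {j // t j ≠ 0} → WithLp 2 (H × H) := fun j =>
    (((√(t j : ℝ))⁻¹ : ℝ) : ℂ) • WithLp.toLp 2 (a (g j), b (g j))
  have hin : ∀ (i j : ι), ⟪WithLp.toLp 2 (a (g i), b (g i)), WithLp.toLp 2 (a (g j), b (g j))⟫_ℂ
      = (t j : ℂ) * ⟪g i, g j⟫_ℂ := fun i j => h.inner_add_inner (g i) j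
  have hv : Orthonormal ℂ v := by
    classical
    rw [orthonormal_iff_ite]
    intro i j
    simp only [v]
    rw [inner_smul_left, inner_smul_right, hin]
    split_ifs with hij
    · subst hij
      rw [inner_self_eq_norm_sq_to_K, g.orthonormal.1, Complex.conj_ofReal]
      have h1 : (√(t i : ℝ))⁻¹ * ((√(t i : ℝ))⁻¹ * (t i : ℝ)) = 1 := by
        have h3 : (t i : ℝ) = √(t i : ℝ) * √(t i : ℝ) := (Real.mul_self_sqrt (t i).2).symm
        have := (htpos i).ne'
        nth_rw 3 [h3]
        field_simp
      have h2 := congrArg (fun r : ℝ => (r : ℂ)) h1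
      push_cast at h2
      simpa using h2
    · rw [g.orthonormal.2 (fun hh => hij (Subtype.ext hh))]; simp
  have hB := Orthonormal.tsum_enorm_inner_sq_le hv (WithLp.toLp 2 (y, z))
  have hn : ‖WithLp.toLp 2 (y, z)‖ₑ ^ 2 = ‖y‖ₑ ^ 2 + ‖z‖ₑ ^ 2 := by
    have := WithLp.prod_norm_sq_eq_of_L2 (WithLp.toLp 2 (y, z))
    rw [← ofReal_norm, ← ofReal_norm, ← ofReal_norm, ← ENNReal.ofReal_pow (norm_nonneg _),
      ← ENNReal.ofReal_pow (norm_nonneg _), ← ENNReal.ofReal_pow (norm_nonneg _), this,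
      ENNReal.ofReal_add (by positivity) (by positivity)]
    rfl
  rw [hn] at hB
  refine le_trans (le_of_eq ?_) hB
  have hsupp : Function.support (fun j => ‖⟪y, a (g j)⟫_ℂ + ⟪z, b (g j)⟫_ℂ‖ₑ ^ 2 / (t j : ℝ≥0∞))
      ⊆ {j | t j ≠ 0} := by
    intro j hj h0
    obtain ⟨h1, h2⟩ := pairValue_eq_zero.1 h0
    simp [h1, h2] at hj
  rw [← tsum_subtype_eq_of_support_subset hsupp]
  refine tsum_congr fun j => ?_
  simp only [v]
  rw [← inner_conj_symm (_ • _), inner_smul_right]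
  have h1 : ⟪WithLp.toLp 2 (y, z), WithLp.toLp 2 (a (g j), b (g j))⟫_ℂ
    = ⟪y, a (g j)⟫_ℂ + ⟪z, b (g j)⟫_ℂ := rfl
  rw [h1, ← ofReal_norm, ← ofReal_norm, RCLike.norm_conj, norm_mul, ← ENNReal.ofReal_pow (by positivity),
    ← ENNReal.ofReal_pow (by positivity), mul_pow, Complex.norm_real, Real.norm_eq_abs, sq_abs,
    inv_pow, Real.sq_sqrt (t j).coe_nonneg, mul_comm, ← div_eq_mul_inv,
    ENNReal.ofReal_div_of_pos (NNReal.coe_pos.2 (pos_iff_ne_zero.2 j.2)), ENNReal.ofReal_coe_nnreal]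

section Weights

variable {ι κ κ' : Type*} {a b : H →L[ℂ] H} {g : HilbertBasis ι ℂ H} {f : HilbertBasis κ ℂ H}
  {f' : HilbertBasis κ' ℂ H}

/-- The squared coefficients of the polar part of the column operator `(a, b)`. -/
noncomputable def pairWeight (a b : H →L[ℂ] H) (g : HilbertBasis ι ℂ H) (f : HilbertBasis κ ℂ H)
    (f' : HilbertBasis κ' ℂ H) (k : κ ⊕ κ') (j : ι) : ℝ≥0∞ :=
  Sum.elim (fun i => ‖⟪f i, a (g j)⟫_ℂ‖ₑ ^ 2 / (pairValue a b g j : ℝ≥0∞))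
    (fun i => ‖⟪f' i, b (g j)⟫_ℂ‖ₑ ^ 2 / (pairValue a b g j : ℝ≥0∞)) k

/-- The squared lengths of the rows of the column operator `(a, b)`. -/
noncomputable def starValue (a b : H →L[ℂ] H) (f : HilbertBasis κ ℂ H)
    (f' : HilbertBasis κ' ℂ H) (k : κ ⊕ κ') : ℝ≥0 :=
  Sum.elim (fun i => ‖star a (f i)‖₊ ^ 2) (fun i => ‖star b (f' i)‖₊ ^ 2) k

/-- Bessel's inequality for a unit vector placed in one of the two summands of `H ⊕ H`. -/
theorem pairWeight_row (h : IsPairBasis a b g) (k : κ ⊕ κ') :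
    ∑' j, pairWeight a b g f f' k j ≤ 1 := by
  rcases k with i | i
  · refine le_trans (le_of_eq ?_) ((h.tsum_le (f i) 0).trans (le_of_eq ?_))
    · simp [pairWeight]
    · rw [enorm_zero, ← ofReal_norm, f.orthonormal.1]; simp
  · refine le_trans (le_of_eq ?_) ((h.tsum_le 0 (f' i)).trans (le_of_eq ?_))
    · simp [pairWeight]
    · rw [enorm_zero, ← ofReal_norm, f'.orthonormal.1]; simp

-- Parseval's identity for the basis of `H ⊕ H` made of `f` and `f'`, applied to the normalised
-- vector `(a (g j), b (g j))`.
omit [CompleteSpace H] in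
theorem tsum_pairWeight_col (j : ι) (hj : pairValue a b g j ≠ 0) :
    ∑' k, pairWeight a b g f f' k j = 1 := by
  rw [Summable.tsum_sum ENNReal.summable ENNReal.summable]
  simp only [pairWeight, Sum.elim_inl, Sum.elim_inr, div_eq_mul_inv]
  rw [ENNReal.tsum_mul_right, ENNReal.tsum_mul_right, HilbertBasis.tsum_enorm_inner_sq,
    HilbertBasis.tsum_enorm_inner_sq, ← add_mul, ← coe_pairValue]
  exact ENNReal.mul_inv_cancel (by simpa using hj) ENNReal.coe_ne_top

omit [CompleteSpace H] in
theorem tsum_pairWeight_col_le (j : ι) :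
    ∑' k, pairWeight a b g f f' k j ≤ 1 := by
  by_cases hj : pairValue a b g j = 0
  · obtain ⟨h1, h2⟩ := pairValue_eq_zero.1 hj
    have : ∀ k, pairWeight a b g f f' k j = 0 := by
      rintro (k | k) <;> simp [pairWeight, h1, h2]
    simp [this]
  · exact (tsum_pairWeight_col j hj).le

theorem enorm_inner_star (a : H →L[ℂ] H) (x y : H) : ‖⟪x, star a y⟫_ℂ‖ₑ = ‖⟪y, a x⟫_ℂ‖ₑ := by
  rw [inner_star_apply_right, ← inner_conj_symm, ← ofReal_norm, RCLike.norm_conj, ofReal_norm]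

/-- With `T` the column operator, both sides are the diagonal entry of `T T*` at a vector of `f` or
`f'`, which is `‖a* f‖²` or `‖b* f'‖²`. Jensen's inequality will compare these entries with the
eigenvalues of `T* T`. -/
theorem tsum_pairWeight_mul (k : κ ⊕ κ') :
    ∑' j, pairWeight a b g f f' k j * pairValue a b g j = starValue a b f f' k := by
  have key : ∀ (c : ℝ≥0∞) (j : ι), (pairValue a b g j = 0 → c = 0) →
      c / (pairValue a b g j : ℝ≥0∞) * pairValue a b g j = c := by
    intro c j hc
    by_cases hj : pairValue a b g j = 0
    · simp [hj, hc hj]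
    · exact ENNReal.div_mul_cancel (by simpa using hj) ENNReal.coe_ne_top
  rcases k with i | i
  · have : ∀ j, pairWeight a b g f f' (Sum.inl i) j * pairValue a b g j
        = ‖⟪g j, star a (f i)⟫_ℂ‖ₑ ^ 2 := fun j => by
      rw [enorm_inner_star]
      exact key _ j fun hj => by simp [(pairValue_eq_zero.1 hj).1]
    rw [tsum_congr this, HilbertBasis.tsum_enorm_inner_sq]
    simp [starValue]; rfl
  · have : ∀ j, pairWeight a b g f f' (Sum.inr i) j * pairValue a b g j
        = ‖⟪g j, star b (f' i)⟫_ℂ‖ₑ ^ 2 := fun j => by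
      rw [enorm_inner_star]
      exact key _ j fun hj => by simp [(pairValue_eq_zero.1 hj).2]
    rw [tsum_congr this, HilbertBasis.tsum_enorm_inner_sq]
    simp [starValue]; rfl

theorem coe_sq_rpow {E : Type*} [NormedAddCommGroup E] (x : E) {p : ℝ} (hp : 0 < p) :
    (((‖x‖₊ ^ 2) ^ (p / 2) : ℝ≥0) : ℝ≥0∞) = ‖x‖ₑ ^ p := by
  rw [← NNReal.rpow_natCast, ← NNReal.rpow_mul,
    ENNReal.coe_rpow_of_nonneg _ (by push_cast; linarith)]
  congr 1; push_cast; ring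

theorem tsum_starValue {p : ℝ} (hp : 0 < p) (ha : IsCompactOperator a) (hb : IsCompactOperator b)
    (hf : IsSingularBasis (star a) f) (hf' : IsSingularBasis (star b) f') :
    ∑' k, ((starValue a b f f' k ^ (p / 2) : ℝ≥0) : ℝ≥0∞)
      = singularPowSum p (star a) + singularPowSum p (star b) := by
  rw [Summable.tsum_sum ENNReal.summable ENNReal.summable,
    hf.singularPowSum_eq (isCompactOperator_star ha) hp,
    hf'.singularPowSum_eq (isCompactOperator_star hb) hp]
  simp only [starValue, Sum.elim_inl, Sum.elim_inr, coe_sq_rpow _ hp]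

/-- A pinching inequality: `a a*` and `b b*` are the diagonal blocks of `T T*`, and passing to
diagonal blocks lowers convex power sums. For exponents below 2 the power is concave and the
inequality turns round. -/
theorem pair_le_of_two_lt {p : ℝ} (hp : 2 < p) (ha : IsCompactOperator a)
    (hb : IsCompactOperator b) (h : IsPairBasis a b g) :
    singularPowSum p (star a) + singularPowSum p (star b)
      ≤ ∑' j, ((pairValue a b g j ^ (p / 2) : ℝ≥0) : ℝ≥0∞) := by
  obtain ⟨_, f, hf⟩ := exists_isSingularBasis (isCompactOperator_star ha)
  obtain ⟨_, f', hf'⟩ := exists_isSingularBasis (isCompactOperator_star hb)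
  rw [← tsum_starValue (by linarith) ha hb hf hf']
  exact tsum_rpow_le_of_substochastic (by linarith) (pairWeight_row h) tsum_pairWeight_col_le
    (fun k => (tsum_pairWeight_mul k).ge)

theorem le_pair_of_lt_two {p : ℝ} (hp0 : 0 < p) (hp : p < 2) (ha : IsCompactOperator a)
    (hb : IsCompactOperator b) (h : IsPairBasis a b g) :
    ∑' j, ((pairValue a b g j ^ (p / 2) : ℝ≥0) : ℝ≥0∞)
      ≤ singularPowSum p (star a) + singularPowSum p (star b) := by
  obtain ⟨_, f, hf⟩ := exists_isSingularBasis (isCompactOperator_star ha)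
  obtain ⟨_, f', hf'⟩ := exists_isSingularBasis (isCompactOperator_star hb)
  rw [← tsum_starValue (by linarith) ha hb hf hf']
  exact (tsum_rpow_le_of_stochastic (by linarith) (by linarith) (pairWeight_row h)
    tsum_pairWeight_col (fun k => tsum_pairWeight_mul k)).1

/-- Equality in Jensen puts `a (g j)` in the eigenspace of `a a*` for the same eigenvalue that `g j`
has under `a* a + b* b`. Hence `a a* a = a (a* a + b* b)`, so `a b* b = 0` and `a b* = 0`. -/
theorem mul_star_eq_zero_of_pair_eq {p : ℝ} (hp0 : 0 < p) (hp : p ≠ 2) (ha : IsCompactOperator a)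
    (hb : IsCompactOperator b) (h : IsPairBasis a b g)
    (heq : singularPowSum p (star a) + singularPowSum p (star b)
      = ∑' j, ((pairValue a b g j ^ (p / 2) : ℝ≥0) : ℝ≥0∞))
    (hfin : ∑' j, ((pairValue a b g j ^ (p / 2) : ℝ≥0) : ℝ≥0∞) ≠ ∞) : a * star b = 0 := by
  obtain ⟨_, f, hf⟩ := exists_isSingularBasis (isCompactOperator_star ha)
  obtain ⟨_, f', hf'⟩ := exists_isSingularBasis (isCompactOperator_star hb)
  rw [← tsum_starValue (by linarith) ha hb hf hf'] at heq
  have hval : ∀ k j, pairWeight a b g f f' k j ≠ 0 → pairValue a b g j = starValue a b f f' k := by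
    rcases hp.lt_or_gt with hp | hp
    · exact (tsum_rpow_le_of_stochastic (by linarith) (by linarith) (pairWeight_row h)
        tsum_pairWeight_col (fun k => tsum_pairWeight_mul k)).2 heq.le hfin
    · exact substochastic_eq_of_tsum_rpow_eq (by linarith) (pairWeight_row h)
        tsum_pairWeight_col_le (fun k => (tsum_pairWeight_mul k).ge) hfin heq.ge
  have h1 : ∀ i j, ⟪f i, a (g j)⟫_ℂ ≠ 0 → pairValue a b g j = ‖star a (f i)‖₊ ^ 2 := by
    intro i j hij
    refine hval (Sum.inl i) j ?_
    rw [pairWeight, Sum.elim_inl, Ne, ENNReal.div_eq_zero_iff, not_or]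
    exact ⟨by simpa using hij, ENNReal.coe_ne_top⟩
  have h2 : ∀ j, a (star a (a (g j))) = (pairValue a b g j : ℂ) • a (g j) := by
    intro j
    refine HilbertBasis.ext_inner f fun i => ?_
    have h4 : a (star a (f i)) = ((‖star a (f i)‖ ^ 2 : ℝ) : ℂ) • f i := by
      simpa using hf i
    have h5 : ⟪f i, a (star a (a (g j)))⟫_ℂ = ⟪a (star a (f i)), a (g j)⟫_ℂ := by
      rw [← inner_star_apply_left, ← inner_star_apply_right a (star a (f i))]
    rw [h5, h4, inner_smul_left, inner_smul_right, Complex.conj_ofReal]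
    by_cases hij : ⟪f i, a (g j)⟫_ℂ = 0
    · rw [hij, mul_zero, mul_zero]
    · rw [h1 i j hij]; push_cast; rfl
  have h3 : ∀ j, a (star b (b (g j))) = 0 := by
    intro j
    have h4 := congrArg a (h j)
    rw [map_add, h2, map_smul, pairValue] at h4
    push_cast at h4
    simpa using h4
  have h5 : a * star b * b = 0 := HilbertBasis.ext_clm g h3
  rw [← CStarRing.mul_star_self_eq_zero_iff]
  calc a * star b * star (a * star b) = a * star b * b * star a := by
        rw [star_mul, star_star, mul_assoc, mul_assoc, mul_assoc]
    _ = 0 := by rw [h5, zero_mul]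

end Weights

end SchattenTingley

/-! ### Clarkson–McCarthy inequalities and orthogonality -/

namespace SchattenTingley

open scoped NNReal InnerProductSpace

variable {H : Type*} [NormedAddCommGroup H] [InnerProductSpace ℂ H] [CompleteSpace H]

theorem IsSingularBasis.tsum_mul {ι : Type*} {T : H →L[ℂ] H} {f : HilbertBasis ι ℂ H}
    (h : IsSingularBasis T f) (x : H) :
    ∑' j, ‖⟪f j, x⟫_ℂ‖ₑ ^ 2 * ‖T (f j)‖ₑ ^ 2 = ‖T x‖ₑ ^ 2 := by
  have h1 : HasSum (fun j => ‖⟪f j, x⟫_ℂ‖ ^ 2 * ‖T (f j)‖ ^ 2) (‖T x‖ ^ 2) := by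
    have h1 := Complex.hasSum_re (f.hasSum_inner_mul_inner x (star T (T x)))
    have h2 : (fun i => (⟪x, f i⟫_ℂ * ⟪f i, star T (T x)⟫_ℂ).re)
        = fun j => ‖⟪f j, x⟫_ℂ‖ ^ 2 * ‖T (f j)‖ ^ 2 := by
      funext i
      have h3 : ⟪f i, star T (T x)⟫_ℂ = ((‖T (f i)‖ ^ 2 : ℝ) : ℂ) * ⟪f i, x⟫_ℂ := by
        rw [inner_star_apply_right, ← inner_star_apply_left, h i, inner_smul_left,
          Complex.conj_ofReal]
      rw [h3, ← inner_conj_symm, mul_left_comm, ← Complex.normSq_eq_conj_mul_self,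
        ← Complex.ofReal_mul, Complex.ofReal_re, Complex.normSq_eq_norm_sq, mul_comm]
    rw [h2, inner_star_apply_right] at h1
    rwa [← inner_self_eq_norm_sq (𝕜 := ℂ)]
  have h3 := ENNReal.ofReal_tsum_of_nonneg (fun i => by positivity) h1.summable
  rw [h1.tsum_eq] at h3
  simp_rw [ENNReal.ofReal_mul (sq_nonneg _), ENNReal.ofReal_pow (norm_nonneg _), ofReal_norm] at h3
  exact h3.symm

/-- The numbers `‖T (k i)‖²` are averages of the squared singular values with respect to the doubly
stochastic matrix `|⟪f j, k i⟫|²`. -/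
theorem tsum_enorm_rpow_le {ι : Type*} {p : ℝ} (hp : 2 < p) {T : H →L[ℂ] H}
    (hT : IsCompactOperator T) (k : HilbertBasis ι ℂ H) :
    ∑' i, ‖T (k i)‖ₑ ^ p ≤ singularPowSum p T := by
  obtain ⟨_, f, hf⟩ := exists_isSingularBasis hT
  rw [hf.singularPowSum_eq hT (by linarith)]
  have h := tsum_rpow_le_of_substochastic (q := p / 2) (by linarith)
    (w := fun i j => ‖⟪f j, k i⟫_ℂ‖ₑ ^ 2) (t := fun j => ‖T (f j)‖₊ ^ 2)
    (x := fun i => ‖T (k i)‖₊ ^ 2)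
    (fun i => by
      rw [HilbertBasis.tsum_enorm_inner_sq, ← ofReal_norm, k.orthonormal.1]; simp)
    (fun j => by
      simp_rw [← ofReal_norm, norm_inner_symm (f j), ofReal_norm]
      rw [HilbertBasis.tsum_enorm_inner_sq, ← ofReal_norm, f.orthonormal.1]; simp)
    (fun i => by
      push_cast
      exact (hf.tsum_mul (k i)).ge)
  simpa only [coe_sq_rpow _ (show 0 < p by linarith)] using h

theorem le_tsum_enorm_rpow {ι : Type*} {p : ℝ} (hp0 : 0 < p) (hp : p < 2) {T : H →L[ℂ] H}
    (hT : IsCompactOperator T) (k : HilbertBasis ι ℂ H) :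
    singularPowSum p T ≤ ∑' i, ‖T (k i)‖ₑ ^ p := by
  obtain ⟨_, f, hf⟩ := exists_isSingularBasis hT
  rw [hf.singularPowSum_eq hT (by linarith)]
  have h := (tsum_rpow_le_of_stochastic (q := p / 2) (by linarith) (by linarith)
    (w := fun i j => ‖⟪f j, k i⟫_ℂ‖ₑ ^ 2) (t := fun j => ‖T (f j)‖₊ ^ 2)
    (x := fun i => ‖T (k i)‖₊ ^ 2)
    (fun i => by
      rw [HilbertBasis.tsum_enorm_inner_sq, ← ofReal_norm, k.orthonormal.1]; simp)
    (fun j _ => by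
      simp_rw [← ofReal_norm, norm_inner_symm (f j), ofReal_norm]
      rw [HilbertBasis.tsum_enorm_inner_sq, ← ofReal_norm, f.orthonormal.1]; simp)
    (fun i => by
      push_cast
      exact (hf.tsum_mul (k i)))).1
  simpa only [coe_sq_rpow _ hp0] using h

omit [CompleteSpace H] in
theorem two_mul_pairValue {ι : Type*} (a b : H →L[ℂ] H) (g : HilbertBasis ι ℂ H) (i : ι) :
    pairValue a b g i
      = (1 / 2 : ℝ≥0) * ‖(a + b) (g i)‖₊ ^ 2 + (1 / 2 : ℝ≥0) * ‖(a - b) (g i)‖₊ ^ 2 := by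
  ext
  have := parallelogram_law_with_norm ℂ (a (g i)) (b (g i))
  simp only [pairValue, NNReal.coe_add, NNReal.coe_pow, coe_nnnorm, NNReal.coe_mul, NNReal.coe_div,
    NNReal.coe_one, NNReal.coe_ofNat, _root_.add_apply, _root_.sub_apply]
  nlinarith

variable {ι : Type*} {a b : H →L[ℂ] H}

/-- The parallelogram law writes `pairValue a b g j` as the mean of `‖(a + b) (g j)‖²` and `‖(a - b)
(g j)‖²`; convexity of `t ↦ t^(p/2)` and the bound in an arbitrary basis conclude. Together with
`pair_le_of_two_lt` this is the Clarkson–McCarthy inequality. -/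
theorem two_mul_pair_le_of_two_lt {p : ℝ} (hp : 2 < p) (ha : IsCompactOperator a)
    (hb : IsCompactOperator b) (g : HilbertBasis ι ℂ H) :
    2 * ∑' j, ((pairValue a b g j ^ (p / 2) : ℝ≥0) : ℝ≥0∞)
      ≤ singularPowSum p (a + b) + singularPowSum p (a - b) := by
  refine le_trans ?_ (add_le_add (tsum_enorm_rpow_le hp (ha.add hb) g)
    (tsum_enorm_rpow_le hp (ha.sub hb) g))
  rw [← ENNReal.tsum_mul_left, ← ENNReal.tsum_add]
  refine ENNReal.tsum_le_tsum fun j => ?_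
  rw [← coe_sq_rpow _ (by linarith), ← coe_sq_rpow _ (by linarith), ← ENNReal.coe_add,
    ← ENNReal.coe_ofNat, ← ENNReal.coe_mul, ENNReal.coe_le_coe, two_mul_pairValue]
  have h := NNReal.rpow_arith_mean_le_arith_mean2_rpow (1 / 2) (1 / 2)
    (‖(a + b) (g j)‖₊ ^ 2) (‖(a - b) (g j)‖₊ ^ 2) (by norm_num) (p := p / 2) (by linarith)
  refine (mul_le_mul_right h 2).trans_eq ?_
  rw [mul_add, ← mul_assoc, ← mul_assoc]; norm_num

theorem le_two_mul_pair_of_lt_two {p : ℝ} (hp0 : 0 < p) (hp : p < 2) (ha : IsCompactOperator a)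
    (hb : IsCompactOperator b) (g : HilbertBasis ι ℂ H) :
    singularPowSum p (a + b) + singularPowSum p (a - b)
      ≤ 2 * ∑' j, ((pairValue a b g j ^ (p / 2) : ℝ≥0) : ℝ≥0∞) := by
  refine (add_le_add (le_tsum_enorm_rpow hp0 hp (ha.add hb) g)
    (le_tsum_enorm_rpow hp0 hp (ha.sub hb) g)).trans ?_
  rw [← ENNReal.tsum_mul_left, ← ENNReal.tsum_add]
  refine ENNReal.tsum_le_tsum fun j => ?_
  rw [← coe_sq_rpow _ (by linarith), ← coe_sq_rpow _ (by linarith), ← ENNReal.coe_add,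
    ← ENNReal.coe_ofNat, ← ENNReal.coe_mul, ENNReal.coe_le_coe, two_mul_pairValue]
  have hc : ConcaveOn ℝ≥0 Set.univ fun x : ℝ≥0 => x ^ (p / 2) :=
    NNReal.concaveOn_rpow (by linarith) (by linarith)
  have h : (1 / 2 : ℝ≥0) * (‖(a + b) (g j)‖₊ ^ 2) ^ (p / 2)
      + (1 / 2 : ℝ≥0) * (‖(a - b) (g j)‖₊ ^ 2) ^ (p / 2)
      ≤ (1 / 2 * ‖(a + b) (g j)‖₊ ^ 2 + 1 / 2 * ‖(a - b) (g j)‖₊ ^ 2) ^ (p / 2) :=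
    And.right hc (Set.mem_univ _) (Set.mem_univ _) zero_le zero_le (add_halves 1)
  refine le_trans (le_of_eq ?_) (mul_le_mul_right h 2)
  rw [mul_add, ← mul_assoc, ← mul_assoc]; norm_num

omit [CompleteSpace H] in
theorem isCompactOperator_clm_zero : IsCompactOperator (0 : H →L[ℂ] H) :=
  isCompactOperator_zero

omit [CompleteSpace H] in
theorem isCompactOperator_clm_sub (ha : IsCompactOperator a) (hb : IsCompactOperator b) :
    IsCompactOperator (a - b : H →L[ℂ] H) :=
  ha.sub hb

omit [CompleteSpace H] in
theorem isCompactOperator_clm_neg (ha : IsCompactOperator a) :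
    IsCompactOperator (-a : H →L[ℂ] H) :=
  ha.neg

omit [CompleteSpace H] in
theorem isCompactOperator_clm_add (ha : IsCompactOperator a) (hb : IsCompactOperator b) :
    IsCompactOperator (a + b : H →L[ℂ] H) :=
  ha.add hb

theorem singularPowSum_zero {p : ℝ} (hp : 0 < p) : singularPowSum p (0 : H →L[ℂ] H) = 0 := by
  obtain ⟨_, f, hf⟩ := exists_isSingularBasis (isCompactOperator_clm_zero (H := H))
  rw [hf.singularPowSum_eq isCompactOperator_clm_zero hp]
  simp [hp]

theorem tsum_pairValue_zero {p : ℝ} (hp : 0 < p) (ha : IsCompactOperator a)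
    {g : HilbertBasis ι ℂ H} (h : IsSingularBasis a g) :
    ∑' j, ((pairValue a 0 g j ^ (p / 2) : ℝ≥0) : ℝ≥0∞) = singularPowSum p a := by
  rw [h.singularPowSum_eq ha hp]
  refine tsum_congr fun j => ?_
  rw [← coe_sq_rpow _ hp, pairValue]
  simp

theorem IsSingularBasis.isPairBasis_zero {ι : Type*} {a : H →L[ℂ] H} {g : HilbertBasis ι ℂ H}
    (h : IsSingularBasis a g) : IsPairBasis a 0 g := fun i => by simp [h i]

/-- The pinching inequality with `b = 0` gives one direction; applied to `a*` it gives the other. -/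
theorem singularPowSum_star {p : ℝ} (hp0 : 0 < p) (hp : p ≠ 2) (ha : IsCompactOperator a) :
    singularPowSum p (star a) = singularPowSum p a := by
  have key : ∀ {a : H →L[ℂ] H}, IsCompactOperator a →
      (2 < p → singularPowSum p (star a) ≤ singularPowSum p a) ∧
      (p < 2 → singularPowSum p a ≤ singularPowSum p (star a)) := by
    intro a ha
    obtain ⟨_, g, hg⟩ := exists_isSingularBasis ha
    rw [← tsum_pairValue_zero hp0 ha hg]
    constructor
    · intro hp
      have := pair_le_of_two_lt hp ha isCompactOperator_clm_zero hg.isPairBasis_zero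
      simpa [singularPowSum_zero hp0] using this
    · intro hp
      have := le_pair_of_lt_two hp0 hp ha isCompactOperator_clm_zero hg.isPairBasis_zero
      simpa [singularPowSum_zero hp0] using this
  have h1 := key ha
  have h2 := key (isCompactOperator_star ha)
  rw [star_star] at h2
  rcases hp.lt_or_gt with hp | hp
  · exact le_antisymm (h2.2 hp) (h1.2 hp)
  · exact le_antisymm (h1.1 hp) (h2.1 hp)

theorem singularPowSum_smul {p : ℝ} (hp0 : 0 < p) (ha : IsCompactOperator a) (c : ℂ) :
    singularPowSum p (c • a) = ‖c‖ₑ ^ p * singularPowSum p a := by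
  obtain ⟨_, g, hg⟩ := exists_isSingularBasis ha
  have hg' : IsSingularBasis (c • a) g := by
    refine IsSingularBasis.of_eigen (r := fun i => ‖c‖ ^ 2 * ‖a (g i)‖ ^ 2) fun i => ?_
    rw [star_smul, _root_.smul_apply, _root_.smul_apply, map_smul, hg i, smul_smul, smul_smul,
      Complex.star_def, ← Complex.normSq_eq_conj_mul_self, Complex.normSq_eq_norm_sq]
    push_cast; rfl
  rw [hg'.singularPowSum_eq (ha.smul c) hp0, hg.singularPowSum_eq ha hp0, ← ENNReal.tsum_mul_left]
  refine tsum_congr fun i => ?_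
  rw [_root_.smul_apply, enorm_smul, ENNReal.mul_rpow_of_nonneg _ _ hp0.le]

theorem singularPowSum_neg {p : ℝ} (hp0 : 0 < p) (ha : IsCompactOperator a) :
    singularPowSum p (-a) = singularPowSum p a := by
  have := singularPowSum_smul hp0 ha (-1)
  simpa using this

/-- Finiteness is needed because distances are real numbers obtained by `toReal`, which sends `∞` to
`0`. For `2 < p` the inequalities are applied to `a + b` and `a - b`, whose sum and difference are
`2a` and `2b`. -/
theorem singularPowSum_add_ne_top {p : ℝ} (hp0 : 0 < p) (hp : p ≠ 2) (ha : IsCompactOperator a)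
    (hb : IsCompactOperator b) (ha' : singularPowSum p a ≠ ∞) (hb' : singularPowSum p b ≠ ∞) :
    singularPowSum p (a + b) ≠ ∞ := by
  rcases hp.lt_or_gt with hp | hp
  · obtain ⟨_, g, hg⟩ := exists_isPairBasis ha hb
    refine ne_top_of_le_ne_top ?_ (le_self_add.trans (le_two_mul_pair_of_lt_two hp0 hp ha hb g))
    refine ENNReal.mul_ne_top (by simp) (ne_top_of_le_ne_top ?_ (le_pair_of_lt_two hp0 hp ha hb hg))
    rw [singularPowSum_star hp0 hp.ne ha, singularPowSum_star hp0 hp.ne hb]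
    exact ENNReal.add_ne_top.2 ⟨ha', hb'⟩
  · obtain ⟨_, g, hg⟩ := exists_isPairBasis (isCompactOperator_clm_add ha hb) (isCompactOperator_clm_sub ha hb)
    have h1 := pair_le_of_two_lt hp (isCompactOperator_clm_add ha hb) (isCompactOperator_clm_sub ha hb) hg
    have h2 := two_mul_pair_le_of_two_lt hp (isCompactOperator_clm_add ha hb) (isCompactOperator_clm_sub ha hb) g
    have h3 : a + b + (a - b) = (2 : ℂ) • a := by rw [two_smul]; abel
    have h4 : a + b - (a - b) = (2 : ℂ) • b := by rw [two_smul]; abel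
    rw [h3, h4, singularPowSum_smul hp0 ha, singularPowSum_smul hp0 hb] at h2
    have h5 : ‖(2 : ℂ)‖ₑ ^ p ≠ ∞ := ENNReal.rpow_ne_top_of_nonneg hp0.le (by simp)
    have h6 := ne_top_of_le_ne_top (ENNReal.add_ne_top.2
      ⟨ENNReal.mul_ne_top h5 ha', ENNReal.mul_ne_top h5 hb'⟩) h2
    have h7 : ∑' j, ((pairValue (a + b) (a - b) g j ^ (p / 2) : ℝ≥0) : ℝ≥0∞) ≠ ∞ := by
      intro h; rw [h] at h6; simp at h6
    have h8 := ne_top_of_le_ne_top h7 (le_self_add.trans h1)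
    rwa [singularPowSum_star hp0 hp.ne' (isCompactOperator_clm_add ha hb)] at h8

/-- Orthogonality of operators: `a* b = 0 = a b*`. -/
def OrthogonalTo (a b : H →L[ℂ] H) : Prop := a * star b = 0 ∧ star a * b = 0

theorem OrthogonalTo.symm (h : OrthogonalTo a b) : OrthogonalTo b a := by
  constructor
  · have := congrArg star h.1
    simpa using this
  · have := congrArg star h.2
    simpa using this

/-- The hypotheses give equality in the Clarkson–McCarthy inequality, so the power sum of the pair
values is squeezed to `2`. The second half of orthogonality is the first half for the adjoints. -/
theorem orthogonalTo_of_singularPowSum {p : ℝ} (hp0 : 0 < p) (hp : p ≠ 2)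
    (ha : IsCompactOperator a) (hb : IsCompactOperator b) (ha' : singularPowSum p a = 1)
    (hb' : singularPowSum p b = 1) (h1 : singularPowSum p (a + b) = 2)
    (h2 : singularPowSum p (a - b) = 2) : OrthogonalTo a b := by
  have key : ∀ {a b : H →L[ℂ] H}, IsCompactOperator a → IsCompactOperator b →
      singularPowSum p a = 1 → singularPowSum p b = 1 → singularPowSum p (a + b) = 2 →
      singularPowSum p (a - b) = 2 → a * star b = 0 := by
    intro a b ha hb ha' hb' h1 h2
    obtain ⟨_, g, hg⟩ := exists_isPairBasis ha hb
    have hs : singularPowSum p (star a) + singularPowSum p (star b) = 2 := by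
      rw [singularPowSum_star hp0 hp ha, singularPowSum_star hp0 hp hb, ha', hb', one_add_one_eq_two]
    have h4 : singularPowSum p (a + b) + singularPowSum p (a - b) = 2 * 2 := by
      rw [h1, h2, two_mul]
    have heq : ∑' j, ((pairValue a b g j ^ (p / 2) : ℝ≥0) : ℝ≥0∞) = 2 := by
      rcases hp.lt_or_gt with hp | hp
      · refine le_antisymm ((le_pair_of_lt_two hp0 hp ha hb hg).trans hs.le) ?_
        have := le_two_mul_pair_of_lt_two hp0 hp ha hb g
        rw [h4] at this
        exact (ENNReal.mul_le_mul_iff_right (by simp) (by simp)).1 this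
      · refine le_antisymm ?_ (hs.ge.trans (pair_le_of_two_lt hp ha hb hg))
        have := two_mul_pair_le_of_two_lt hp ha hb g
        rw [h4] at this
        exact (ENNReal.mul_le_mul_iff_right (by simp) (by simp)).1 this
    exact mul_star_eq_zero_of_pair_eq hp0 hp ha hb hg (hs.trans heq.symm) (by rw [heq]; simp)
  refine ⟨key ha hb ha' hb' h1 h2, ?_⟩
  have := key (isCompactOperator_star ha) (isCompactOperator_star hb)
    (by rwa [singularPowSum_star hp0 hp ha]) (by rwa [singularPowSum_star hp0 hp hb])
    (by rwa [← star_add, singularPowSum_star hp0 hp (isCompactOperator_clm_add ha hb)])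
    (by rwa [← star_sub, singularPowSum_star hp0 hp (isCompactOperator_clm_sub ha hb)])
  rwa [star_star] at this

/-- A common eigenbasis is obtained by diagonalising `a* a - b* b`. As `a* a` and `b* b` annihilate
each other, `a* a + b* b` is its absolute value, so `a* a` and `b* b` carry the positive and
negative parts of the eigenvalues: on each basis vector `a` or `b` vanishes. -/
theorem OrthogonalTo.singularPowSum_add {p : ℝ} (hp0 : 0 < p) (h : OrthogonalTo a b)
    (ha : IsCompactOperator a) (hb : IsCompactOperator b) :
    singularPowSum p (a + b) = singularPowSum p a + singularPowSum p b := by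
  obtain ⟨s, g, r, hr⟩ := exists_hilbertBasis_eigenvectors (R := star a * a - star b * b)
    ((isCompactOperator_star_mul_self ha).sub (isCompactOperator_star_mul_self hb))
    ((IsSelfAdjoint.star_mul_self a).sub (IsSelfAdjoint.star_mul_self b))
  have hab : star a * a * (star b * b) = 0 := by
    rw [mul_assoc, ← mul_assoc a, h.1, zero_mul, mul_zero]
  have hba : star b * b * (star a * a) = 0 := by
    rw [mul_assoc, ← mul_assoc b, h.symm.1, zero_mul, mul_zero]
  have hS : (star a * a + star b * b) * (star a * a + star b * b)
      = (star a * a - star b * b) * (star a * a - star b * b) := by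
    simp only [mul_add, add_mul, mul_sub, sub_mul, hab, hba]
    abel
  have hS0 : 0 ≤ star a * a + star b * b := add_nonneg (star_mul_self_nonneg a) (star_mul_self_nonneg b)
  have hSg : ∀ i, (star a * a + star b * b : H →L[ℂ] H) (g i) = ((|r i| : ℝ) : ℂ) • g i := by
    intro i
    refine apply_eq_smul_of_sq_apply_eq hS0 (abs_nonneg _) ?_
    have h1 := congrArg (fun T : H →L[ℂ] H => T (g i)) hS
    refine h1.trans ?_
    change (star a * a - star b * b : H →L[ℂ] H) ((star a * a - star b * b : H →L[ℂ] H) (g i)) = _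
    rw [hr, map_smul, hr, smul_smul, sq_abs, pow_two]
    push_cast; rfl
  have hag : ∀ i, star a (a (g i)) = (((|r i| + r i) / 2 : ℝ) : ℂ) • g i := by
    intro i
    have h1 : star a (a (g i)) + star b (b (g i)) = _ := hSg i
    have h2 : star a (a (g i)) - star b (b (g i)) = _ := hr i
    have h3 : (2 : ℂ) • star a (a (g i)) = ((|r i| : ℝ) : ℂ) • g i + (r i : ℂ) • g i := by
      rw [← h1, ← h2, two_smul]; abel
    have h4 : star a (a (g i)) = (2 : ℂ)⁻¹ • ((2 : ℂ) • star a (a (g i))) := by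
      rw [smul_smul]; norm_num
    rw [h4, h3, ← add_smul, smul_smul]
    push_cast
    congr 1; ring
  have hbg : ∀ i, star b (b (g i)) = (((|r i| - r i) / 2 : ℝ) : ℂ) • g i := by
    intro i
    have h1 : star a (a (g i)) + star b (b (g i)) = _ := hSg i
    rw [← sub_eq_iff_eq_add'.2 h1.symm, hag, ← sub_smul]
    push_cast
    congr 1; ring
  have hga := IsSingularBasis.of_eigen hag
  have hgb := IsSingularBasis.of_eigen hbg
  have hgab : IsSingularBasis (a + b) g := by
    refine IsSingularBasis.of_eigen (r := fun i => |r i|) fun i => ?_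
    have h1 : star (a + b) * (a + b) = star a * a + star b * b := by
      rw [star_add, add_mul, mul_add, mul_add, h.2, h.symm.2]; abel
    rw [← hSg, ← h1]; rfl
  rw [hga.singularPowSum_eq ha hp0, hgb.singularPowSum_eq hb hp0,
    hgab.singularPowSum_eq (isCompactOperator_clm_add ha hb) hp0, ← ENNReal.tsum_add]
  refine tsum_congr fun i => ?_
  have hz : ∀ T : H →L[ℂ] H, star T (T (g i)) = 0 → T (g i) = 0 := fun T hT => by
    have : ⟪T (g i), T (g i)⟫_ℂ = 0 := by
      rw [← inner_star_apply_right, hT, inner_zero_right]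
    exact inner_self_eq_zero.1 this
  rw [_root_.add_apply]
  rcases le_total 0 (r i) with h0 | h0
  · have : b (g i) = 0 := hz b (by rw [hbg, abs_of_nonneg h0]; simp)
    rw [this]; simp [hp0]
  · have : a (g i) = 0 := hz a (by rw [hag, abs_of_nonpos h0]; simp)
    rw [this]; simp [hp0]

end SchattenTingley

/-! ### Strict convexity of the norm -/

namespace SchattenTingley

open scoped NNReal InnerProductSpace

variable {H : Type*} [NormedAddCommGroup H] [InnerProductSpace ℂ H]

/-- Bessel's inequality holds for the family `h`. -/
def IsBessel {ι : Type*} (h : ι → H) : Prop := ∀ y, ∑' j, ‖⟪h j, y⟫_ℂ‖ₑ ^ 2 ≤ ‖y‖ₑ ^ 2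

theorem IsBessel.norm_le_one {ι : Type*} {h : ι → H} (hh : IsBessel h) (j : ι) : ‖h j‖ ≤ 1 := by
  have h1 := (ENNReal.le_tsum j).trans (hh (h j))
  have h2 : ‖⟪h j, h j⟫_ℂ‖ ^ 2 ≤ ‖h j‖ ^ 2 := by
    rw [← ofReal_norm, ← ofReal_norm, ← ENNReal.ofReal_pow (norm_nonneg _),
      ← ENNReal.ofReal_pow (norm_nonneg _)] at h1
    exact (ENNReal.ofReal_le_ofReal_iff (by positivity)).1 h1
  rw [inner_self_eq_norm_sq_to_K, norm_pow] at h2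
  simp only [Complex.coe_algebraMap, Complex.norm_real, norm_norm] at h2
  by_contra h3
  push Not at h3
  nlinarith [mul_pos (sub_pos.2 h3) (sub_pos.2 h3)]

variable [CompleteSpace H]

/-- The nonzero images `T (g j)` are orthogonal; where `T (g j) = 0` the convention `0⁻¹ = 0` makes
the member of the family zero. -/
theorem IsSingularBasis.isBessel {ι : Type*} {T : H →L[ℂ] H} {g : HilbertBasis ι ℂ H}
    (hg : IsSingularBasis T g) : IsBessel fun j => ((‖T (g j)‖⁻¹ : ℝ) : ℂ) • T (g j) := by
  intro y
  refine le_trans (le_of_eq ?_) ((hg.isPairBasis_zero.tsum_le y 0).trans (le_of_eq ?_))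
  · refine tsum_congr fun j => ?_
    rw [inner_zero_left, add_zero, ← inner_conj_symm, inner_smul_right, ← ofReal_norm,
      RCLike.norm_conj, norm_mul, Complex.norm_real, norm_inv, norm_norm, coe_pairValue]
    by_cases h0 : T (g j) = 0
    · simp [h0]
    · have h1 : 0 < ‖T (g j)‖ := norm_pos_iff.2 h0
      rw [ENNReal.ofReal_mul (by positivity), mul_pow, ofReal_norm, ENNReal.ofReal_inv_of_pos h1,
        ofReal_norm, ← ENNReal.inv_pow]
      simp [div_eq_mul_inv, mul_comm]
  · simp

omit [CompleteSpace H] in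
theorem eq_inner_smul_of_norm_le {h v : H} (hh : ‖h‖ ≤ 1) (hv : ‖v‖ ≤ ‖⟪h, v⟫_ℂ‖) :
    v = ⟪h, v⟫_ℂ • h := by
  have h1 : ‖v - ⟪h, v⟫_ℂ • h‖ ^ 2 ≤ 0 := by
    rw [@norm_sub_sq ℂ, inner_smul_right, norm_smul, ← inner_conj_symm v h]
    have h2 : RCLike.re (⟪h, v⟫_ℂ * (starRingEnd ℂ) ⟪h, v⟫_ℂ) = ‖⟪h, v⟫_ℂ‖ ^ 2 := by
      rw [RCLike.mul_conj, ← RCLike.ofReal_pow, RCLike.ofReal_re]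
    rw [h2]
    have h3 : ‖v‖ ^ 2 ≤ ‖⟪h, v⟫_ℂ‖ ^ 2 := by gcongr
    have h4 : (‖⟪h, v⟫_ℂ‖ * ‖h‖) ^ 2 ≤ ‖⟪h, v⟫_ℂ‖ ^ 2 := by
      gcongr
      exact mul_le_of_le_one_right (norm_nonneg _) hh
    linarith
  have h2 : ‖v - ⟪h, v⟫_ℂ • h‖ = 0 := by nlinarith [norm_nonneg (v - ⟪h, v⟫_ℂ • h)]
  exact sub_eq_zero.1 (norm_eq_zero.1 h2)

/-- For Bessel families `u`, `h`, the diagonal of `a` with respect to `u`, `h` has `p`-th power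
sum at most that of the singular values; equality forces `‖a (u j)‖ = |⟪h j, a (u j)⟫|`. -/
theorem tsum_diagonal_rpow_le {J : Type*} {p : ℝ} (hp : 1 < p) {a : H →L[ℂ] H}
    (ha : IsCompactOperator a) {u h : J → H} (hu : IsBessel u) (hh : IsBessel h) :
    ∑' j, ‖⟪h j, a (u j)⟫_ℂ‖ₑ ^ p ≤ singularPowSum p a ∧
    (singularPowSum p a ≠ ∞ → singularPowSum p a ≤ ∑' j, ‖⟪h j, a (u j)⟫_ℂ‖ₑ ^ p →
      ∀ j, ‖a (u j)‖ ≤ ‖⟪h j, a (u j)⟫_ℂ‖) := by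
  have hp0 : 0 < p := by linarith
  obtain ⟨I, f, hf⟩ := exists_isSingularBasis ha
  set f' : I → H := fun i => ((‖a (f i)‖⁻¹ : ℝ) : ℂ) • a (f i) with hf'
  have hb' : IsBessel f' := hf.isBessel
  -- In the singular value expansion of `⟪h j, a (u j)⟫` the coefficient of `‖a (f i)‖` is a product
  -- of two inner products. Its modulus is at most the mean of their squares, and Bessel's
  -- inequality makes these means doubly substochastic.
  let w : J → I → ℝ≥0∞ := fun j i => (‖⟪f i, u j⟫_ℂ‖ₑ ^ 2 + ‖⟪f' i, h j⟫_ℂ‖ₑ ^ 2) / 2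
  have hone : ∀ x : H, ‖x‖ ≤ 1 → ‖x‖ₑ ^ 2 ≤ 1 := fun x hx => by
    rw [← ofReal_norm, ← ENNReal.ofReal_pow (norm_nonneg _), ENNReal.ofReal_le_one]
    exact pow_le_one₀ (norm_nonneg _) hx
  have hhalf : ∀ x y : ℝ≥0∞, x ≤ 1 → y ≤ 1 → (x + y) / 2 ≤ 1 := fun x y hx hy => by
    rw [ENNReal.div_le_iff (by simp) (by simp), one_mul, ← one_add_one_eq_two]
    exact add_le_add hx hy
  have hrow : ∀ j, ∑' i, w j i ≤ 1 := fun j => by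
    simp only [w, div_eq_mul_inv]
    rw [ENNReal.tsum_mul_right, ENNReal.tsum_add, ← div_eq_mul_inv]
    refine hhalf _ _ ?_ ((hb' _).trans (hone _ (hh.norm_le_one j)))
    rw [HilbertBasis.tsum_enorm_inner_sq]
    exact hone _ (hu.norm_le_one j)
  have hcol : ∀ i, ∑' j, w j i ≤ 1 := fun i => by
    simp only [w, div_eq_mul_inv]
    rw [ENNReal.tsum_mul_right, ENNReal.tsum_add, ← div_eq_mul_inv]
    simp_rw [← ofReal_norm, norm_inner_symm (f i), norm_inner_symm (f' i), ofReal_norm]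
    exact hhalf _ _ ((hu _).trans (hone _ (f.orthonormal.1 i).le))
      ((hh _).trans (hone _ (hb'.norm_le_one i)))
  have hx : ∀ j, ((‖⟪h j, a (u j)⟫_ℂ‖₊ : ℝ≥0) : ℝ≥0∞) ≤ ∑' i, w j i * (‖a (f i)‖₊ : ℝ≥0) := by
    intro j
    have h1 : HasSum (fun i => ⟪f i, u j⟫_ℂ * ⟪h j, a (f i)⟫_ℂ) ⟪h j, a (u j)⟫_ℂ := by
      have h2 : (fun i => ⟪f i, u j⟫_ℂ * ⟪h j, a (f i)⟫_ℂ)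
          = fun i => ((innerSL ℂ (h j)).comp a) (f.repr (u j) i • f i) :=
        funext fun i => by rw [map_smul, f.repr_apply_apply]; rfl
      rw [h2]
      exact (f.hasSum_repr (u j)).mapL ((innerSL ℂ (h j)).comp a)
    have h3 : ‖⟪h j, a (u j)⟫_ℂ‖ₑ ≤ ∑' i, ‖⟪f i, u j⟫_ℂ * ⟪h j, a (f i)⟫_ℂ‖ₑ := by
      rw [← h1.tsum_eq]
      exact enorm_tsum_le_tsum_enorm
    refine h3.trans (ENNReal.tsum_le_tsum fun i => ?_)
    have h4 : ‖⟪h j, a (f i)⟫_ℂ‖ = ‖⟪f' i, h j⟫_ℂ‖ * ‖a (f i)‖ := by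
      by_cases h0 : a (f i) = 0
      · simp [h0]
      · rw [norm_inner_symm (f' i)]
        rw [show f' i = ((‖a (f i)‖⁻¹ : ℝ) : ℂ) • a (f i) from rfl,
          inner_smul_right, norm_mul, Complex.norm_real, norm_inv, norm_norm]
        have := norm_ne_zero_iff.2 h0
        field_simp
    have h5 : ‖⟪f i, u j⟫_ℂ * ⟪h j, a (f i)⟫_ℂ‖
        ≤ (‖⟪f i, u j⟫_ℂ‖ ^ 2 + ‖⟪f' i, h j⟫_ℂ‖ ^ 2) / 2 * ‖a (f i)‖ := by
      rw [norm_mul, h4, ← mul_assoc]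
      gcongr
      nlinarith [sq_nonneg (‖⟪f i, u j⟫_ℂ‖ - ‖⟪f' i, h j⟫_ℂ‖)]
    have h6 := ENNReal.ofReal_le_ofReal h5
    rw [ENNReal.ofReal_mul (by positivity), ENNReal.ofReal_div_of_pos (by norm_num),
      ENNReal.ofReal_add (by positivity) (by positivity), ENNReal.ofReal_pow (norm_nonneg _),
      ENNReal.ofReal_pow (norm_nonneg _)] at h6
    simpa [w, ofReal_norm, enorm_eq_nnnorm] using h6
  rw [hf.singularPowSum_eq ha hp0]
  constructor
  · have := tsum_rpow_le_of_substochastic hp hrow hcol hx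
    simp only [ENNReal.coe_rpow_of_nonneg _ hp0.le] at this
    exact this
  · intro hfin heq j
    have h1 := substochastic_eq_of_tsum_rpow_eq hp hrow hcol hx
      (by simp only [ENNReal.coe_rpow_of_nonneg _ hp0.le]; exact hfin)
      (by simp only [ENNReal.coe_rpow_of_nonneg _ hp0.le]; exact heq) j
    have h2 : ∀ i, ‖⟪f i, u j⟫_ℂ‖ₑ ^ 2 * ‖a (f i)‖ₑ ^ 2
        = ‖⟪f i, u j⟫_ℂ‖ₑ ^ 2 * ‖⟪h j, a (u j)⟫_ℂ‖ₑ ^ 2 := by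
      intro i
      by_cases h0 : ⟪f i, u j⟫_ℂ = 0
      · simp [h0]
      · have h3 : w j i ≠ 0 := by
          simp only [w, ne_eq, ENNReal.div_eq_zero_iff, not_or]
          exact ⟨by simp [h0], by simp⟩
        have h4 : ‖a (f i)‖ₑ = ‖⟪h j, a (u j)⟫_ℂ‖ₑ := congrArg _ (h1 i h3)
        rw [h4]
    have h3 := hf.tsum_mul (u j)
    rw [tsum_congr h2, ENNReal.tsum_mul_right, HilbertBasis.tsum_enorm_inner_sq] at h3
    have h4 : ‖a (u j)‖ₑ ^ 2 ≤ ‖⟪h j, a (u j)⟫_ℂ‖ₑ ^ 2 := by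
      rw [← h3]
      exact mul_le_of_le_one_left' (hone _ (hu.norm_le_one j))
    rw [← ofReal_norm, ← ofReal_norm, ← ENNReal.ofReal_pow (norm_nonneg _),
      ← ENNReal.ofReal_pow (norm_nonneg _), ENNReal.ofReal_le_ofReal_iff (by positivity)] at h4
    exact le_of_sq_le_sq h4 (norm_nonneg _)

theorem rpow_half_add_lt {p : ℝ} (hp : 1 < p) {x y : ℝ≥0} (h : x ≠ y) :
    ((x + y) / 2) ^ p < (x ^ p + y ^ p) / 2 := by
  rw [← NNReal.coe_lt_coe]
  push_cast
  have hsc : StrictConvexOn ℝ (Set.Ici 0) fun x : ℝ => x ^ p := strictConvexOn_rpow hp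
  have h1 : (1 / 2 * (x : ℝ) + 1 / 2 * y) ^ p < 1 / 2 * (x : ℝ) ^ p + 1 / 2 * (y : ℝ) ^ p :=
    And.right hsc (Set.mem_Ici.2 x.coe_nonneg) (Set.mem_Ici.2 y.coe_nonneg)
      (fun hxy => h (NNReal.coe_injective hxy)) one_half_pos one_half_pos (add_halves 1)
  calc _ = (1 / 2 * (x : ℝ) + 1 / 2 * y) ^ p := by congr 1; ring
    _ < _ := h1
    _ = _ := by ring

/-- Strict convexity of the `p`-Schatten norm. -/
theorem eq_of_singularPowSum_add {p : ℝ} (hp : 1 < p) {a b : H →L[ℂ] H}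
    (ha : IsCompactOperator a) (hb : IsCompactOperator b) (ha' : singularPowSum p a = 1)
    (hb' : singularPowSum p b = 1) (hab : singularPowSum p (a + b) = 2 ^ p) : a = b := by
  have hp0 : 0 < p := by linarith
  obtain ⟨I, g, hg⟩ := exists_isSingularBasis (isCompactOperator_clm_add ha hb)
  set h : I → H := fun j => ((‖(a + b) (g j)‖⁻¹ : ℝ) : ℂ) • (a + b) (g j) with hh
  have hbh : IsBessel h := hg.isBessel
  have hbg : IsBessel g := fun y => (HilbertBasis.tsum_enorm_inner_sq g y).le
  obtain ⟨hA1, hA2⟩ := tsum_diagonal_rpow_le hp ha hbg hbh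
  obtain ⟨hB1, hB2⟩ := tsum_diagonal_rpow_le hp hb hbg hbh
  set α : I → ℂ := fun j => ⟪h j, a (g j)⟫_ℂ with hα
  set β : I → ℂ := fun j => ⟪h j, b (g j)⟫_ℂ with hβ
  have hsum : ∀ j, α j + β j = (‖(a + b) (g j)‖ : ℂ) := by
    intro j
    simp only [hα, hβ]
    rw [← inner_add_right, ← _root_.add_apply]
    simp only [hh]
    rw [inner_smul_left, inner_self_eq_norm_sq_to_K, Complex.conj_ofReal]
    have h1 : ‖(a + b) (g j)‖⁻¹ * ‖(a + b) (g j)‖ ^ 2 = ‖(a + b) (g j)‖ := by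
      by_cases h0 : ‖(a + b) (g j)‖ = 0
      · rw [h0]; simp
      · field_simp
    have h2 := congrArg Complex.ofReal h1
    push_cast at h2 ⊢
    exact h2
  -- The chain is `1 = ∑ m^p ≤ ∑ ((|α| + |β|) / 2)^p ≤ (∑ |α|^p + ∑ |β|^p) / 2 ≤ 1`, so every step
  -- is an equality, term by term.
  set m : I → ℝ≥0 := fun j => ‖(a + b) (g j)‖₊ / 2 with hm
  have hmle : ∀ j, m j ≤ (‖α j‖₊ + ‖β j‖₊) / 2 := fun j => by
    simp only [hm]
    gcongr
    have := nnnorm_add_le (α j) (β j)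
    rw [hsum] at this
    simpa using this
  have hconv : ∀ x y : ℝ≥0, ((x + y) / 2) ^ p ≤ (x ^ p + y ^ p) / 2 := fun x y => by
    by_cases hxy : x = y
    · subst hxy; simp
    · exact (rpow_half_add_lt hp hxy).le
  have hterm : ∀ j, (m j) ^ p ≤ (‖α j‖₊ ^ p + ‖β j‖₊ ^ p) / 2 := fun j =>
    (NNReal.rpow_le_rpow (hmle j) hp0.le).trans (hconv _ _)
  have hmsum : ∑' j, ((m j ^ p : ℝ≥0) : ℝ≥0∞) = 1 := by
    have h1 : ∀ j, ((m j ^ p : ℝ≥0) : ℝ≥0∞) = ‖(a + b) (g j)‖ₑ ^ p * (2 ^ p)⁻¹ := fun j => by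
      simp only [hm]
      rw [NNReal.div_rpow, ENNReal.coe_div (by positivity), div_eq_mul_inv,
        ENNReal.coe_rpow_of_nonneg _ hp0.le, ENNReal.coe_rpow_of_nonneg _ hp0.le]
      rfl
    rw [tsum_congr h1, ENNReal.tsum_mul_right,
      ← hg.singularPowSum_eq (isCompactOperator_clm_add ha hb) hp0, hab]
    exact ENNReal.mul_inv_cancel (by simp) (ENNReal.rpow_ne_top_of_nonneg hp0.le (by simp))
  have hrhs : ∑' j, (((‖α j‖₊ ^ p + ‖β j‖₊ ^ p) / 2 : ℝ≥0) : ℝ≥0∞)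
      = (∑' j, ‖α j‖ₑ ^ p + ∑' j, ‖β j‖ₑ ^ p) / 2 := by
    rw [div_eq_mul_inv, ← ENNReal.tsum_add, ← ENNReal.tsum_mul_right]
    refine tsum_congr fun j => ?_
    rw [ENNReal.coe_div (by norm_num), ENNReal.coe_add, ENNReal.coe_rpow_of_nonneg _ hp0.le,
      ENNReal.coe_rpow_of_nonneg _ hp0.le, div_eq_mul_inv]
    rfl
  rw [ha'] at hA1
  rw [hb'] at hB1
  have hle : 1 ≤ (∑' j, ‖α j‖ₑ ^ p + ∑' j, ‖β j‖ₑ ^ p) / 2 := by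
    rw [← hrhs, ← hmsum]
    exact ENNReal.tsum_le_tsum fun j => ENNReal.coe_le_coe.2 (hterm j)
  have hle2 : 2 ≤ ∑' j, ‖α j‖ₑ ^ p + ∑' j, ‖β j‖ₑ ^ p := by
    rwa [ENNReal.le_div_iff_mul_le (by simp) (by simp), one_mul] at hle
  have hαs : 1 ≤ ∑' j, ‖α j‖ₑ ^ p := by
    by_contra hc
    have := ENNReal.add_lt_add_of_lt_of_le (ne_top_of_le_ne_top (by simp) hB1) (not_le.1 hc) hB1
    rw [one_add_one_eq_two] at this
    exact (this.trans_le hle2).false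
  have hβs : 1 ≤ ∑' j, ‖β j‖ₑ ^ p := by
    by_contra hc
    have := ENNReal.add_lt_add_of_le_of_lt (ne_top_of_le_ne_top (by simp) hA1) hA1 (not_le.1 hc)
    rw [one_add_one_eq_two] at this
    exact (this.trans_le hle2).false
  have hA3 := hA2 (by simp [ha']) (by rw [ha']; exact hαs)
  have hB3 := hB2 (by simp [hb']) (by rw [hb']; exact hβs)
  have heq : ∀ j, (m j) ^ p = (‖α j‖₊ ^ p + ‖β j‖₊ ^ p) / 2 := fun j => by
    refine ENNReal.coe_injective (eq_of_tsum_eq_of_le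
      (fun j => ENNReal.coe_le_coe.2 (hterm j)) (by rw [hmsum]; simp) ?_ j)
    rw [hrhs, hmsum, ENNReal.div_le_iff (by simp) (by simp), one_mul, ← one_add_one_eq_two]
    exact add_le_add hA1 hB1
  refine HilbertBasis.ext_clm g fun j => ?_
  have h1 : ‖α j‖₊ = ‖β j‖₊ := by
    by_contra hne
    exact ((NNReal.rpow_le_rpow (hmle j) hp0.le).trans_lt (rpow_half_add_lt hp hne)).ne (heq j)
  have h2 : m j = ‖α j‖₊ := by
    have h3 := heq j
    rw [← h1, add_self_div_two] at h3
    exact NNReal.rpow_left_injective hp0.ne' h3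
  have h4 : ‖(a + b) (g j)‖ = 2 * ‖α j‖ := by
    have h3 : ((‖(a + b) (g j)‖₊ / 2 : ℝ≥0) : ℝ) = ‖α j‖ := congrArg NNReal.toReal h2
    rw [NNReal.coe_div, coe_nnnorm, NNReal.coe_ofNat] at h3
    linarith
  have h5 : ‖α j‖ = ‖β j‖ := congrArg NNReal.toReal h1
  -- The moduli agree and the triangle inequality for `α j + β j` is sharp, so the parallelogram law
  -- gives `α j - β j = 0`.
  have h6 : α j = β j := by
    have := parallelogram_law_with_norm ℝ (α j) (β j)
    rw [hsum, Complex.norm_real, norm_norm, h4, ← h5] at this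
    have h7 : ‖α j - β j‖ = 0 := by nlinarith [norm_nonneg (α j - β j)]
    exact sub_eq_zero.1 (norm_eq_zero.1 h7)
  rw [eq_inner_smul_of_norm_le (hbh.norm_le_one j) (hA3 j),
    eq_inner_smul_of_norm_le (hbh.norm_le_one j) (hB3 j)]
  exact congrArg (· • h j) h6

end SchattenTingley

/-! ### Singular values of differences of rank one operators -/

namespace SchattenTingley

open scoped NNReal InnerProductSpace
open InnerProductSpace

variable {H : Type*} [NormedAddCommGroup H] [InnerProductSpace ℂ H]

/-- The squared Hilbert–Schmidt norm of the operator `x ↦ ⟪η₁, x⟫ u₁ + ⟪η₂, x⟫ u₂`. It is used both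
for `T` and for `T* T`, giving the first two moments of the squared singular values. -/
theorem hasSum_norm_sq_two {ι : Type*} (g : HilbertBasis ι ℂ H) (η₁ η₂ u₁ u₂ : H) :
    HasSum (fun j => ‖⟪η₁, g j⟫_ℂ • u₁ + ⟪η₂, g j⟫_ℂ • u₂‖ ^ 2)
      (‖η₁‖ ^ 2 * ‖u₁‖ ^ 2 + ‖η₂‖ ^ 2 * ‖u₂‖ ^ 2 + 2 * (⟪η₂, η₁⟫_ℂ * ⟪u₁, u₂⟫_ℂ).re) := by
  have hsq : ∀ z : ℂ, (starRingEnd ℂ z * z).re = ‖z‖ ^ 2 := fun z => by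
    rw [← Complex.normSq_eq_conj_mul_self, Complex.ofReal_re, Complex.normSq_eq_norm_sq]
  have hself : ∀ η : H, HasSum (fun j => ‖⟪η, g j⟫_ℂ‖ ^ 2) (‖η‖ ^ 2) := fun η => by
    have h1 := Complex.hasSum_re (g.hasSum_inner_mul_inner η η)
    have h2 : (fun i => (⟪η, g i⟫_ℂ * ⟪g i, η⟫_ℂ).re) = fun i => ‖⟪η, g i⟫_ℂ‖ ^ 2 := by
      funext i
      rw [← inner_conj_symm (g i) η, mul_comm, hsq]
    rw [h2] at h1
    rwa [← inner_self_eq_norm_sq (𝕜 := ℂ)]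
  have hmix := Complex.hasSum_re ((g.hasSum_inner_mul_inner η₂ η₁).mul_right ⟪u₁, u₂⟫_ℂ)
  have h := (((hself η₁).mul_right (‖u₁‖ ^ 2)).add ((hself η₂).mul_right (‖u₂‖ ^ 2))).add
    (hmix.mul_left 2)
  have hfun : (fun j => ‖⟪η₁, g j⟫_ℂ • u₁ + ⟪η₂, g j⟫_ℂ • u₂‖ ^ 2)
      = fun j => ‖⟪η₁, g j⟫_ℂ‖ ^ 2 * ‖u₁‖ ^ 2 + ‖⟪η₂, g j⟫_ℂ‖ ^ 2 * ‖u₂‖ ^ 2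
        + 2 * (⟪η₂, g j⟫_ℂ * ⟪g j, η₁⟫_ℂ * ⟪u₁, u₂⟫_ℂ).re := by
    funext j
    rw [@norm_add_sq ℂ, inner_smul_left, inner_smul_right, inner_conj_symm, norm_smul, norm_smul,
      mul_pow, mul_pow, mul_left_comm, ← mul_assoc ⟪η₂, g j⟫_ℂ]
    simp only [RCLike.re_eq_complex_re]
    ring
  rw [hfun]
  exact h

theorem norm_sq_smul_add_smul {η₁ η₂ : H} (h₁ : ‖η₁‖ = 1) (h₂ : ‖η₂‖ = 1) (x y : ℂ) :
    ‖x • η₁ + y • η₂‖ ^ 2 = ‖x‖ ^ 2 + ‖y‖ ^ 2 + 2 * (starRingEnd ℂ x * y * ⟪η₁, η₂⟫_ℂ).re := by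
  rw [@norm_add_sq ℂ, inner_smul_left, inner_smul_right, norm_smul, norm_smul, h₁, h₂, ← mul_assoc]
  simp only [RCLike.re_eq_complex_re]
  ring

theorem inner_smul_add_smul {η₁ η₂ : H} (h₁ : ‖η₁‖ = 1) (h₂ : ‖η₂‖ = 1) (x y x' y' : ℂ) :
    ⟪x • η₁ + y • η₂, x' • η₁ + y' • η₂⟫_ℂ = starRingEnd ℂ x * x' + starRingEnd ℂ y * y'
      + starRingEnd ℂ x * y' * starRingEnd ℂ ⟪η₂, η₁⟫_ℂ + starRingEnd ℂ y * x' * ⟪η₂, η₁⟫_ℂ := by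
  rw [inner_add_left, inner_add_right, inner_add_right]
  simp only [inner_smul_left, inner_smul_right, inner_self_eq_norm_sq_to_K, h₁, h₂]
  rw [inner_conj_symm]
  simp
  ring

/-- With `A = ⟪ξ₁, ξ₂⟫` and `B = ⟪η₂, η₁⟫`, the left side is the squared Hilbert–Schmidt norm of `T*
T` and the right side has the form `(t₁ + t₂)² - 2 t₁ t₂`. -/
theorem second_moment_identity (A B c : ℂ) :
    (‖(1 : ℂ)‖ ^ 2 + ‖-(starRingEnd ℂ c * starRingEnd ℂ A)‖ ^ 2
        + 2 * (starRingEnd ℂ 1 * -(starRingEnd ℂ c * starRingEnd ℂ A) * starRingEnd ℂ B).re)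
      + (‖-(c * A)‖ ^ 2 + ‖c * starRingEnd ℂ c‖ ^ 2
        + 2 * (starRingEnd ℂ (-(c * A)) * (c * starRingEnd ℂ c) * starRingEnd ℂ B).re)
      + 2 * (B * (starRingEnd ℂ 1 * -(c * A)
        + starRingEnd ℂ (-(starRingEnd ℂ c * starRingEnd ℂ A)) * (c * starRingEnd ℂ c)
        + starRingEnd ℂ 1 * (c * starRingEnd ℂ c) * starRingEnd ℂ B
        + starRingEnd ℂ (-(starRingEnd ℂ c * starRingEnd ℂ A)) * -(c * A) * B)).re
      = (1 + ‖c‖ ^ 2 - 2 * (c * (A * B)).re) ^ 2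
        - 2 * (‖c‖ ^ 2 * ((1 - ‖A‖ ^ 2) * (1 - ‖B‖ ^ 2))) := by
  simp only [norm_neg, norm_mul, norm_one, RCLike.norm_conj, mul_pow, Complex.sq_norm,
    Complex.normSq_apply, Complex.mul_re, Complex.mul_im, Complex.neg_re, Complex.neg_im,
    Complex.conj_re, Complex.conj_im, Complex.add_re, Complex.add_im, Complex.one_re,
    Complex.one_im, map_one, map_neg, map_mul, Complex.conj_conj]
  ring

/-- Missing values are padded with `0`, whence the condition `f 0 = 0`. One pair serves for all `f`:
the identity, the square and the power `p / 2`. -/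
theorem exists_pair_of_card_le_two {ι : Type*} (F : Finset ι) (hF : F.card ≤ 2) (t : ι → ℝ)
    (ht : ∀ i, 0 ≤ t i) :
    ∃ t₁ t₂ : ℝ, 0 ≤ t₁ ∧ 0 ≤ t₂ ∧ ∀ f : ℝ → ℝ, f 0 = 0 → ∑ i ∈ F, f (t i) = f t₁ + f t₂ := by
  classical
  have h : F.card = 0 ∨ F.card = 1 ∨ F.card = 2 := by omega
  rcases h with h | h | h
  · rw [Finset.card_eq_zero] at h
    exact ⟨0, 0, le_rfl, le_rfl, fun f hf => by simp [h, hf]⟩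
  · obtain ⟨i, rfl⟩ := Finset.card_eq_one.1 h
    exact ⟨t i, 0, ht i, le_rfl, fun f hf => by simp [hf]⟩
  · obtain ⟨i, j, hij, rfl⟩ := Finset.card_eq_two.1 h
    exact ⟨t i, t j, ht i, ht j, fun f hf => Finset.sum_pair hij⟩

variable [CompleteSpace H]

omit [CompleteSpace H] in
theorem isCompactOperator_rankOne (ξ η : H) : IsCompactOperator (rankOne ℂ ξ η : H →L[ℂ] H) := by
  have h : IsCompactOperator (innerSL ℂ η : H →L[ℂ] ℂ) :=
    isCompactOperator_of_locallyCompactSpace_dom (innerSL ℂ η)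
  exact h.clm_comp (ContinuousLinearMap.toSpanSingleton ℂ ξ)

theorem star_rankOne (ξ η : H) : star (rankOne ℂ ξ η : H →L[ℂ] H) = rankOne ℂ η ξ := by
  rw [ContinuousLinearMap.star_eq_adjoint, adjoint_rankOne]

omit [CompleteSpace H] in
theorem mul_rankOne (T : H →L[ℂ] H) (ξ η : H) : T * rankOne ℂ ξ η = rankOne ℂ (T ξ) η :=
  comp_rankOne ξ η T

/-- The singular values of a difference of two rank one operators. -/
theorem exists_singularPowSum_sub_smul_rankOne {ξ₁ ξ₂ η₁ η₂ : H} (hξ₁ : ‖ξ₁‖ = 1) (hξ₂ : ‖ξ₂‖ = 1)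
    (hη₁ : ‖η₁‖ = 1) (hη₂ : ‖η₂‖ = 1) (c : ℂ) :
    ∃ t₁ t₂ : ℝ, 0 ≤ t₁ ∧ 0 ≤ t₂ ∧
      t₁ + t₂ = 1 + ‖c‖ ^ 2 - 2 * (c * (⟪ξ₁, ξ₂⟫_ℂ * ⟪η₂, η₁⟫_ℂ)).re ∧
      t₁ * t₂ = ‖c‖ ^ 2 * ((1 - ‖⟪ξ₁, ξ₂⟫_ℂ‖ ^ 2) * (1 - ‖⟪η₂, η₁⟫_ℂ‖ ^ 2)) ∧
      ∀ p : ℝ, 0 < p → singularPowSum p (rankOne ℂ ξ₁ η₁ - c • rankOne ℂ ξ₂ η₂ : H →L[ℂ] H)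
        = ENNReal.ofReal (t₁ ^ (p / 2) + t₂ ^ (p / 2)) := by
  classical
  set T : H →L[ℂ] H := rankOne ℂ ξ₁ η₁ - c • rankOne ℂ ξ₂ η₂ with hT
  have hTc : IsCompactOperator T :=
    isCompactOperator_clm_sub (isCompactOperator_rankOne _ _) ((isCompactOperator_rankOne _ _).smul c)
  obtain ⟨I, g, hg⟩ := exists_isSingularBasis hTc
  have hTx : ∀ x, T x = ⟪η₁, x⟫_ℂ • ξ₁ + ⟪η₂, x⟫_ℂ • (-c • ξ₂) := fun x => by
    rw [hT, _root_.sub_apply, _root_.smul_apply, rankOne_apply, rankOne_apply, sub_eq_add_neg,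
      neg_smul, smul_neg, smul_comm c]
  -- The nonzero images are orthogonal and lie in the span of `ξ₁` and `ξ₂`, so there are at most
  -- two of them.
  have hli : LinearIndependent ℂ fun j : {j // T (g j) ≠ 0} => T (g j) :=
    linearIndependent_of_ne_zero_of_inner_eq_zero (fun j => j.2)
      (fun i j hij => hg.inner_apply_eq_zero fun h => hij (Subtype.ext h))
  set V : Submodule ℂ H := Submodule.span ℂ (({ξ₁, ξ₂} : Finset H) : Set H) with hV
  have hVmem : ∀ x, T x ∈ V := fun x => by
    rw [hTx]
    refine V.add_mem (V.smul_mem _ (Submodule.subset_span (by simp)))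
      (V.smul_mem _ (V.smul_mem _ (Submodule.subset_span (by simp))))
  have hli' : LinearIndependent ℂ fun j : {j // T (g j) ≠ 0} => (⟨T (g j), hVmem _⟩ : V) :=
    LinearIndependent.of_comp V.subtype hli
  have hfin : Finite {j // T (g j) ≠ 0} := hli'.finite
  have := Fintype.ofFinite {j // T (g j) ≠ 0}
  have hcard : Fintype.card {j // T (g j) ≠ 0} ≤ 2 :=
    hli'.fintype_card_le_finrank.trans ((finrank_span_finset_le_card _).trans Finset.card_le_two)
  set F : Finset I := Finset.univ.map (Function.Embedding.subtype fun j => T (g j) ≠ 0) with hF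
  have hFmem : ∀ j, j ∉ F → T (g j) = 0 := fun j hj => by
    by_contra h
    exact hj (by simp [hF, h])
  have hFc : F.card ≤ 2 := by simpa [hF] using hcard
  obtain ⟨t₁, t₂, h₁, h₂, hsum⟩ := exists_pair_of_card_le_two F hFc (fun j => ‖T (g j)‖ ^ 2)
    (fun j => sq_nonneg _)
  have hs1 : t₁ + t₂ = 1 + ‖c‖ ^ 2 - 2 * (c * (⟪ξ₁, ξ₂⟫_ℂ * ⟪η₂, η₁⟫_ℂ)).re := by
    have h1 := hasSum_norm_sq_two g η₁ η₂ ξ₁ (-c • ξ₂)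
    simp_rw [← hTx] at h1
    have h3 := h1.unique (hasSum_sum_of_ne_finset_zero (s := F) fun j hj => by simp [hFmem j hj])
    rw [hsum (fun x => x) rfl, hξ₁, hη₁, hη₂, norm_smul, hξ₂, norm_neg, inner_smul_right] at h3
    rw [← h3]
    have : ⟪η₂, η₁⟫_ℂ * (-c * ⟪ξ₁, ξ₂⟫_ℂ) = -(c * (⟪ξ₁, ξ₂⟫_ℂ * ⟪η₂, η₁⟫_ℂ)) := by ring
    rw [this, Complex.neg_re]
    ring
  have hs2 : t₁ ^ 2 + t₂ ^ 2 = (t₁ + t₂) ^ 2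
      - 2 * (‖c‖ ^ 2 * ((1 - ‖⟪ξ₁, ξ₂⟫_ℂ‖ ^ 2) * (1 - ‖⟪η₂, η₁⟫_ℂ‖ ^ 2))) := by
    have h1 := hasSum_norm_sq_two g η₁ η₂ (star T ξ₁) (star T (-c • ξ₂))
    have hstar : ∀ x, star T x = ⟪ξ₁, x⟫_ℂ • η₁ - (starRingEnd ℂ c * ⟪ξ₂, x⟫_ℂ) • η₂ := fun x => by
      rw [hT, star_sub, star_smul, star_rankOne, star_rankOne, _root_.sub_apply, _root_.smul_apply,
        rankOne_apply, rankOne_apply, smul_smul]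
      rfl
    have hTT : ∀ j, ‖⟪η₁, g j⟫_ℂ • star T ξ₁ + ⟪η₂, g j⟫_ℂ • star T (-c • ξ₂)‖ ^ 2
        = (‖T (g j)‖ ^ 2) ^ 2 := fun j => by
      rw [← map_smul, ← map_smul, ← map_add, ← hTx, hg j, norm_smul, g.orthonormal.1]
      simp
    simp_rw [hTT] at h1
    have h3 := h1.unique (hasSum_sum_of_ne_finset_zero (s := F) fun j hj => by simp [hFmem j hj])
    rw [hsum (fun x => x ^ 2) (by simp)] at h3
    have hu1 : star T ξ₁ = (1 : ℂ) • η₁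
        + (-(starRingEnd ℂ c * starRingEnd ℂ ⟪ξ₁, ξ₂⟫_ℂ)) • η₂ := by
      rw [hstar, inner_self_eq_norm_sq_to_K, hξ₁, inner_conj_symm, neg_smul, ← sub_eq_add_neg]
      simp
    have hu2 : star T (-c • ξ₂) = (-(c * ⟪ξ₁, ξ₂⟫_ℂ)) • η₁ + (c * starRingEnd ℂ c) • η₂ := by
      rw [hstar, inner_smul_right, inner_smul_right, inner_self_eq_norm_sq_to_K, hξ₂,
        sub_eq_add_neg, ← neg_smul]
      congr 2
      · ring
      · simp [mul_comm]
    rw [hη₁, hη₂, hu1, hu2, norm_sq_smul_add_smul hη₁ hη₂, norm_sq_smul_add_smul hη₁ hη₂,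
      inner_smul_add_smul hη₁ hη₂, ← inner_conj_symm η₁ η₂] at h3
    rw [← h3, hs1, ← second_moment_identity]
    ring
  refine ⟨t₁, t₂, h₁, h₂, hs1, by linarith, fun p hp => ?_⟩
  rw [hg.singularPowSum_eq hTc hp, tsum_eq_sum (s := F) fun j hj => by simp [hFmem j hj, hp]]
  have h4 := hsum (fun x => x ^ (p / 2)) (Real.zero_rpow (by linarith))
  rw [← h4, ENNReal.ofReal_sum_of_nonneg (fun j _ => by positivity)]
  refine Finset.sum_congr rfl fun j _ => ?_
  rw [← Real.rpow_natCast, ← Real.rpow_mul (norm_nonneg _), ← ofReal_norm,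
    ENNReal.ofReal_rpow_of_nonneg (norm_nonneg _) hp.le]
  congr 2; push_cast; ring

/-! ### Minimal partial isometries and the orthogonality relation -/

theorem isMinimalPartialIsometry_rankOne {ξ η : H} (hξ : ‖ξ‖ = 1) (hη : ‖η‖ = 1) :
    IsMinimalPartialIsometry (rankOne ℂ ξ η : H →L[ℂ] H) := by
  constructor
  · rw [star_rankOne, mul_rankOne, mul_rankOne]
    simp [hξ, hη]
  · have h : LinearMap.range ((rankOne ℂ ξ η : H →L[ℂ] H) : H →ₗ[ℂ] H) = Submodule.span ℂ {ξ} := by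
      ext x
      rw [Submodule.mem_span_singleton, LinearMap.mem_range]
      constructor
      · rintro ⟨y, rfl⟩
        exact ⟨⟪η, y⟫_ℂ, rfl⟩
      · rintro ⟨c, rfl⟩
        refine ⟨c • η, ?_⟩
        change ⟪η, c • η⟫_ℂ • ξ = c • ξ
        rw [inner_smul_right, inner_self_eq_norm_sq_to_K, hη]; simp
    rw [h, finrank_span_singleton]
    rintro rfl
    simp at hξ

theorem exists_eq_rankOne {e : H →L[ℂ] H} (he : IsMinimalPartialIsometry e) :
    ∃ ξ η : H, ‖ξ‖ = 1 ∧ ‖η‖ = 1 ∧ e = rankOne ℂ ξ η := by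
  obtain ⟨h1, h2⟩ := he
  obtain ⟨u, hu0, hu⟩ := finrank_eq_one_iff'.1 h2
  have hune : ‖(u : H)‖ ≠ 0 := by simpa using hu0
  set ξ : H := ((‖(u : H)‖⁻¹ : ℝ) : ℂ) • (u : H) with hξdef
  have hξ : ‖ξ‖ = 1 := by
    rw [hξdef, norm_smul, Complex.norm_real, norm_inv, norm_norm, inv_mul_cancel₀ hune]
  have hrep : e = rankOne ℂ ξ (star e ξ) := by
    ext y
    obtain ⟨c, hc⟩ := hu ⟨e y, ⟨y, rfl⟩⟩
    have hc' : e y = c • (u : H) := (congrArg Subtype.val hc).symm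
    have hc'' : e y = (c * ‖(u : H)‖) • ξ := by
      have hne : (‖(u : H)‖ : ℂ) ≠ 0 := by exact_mod_cast hune
      rw [hξdef, smul_smul, hc']
      congr 1
      push_cast
      field_simp
    rw [rankOne_apply, inner_star_apply_left, hc'', inner_smul_right, inner_self_eq_norm_sq_to_K, hξ]
    simp
  refine ⟨ξ, star e ξ, hξ, ?_, hrep⟩
  set η := star e ξ with hη
  have hη0 : η ≠ 0 := by
    intro h0
    rw [h0] at hrep
    have : e = 0 := by rw [hrep]; simp
    obtain ⟨⟨w, y, hy⟩, rfl⟩ : ∃ w, w = u := ⟨u, rfl⟩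
    apply hune
    rw [norm_eq_zero]
    change w = 0
    rw [← hy, this]; rfl
  -- With `e = ξ ⊗ η` and `‖ξ‖ = 1`, the identity `e e* e = e` reads `‖η‖² e = e`.
  have h3 := h1
  rw [hrep, star_rankOne, mul_rankOne, mul_rankOne] at h3
  have h4 := congrArg (fun T : H →L[ℂ] H => ⟪ξ, T η⟫_ℂ) h3
  simp only [rankOne_apply, inner_smul_right, inner_self_eq_norm_sq_to_K, hξ] at h4
  have h5 : (‖η‖ ^ 2) * (‖η‖ ^ 2) = ‖η‖ ^ 2 := by
    have h6 : ((‖η‖ : ℂ) ^ 2) * ((‖η‖ : ℂ) ^ 2) = (‖η‖ : ℂ) ^ 2 := by simpa using h4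
    exact_mod_cast h6
  have h7 : ‖η‖ ^ 2 = 1 := mul_left_cancel₀ (pow_ne_zero 2 (norm_ne_zero_iff.2 hη0)) (by rw [h5, mul_one])
  exact (pow_eq_one_iff_of_nonneg (norm_nonneg _) two_ne_zero).1 h7

theorem singularPowSum_rankOne {p : ℝ} (hp : 0 < p) {ξ η : H} (hξ : ‖ξ‖ = 1) (hη : ‖η‖ = 1) :
    singularPowSum p (rankOne ℂ ξ η : H →L[ℂ] H) = 1 := by
  obtain ⟨t₁, t₂, h1, h2, h3, h4, h5⟩ :=
    exists_singularPowSum_sub_smul_rankOne hξ hξ hη hη 0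
  have h6 := h5 p hp
  rw [zero_smul, sub_zero] at h6
  have hp2 : p / 2 ≠ 0 := by linarith
  rw [h6]
  simp only [norm_zero, ne_eq, OfNat.ofNat_ne_zero, not_false_eq_true, zero_pow, add_zero, zero_mul,
    Complex.zero_re, mul_zero, sub_zero] at h3 h4
  rcases mul_eq_zero.1 h4 with h | h
  · have : t₂ = 1 := by linarith
    simp [h, this, hp2]
  · have : t₁ = 1 := by linarith
    simp [h, this, hp2]

theorem peirceCoeff_rankOne {ξ₁ ξ₂ η₁ η₂ : H} (hξ₁ : ‖ξ₁‖ = 1) (hη₁ : ‖η₁‖ = 1) :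
    peirceCoeff (rankOne ℂ ξ₁ η₁ : H →L[ℂ] H) (rankOne ℂ ξ₂ η₂) = ⟪ξ₁, ξ₂⟫_ℂ * ⟪η₂, η₁⟫_ℂ := by
  have he := isMinimalPartialIsometry_rankOne hξ₁ hη₁
  refine (existsUnique_peirceTwo_eq_smul he (rankOne ℂ ξ₂ η₂)).unique
    (peirceTwo_eq_peirceCoeff_smul he _) ?_
  ext x
  simp only [peirceTwo, star_rankOne, mul_apply_eq_comp, rankOne_apply, map_smul, smul_smul,
    _root_.smul_apply, inner_self_eq_norm_sq_to_K, hξ₁, hη₁]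
  congr 1
  simp
  ring

theorem orthogonalTo_rankOne_iff {z : H →L[ℂ] H} {α β : H} (hα : α ≠ 0) (hβ : β ≠ 0) :
    OrthogonalTo z (rankOne ℂ α β) ↔ z β = 0 ∧ star z α = 0 := by
  rw [OrthogonalTo, star_rankOne, mul_rankOne, mul_rankOne, rankOne_eq_zero, rankOne_eq_zero]
  simp [hα, hβ]

/-- Testing against all admissible pairs shows that `x` kills the complement of `η` and `x*` kills
the complement of `ξ`; such an operator is a multiple of `ξ ⊗ η`. -/
theorem eq_smul_of_forall_orthogonal {ξ η : H} (hξ : ‖ξ‖ = 1) (hη : ‖η‖ = 1) {x : H →L[ℂ] H}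
    (h : ∀ α β : H, ‖α‖ = 1 → ‖β‖ = 1 → ⟪α, ξ⟫_ℂ = 0 → ⟪β, η⟫_ℂ = 0 →
      OrthogonalTo x (rankOne ℂ α β)) :
    ∃ c : ℂ, x = c • rankOne ℂ ξ η := by
  have hproj : ∀ {ζ : H}, ‖ζ‖ = 1 → ∀ y, ⟪y - ⟪ζ, y⟫_ℂ • ζ, ζ⟫_ℂ = 0 := fun {ζ} hζ y => by
    rw [inner_sub_left, inner_smul_left, inner_self_eq_norm_sq_to_K, hζ, inner_conj_symm]
    simp
  have hunit : ∀ {ζ y : H}, y ≠ 0 → ⟪y, ζ⟫_ℂ = 0 →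
      ‖((‖y‖⁻¹ : ℝ) : ℂ) • y‖ = 1 ∧ ⟪((‖y‖⁻¹ : ℝ) : ℂ) • y, ζ⟫_ℂ = 0 := fun {ζ y} hy h0 => by
    refine ⟨?_, by rw [inner_smul_left, h0, mul_zero]⟩
    rw [norm_smul, Complex.norm_real, norm_inv, norm_norm, inv_mul_cancel₀ (norm_ne_zero_iff.2 hy)]
  have hmain : ∀ y z : H, y ≠ 0 → ⟪y, ξ⟫_ℂ = 0 → z ≠ 0 → ⟪z, η⟫_ℂ = 0 →
      x z = 0 ∧ star x y = 0 := by
    intro y z hy hy0 hz hz0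
    obtain ⟨hy1, hy2⟩ := hunit hy hy0
    obtain ⟨hz1, hz2⟩ := hunit hz hz0
    have h1 := (orthogonalTo_rankOne_iff (by intro h0; rw [h0, norm_zero] at hy1; exact zero_ne_one hy1)
      (by intro h0; rw [h0, norm_zero] at hz1; exact zero_ne_one hz1)).1 (h _ _ hy1 hz1 hy2 hz2)
    have hz3 : ((‖z‖⁻¹ : ℝ) : ℂ) ≠ 0 := by simpa using hz
    have hy3 : ((‖y‖⁻¹ : ℝ) : ℂ) ≠ 0 := by simpa using hy
    rw [map_smul, map_smul, smul_eq_zero_iff_right hz3, smul_eq_zero_iff_right hy3] at h1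
    exact h1
  have hξ0 : ξ ≠ 0 := by rintro rfl; simp at hξ
  have hη0 : η ≠ 0 := by rintro rfl; simp at hη
  refine ⟨⟪ξ, x η⟫_ℂ, ?_⟩
  -- In dimension one there is nothing to test against, but every operator is then a multiple of `ξ
  -- ⊗ η`. Otherwise both complements are nonzero, as a test operator requires.
  by_cases hdim : ∀ y, ∃ c : ℂ, y = c • ξ
  · have hself : ∀ y, y = ⟪ξ, y⟫_ℂ • ξ := fun y => by
      obtain ⟨c, rfl⟩ := hdim y
      rw [inner_smul_right, inner_self_eq_norm_sq_to_K, hξ]; simp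
    have hself' : ∀ y, y = ⟪η, y⟫_ℂ • η := fun y => by
      obtain ⟨d, hd⟩ := hdim η
      obtain ⟨c, hc⟩ := hdim y
      have hd0 : d ≠ 0 := by rintro rfl; exact hη0 (by simpa using hd)
      have hy : y = (c / d) • η := by
        rw [hd, smul_smul, div_mul_cancel₀ _ hd0, hc]
      rw [hy, inner_smul_right, inner_self_eq_norm_sq_to_K, hη]; simp
    ext y
    rw [_root_.smul_apply, rankOne_apply, smul_comm, ← hself, ← map_smul, ← hself']
  · push Not at hdim
    obtain ⟨y₀, hy₀⟩ := hdim
    have hα : ∃ α, α ≠ 0 ∧ ⟪α, ξ⟫_ℂ = 0 :=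
      ⟨y₀ - ⟪ξ, y₀⟫_ℂ • ξ, fun h0 => hy₀ _ (sub_eq_zero.1 h0), hproj hξ y₀⟩
    have hβ : ∃ β, β ≠ 0 ∧ ⟪β, η⟫_ℂ = 0 := by
      by_contra hc
      push Not at hc
      have hall : ∀ y, y = ⟪η, y⟫_ℂ • η := fun y => by
        by_contra hy
        exact hc _ (sub_ne_zero.2 hy) (hproj hη y)
      have hd0 : ⟪η, ξ⟫_ℂ ≠ 0 := fun h0 => hξ0 (by rw [hall ξ, h0, zero_smul])
      refine hy₀ (⟪η, y₀⟫_ℂ / ⟪η, ξ⟫_ℂ) ?_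
      have h1 : (⟪η, y₀⟫_ℂ / ⟪η, ξ⟫_ℂ) • ⟪η, ξ⟫_ℂ • η = y₀ := by
        rw [smul_smul, div_mul_cancel₀ _ hd0, ← hall]
      rw [← hall] at h1
      exact h1.symm
    obtain ⟨α, hα0, hα1⟩ := hα
    obtain ⟨β, hβ0, hβ1⟩ := hβ
    have hx : ∀ z, ⟪z, η⟫_ℂ = 0 → x z = 0 := fun z hz => by
      by_cases hz0 : z = 0
      · rw [hz0, map_zero]
      · exact (hmain α z hα0 hα1 hz0 hz).1
    have hxs : ∀ z, ⟪z, ξ⟫_ℂ = 0 → star x z = 0 := fun z hz => by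
      by_cases hz0 : z = 0
      · rw [hz0, map_zero]
      · exact (hmain z β hz0 hz hβ0 hβ1).2
    have hr : ∀ y, x y = ⟪ξ, x y⟫_ℂ • ξ := fun y => by
      have h1 := hxs _ (hproj hξ (x y))
      have h2 : ⟪x y - ⟪ξ, x y⟫_ℂ • ξ, x y⟫_ℂ = 0 := by
        rw [← inner_star_apply_left, h1, inner_zero_left]
      have h3 : ⟪x y - ⟪ξ, x y⟫_ℂ • ξ, x y - ⟪ξ, x y⟫_ℂ • ξ⟫_ℂ = 0 := by
        rw [inner_sub_right, h2, inner_smul_right, hproj hξ, mul_zero, sub_zero]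
      exact sub_eq_zero.1 (inner_self_eq_zero.1 h3)
    ext y
    have h1 := hx _ (hproj hη y)
    rw [map_sub, map_smul, sub_eq_zero] at h1
    rw [_root_.smul_apply, rankOne_apply, smul_comm, ← hr, h1]

/-- An operator that is not a minimal partial isometry dominates two orthogonal ones. -/
theorem exists_orthogonal_pair {p : ℝ} (hp : 0 < p) {a : H →L[ℂ] H} (ha : IsCompactOperator a)
    (ha1 : singularPowSum p a = 1) (hn : ¬ IsMinimalPartialIsometry a) :
    ∃ x y : H →L[ℂ] H, IsMinimalPartialIsometry x ∧ IsMinimalPartialIsometry y ∧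
      OrthogonalTo x y ∧ ∀ z, OrthogonalTo z a → OrthogonalTo z x ∧ OrthogonalTo z y := by
  obtain ⟨I, g, hg⟩ := exists_isSingularBasis ha
  have hsum := hg.singularPowSum_eq ha hp
  have hne : ∃ j, a (g j) ≠ 0 := by
    by_contra hc
    push Not at hc
    rw [ha1] at hsum
    simp [hc, hp] at hsum
  obtain ⟨j, hj⟩ := hne
  -- With a single nonzero image, unit norm forces `‖a (g j)‖ = 1`, so `a` would be a minimal
  -- partial isometry.
  have hne2 : ∃ k, k ≠ j ∧ a (g k) ≠ 0 := by
    by_contra hc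
    push Not at hc
    rw [ha1, tsum_eq_single j fun k hk => by simp [hc k hk, hp]] at hsum
    have h1 : ‖a (g j)‖ = 1 := by
      have h2 : ‖a (g j)‖ₑ = 1 := by
        have h3 := congrArg (· ^ p⁻¹) hsum
        simpa [← ENNReal.rpow_mul, hp.ne'] using h3.symm
      simpa [← ofReal_norm] using h2
    apply hn
    have h3 : a = rankOne ℂ (a (g j)) (g j) := by
      refine HilbertBasis.ext_clm g fun k => ?_
      rw [rankOne_apply]
      by_cases hk : k = j
      · rw [hk, inner_self_eq_norm_sq_to_K, g.orthonormal.1]; simp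
      · rw [hc k hk, g.orthonormal.2 (Ne.symm hk), zero_smul]
    rw [h3]
    exact isMinimalPartialIsometry_rankOne h1 (g.orthonormal.1 j)
  obtain ⟨k, hkj, hk⟩ := hne2
  let v : I → H := fun i => ((‖a (g i)‖⁻¹ : ℝ) : ℂ) • a (g i)
  have hv : ∀ i, a (g i) ≠ 0 → ‖v i‖ = 1 := fun i hi => by
    simp only [v]
    rw [norm_smul, Complex.norm_real, norm_inv, norm_norm, inv_mul_cancel₀ (norm_ne_zero_iff.2 hi)]
  have hv0 : ∀ i, a (g i) ≠ 0 → v i ≠ 0 := fun i hi h0 => by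
    have := hv i hi
    simp [h0] at this
  have hg0 : ∀ i, g i ≠ 0 := fun i => g.orthonormal.ne_zero i
  have hz : ∀ z, OrthogonalTo z a → ∀ i, a (g i) ≠ 0 → OrthogonalTo z (rankOne ℂ (v i) (g i)) := by
    intro z hza i hi
    rw [orthogonalTo_rankOne_iff (hv0 i hi) (hg0 i)]
    constructor
    · have h1 := congrArg (fun T : H →L[ℂ] H => T (a (g i))) hza.1
      have h2 : z (star a (a (g i))) = 0 := h1
      rw [hg i, map_smul, smul_eq_zero_iff_right] at h2
      · exact h2
      · simpa using hi
    · have h1 : star z (a (g i)) = 0 := congrArg (fun T : H →L[ℂ] H => T (g i)) hza.2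
      rw [map_smul, h1, smul_zero]
  refine ⟨rankOne ℂ (v j) (g j), rankOne ℂ (v k) (g k),
    isMinimalPartialIsometry_rankOne (hv j hj) (g.orthonormal.1 j),
    isMinimalPartialIsometry_rankOne (hv k hk) (g.orthonormal.1 k), ?_,
    fun z hza => ⟨hz z hza j hj, hz z hza k hk⟩⟩
  rw [orthogonalTo_rankOne_iff (hv0 k hk) (hg0 k), star_rankOne, rankOne_apply, rankOne_apply,
    g.orthonormal.2 (Ne.symm hkj)]
  simp only [v]
  rw [inner_smul_left, inner_smul_right, hg.inner_apply_eq_zero (Ne.symm hkj)]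
  simp

end SchattenTingley

/-! ### Recovering the Peirce coefficient from distances -/

namespace SchattenTingley

open scoped NNReal InnerProductSpace
open InnerProductSpace

section PowerSums

/-- When the products agree, `(s₁ - t₁)(s₁ - t₂) = s₁ (s₁ + s₂ - t₁ - t₂)`. Read for the numbers
themselves this puts both `t`'s below the larger `s`; read for their `q`-th powers, whose products
also agree, it gives the conclusion. -/
theorem rpow_add_rpow_lt_of_add_lt {q t₁ t₂ s₁ s₂ : ℝ} (hq : 0 < q) (ht₁ : 0 ≤ t₁) (ht₂ : 0 ≤ t₂)
    (hs₁ : 0 ≤ s₁) (hs₂ : 0 ≤ s₂) (hmul : t₁ * t₂ = s₁ * s₂) (hadd : t₁ + t₂ < s₁ + s₂) :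
    t₁ ^ q + t₂ ^ q < s₁ ^ q + s₂ ^ q := by
  wlog hs : s₂ ≤ s₁ generalizing s₁ s₂
  · rw [add_comm (s₁ ^ q)]
    exact this hs₂ hs₁ (by rw [hmul, mul_comm]) (by rwa [add_comm s₂]) (le_of_not_ge hs)
  have hpos : 0 < s₁ := by linarith
  have hprod : 0 < (s₁ - t₁) * (s₁ - t₂) := by
    have : (s₁ - t₁) * (s₁ - t₂) = s₁ * (s₁ + s₂ - (t₁ + t₂)) := by linear_combination hmul
    rw [this]
    exact mul_pos hpos (by linarith)
  have hlt : t₁ < s₁ ∧ t₂ < s₁ := by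
    rcases pos_and_pos_or_neg_and_neg_of_mul_pos hprod with h | h
    · constructor <;> linarith
    · exfalso
      nlinarith [mul_nonneg hs₁ (sub_nonneg.2 hs)]
  have h1 := Real.rpow_lt_rpow ht₁ hlt.1 hq
  have h2 := Real.rpow_lt_rpow ht₂ hlt.2 hq
  have h3 : t₁ ^ q * t₂ ^ q = s₁ ^ q * s₂ ^ q := by
    rw [← Real.mul_rpow ht₁ ht₂, ← Real.mul_rpow hs₁ hs₂, hmul]
  have h4 : 0 < s₁ ^ q := Real.rpow_pos_of_pos hpos q
  have h5 : 0 < s₁ ^ q * (s₁ ^ q + s₂ ^ q - (t₁ ^ q + t₂ ^ q)) := by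
    have := mul_pos (sub_pos.2 h1) (sub_pos.2 h2)
    nlinarith
  have := (mul_pos_iff_of_pos_left h4).1 h5
  linarith

theorem add_eq_add_of_rpow_add_rpow_eq {q t₁ t₂ s₁ s₂ : ℝ} (hq : 0 < q) (ht₁ : 0 ≤ t₁)
    (ht₂ : 0 ≤ t₂) (hs₁ : 0 ≤ s₁) (hs₂ : 0 ≤ s₂) (hmul : t₁ * t₂ = s₁ * s₂)
    (h : t₁ ^ q + t₂ ^ q = s₁ ^ q + s₂ ^ q) : t₁ + t₂ = s₁ + s₂ := by
  rcases lt_trichotomy (t₁ + t₂) (s₁ + s₂) with h1 | h1 | h1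
  · exact absurd h (rpow_add_rpow_lt_of_add_lt hq ht₁ ht₂ hs₁ hs₂ hmul h1).ne
  · exact h1
  · exact absurd h (rpow_add_rpow_lt_of_add_lt hq hs₁ hs₂ ht₁ ht₂ hmul.symm h1).ne'

/-- With equal sums, the smaller product belongs to the more spread-out pair; `s₁` and `s₂` are
complementary convex combinations of `t₁` and `t₂`. -/
theorem add_apply_lt_of_strictConvexOn {f : ℝ → ℝ} (hf : StrictConvexOn ℝ (Set.Ici 0) f)
    {t₁ t₂ s₁ s₂ : ℝ} (ht₁ : 0 ≤ t₁) (ht₂ : 0 ≤ t₂)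
    (hadd : t₁ + t₂ = s₁ + s₂) (hmul : t₁ * t₂ < s₁ * s₂) :
    f s₁ + f s₂ < f t₁ + f t₂ := by
  wlog ht : t₂ ≤ t₁ generalizing t₁ t₂
  · rw [add_comm (f t₁)]
    exact this ht₂ ht₁ (by rwa [add_comm t₂]) (by rwa [mul_comm t₂]) (le_of_not_ge ht)
  wlog hs : s₂ ≤ s₁ generalizing s₁ s₂
  · rw [add_comm (f s₁)]
    exact this (by rwa [add_comm s₂]) (by rwa [mul_comm s₂]) (le_of_not_ge hs)
  have hprod : 0 < (t₁ - s₁) * (t₁ - s₂) := by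
    have : (t₁ - s₁) * (t₁ - s₂) = s₁ * s₂ - t₁ * t₂ := by linear_combination t₁ * hadd
    rw [this]; linarith
  have h2 : 0 < t₁ - s₂ := by
    rcases pos_and_pos_or_neg_and_neg_of_mul_pos hprod with h | h
    · exact h.2
    · linarith
  have h1 : 0 < t₁ - s₁ := (pos_iff_pos_of_mul_pos hprod).2 h2
  have hpos : 0 < t₁ - t₂ := by linarith
  set l := (s₁ - t₂) / (t₁ - t₂) with hl
  have hl0 : 0 < l := div_pos (by linarith) hpos
  have hl1 : 0 < 1 - l := by
    have : 1 - l = (t₁ - s₁) / (t₁ - t₂) := by rw [hl]; field_simp; ring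
    rw [this]; exact div_pos h1 hpos
  have hls : l * (t₁ - t₂) = s₁ - t₂ := div_mul_cancel₀ _ hpos.ne'
  have e1 : l * t₁ + (1 - l) * t₂ = s₁ := by linear_combination hls
  have e2 : (1 - l) * t₁ + l * t₂ = s₂ := by linear_combination hadd - hls
  have c1 := And.right hf (Set.mem_Ici.2 ht₁) (Set.mem_Ici.2 ht₂) (sub_ne_zero.1 hpos.ne') hl0 hl1
    (by ring)
  have c2 := And.right hf (Set.mem_Ici.2 ht₁) (Set.mem_Ici.2 ht₂) (sub_ne_zero.1 hpos.ne') hl1 hl0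
    (by ring)
  simp only [smul_eq_mul] at c1 c2
  rw [e1] at c1
  rw [e2] at c2
  linarith

theorem mul_eq_mul_of_rpow_add_rpow_eq {q t₁ t₂ s₁ s₂ : ℝ} (hq : 0 < q) (hq1 : q ≠ 1)
    (ht₁ : 0 ≤ t₁) (ht₂ : 0 ≤ t₂) (hs₁ : 0 ≤ s₁) (hs₂ : 0 ≤ s₂) (hadd : t₁ + t₂ = s₁ + s₂)
    (h : t₁ ^ q + t₂ ^ q = s₁ ^ q + s₂ ^ q) : t₁ * t₂ = s₁ * s₂ := by
  have key : ∀ f : ℝ → ℝ, StrictConvexOn ℝ (Set.Ici 0) f → f t₁ + f t₂ = f s₁ + f s₂ →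
      t₁ * t₂ = s₁ * s₂ := by
    intro f hf h
    rcases lt_trichotomy (t₁ * t₂) (s₁ * s₂) with h1 | h1 | h1
    · exact absurd h (add_apply_lt_of_strictConvexOn hf ht₁ ht₂ hadd h1).ne'
    · exact h1
    · exact absurd h (add_apply_lt_of_strictConvexOn hf hs₁ hs₂ hadd.symm h1).ne
  rcases hq1.lt_or_gt with hq1 | hq1
  · refine key _ (Real.strictConcaveOn_rpow hq hq1).neg ?_
    simp only [Pi.neg_apply]
    linarith
  · exact key _ (strictConvexOn_rpow hq1) h

theorem rpow_add_rpow_eq_of_add_eq_of_mul_eq {q t₁ t₂ s₁ s₂ : ℝ}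
    (hadd : t₁ + t₂ = s₁ + s₂) (hmul : t₁ * t₂ = s₁ * s₂) :
    t₁ ^ q + t₂ ^ q = s₁ ^ q + s₂ ^ q := by
  have h : (t₁ - s₁) * (t₁ - s₂) = 0 := by linear_combination t₁ * hadd - hmul
  rcases mul_eq_zero.1 h with h | h
  · have h1 : t₁ = s₁ := by linarith
    have h2 : t₂ = s₂ := by linarith
    rw [h1, h2]
  · have h1 : t₁ = s₂ := by linarith
    have h2 : t₂ = s₁ := by linarith
    rw [h1, h2, add_comm]

end PowerSums

section ComplexNumbers

theorem exists_norm_eq_one_mul_re_eq_zero (z : ℂ) : ∃ c : ℂ, ‖c‖ = 1 ∧ (c * z).re = 0 := by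
  by_cases hz : z = 0
  · exact ⟨1, by simp [hz]⟩
  · have hn : (‖z‖ : ℂ) ≠ 0 := by simpa using hz
    refine ⟨Complex.I * (starRingEnd ℂ z / ‖z‖), ?_, ?_⟩
    · simp [hz]
    · have h1 : Complex.I * (starRingEnd ℂ z / ‖z‖) * z = ((‖z‖ : ℝ) : ℂ) * Complex.I := by
        have h2 : starRingEnd ℂ z * z = (‖z‖ : ℂ) ^ 2 := by
          rw [← Complex.normSq_eq_conj_mul_self, Complex.normSq_eq_norm_sq]; push_cast; rfl
        field_simp
        linear_combination h2
      rw [h1]; simp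

theorem eq_of_forall_mul_re_eq {z w : ℂ} (h : ∀ c : ℂ, ‖c‖ = 1 → (c * z).re = (c * w).re) :
    z = w := by
  have h1 := h 1 norm_one
  have h2 := h Complex.I Complex.norm_I
  apply Complex.ext
  · simpa using h1
  · simpa using h2

/-- The map preserves real inner products of unit vectors, so `f 1 = 1` fixes real parts and forces
`f i = ±i`; this sign decides the alternative. -/
theorem isometry_circle_eq_id_or_conj {f : Circle → ℂ} (hn : ∀ c, ‖f c‖ = 1) (h1 : f 1 = 1)
    (hf : ∀ c d, ‖f c - f d‖ = ‖(c : ℂ) - d‖) :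
    (∀ c, f c = c) ∨ ∀ c, f c = starRingEnd ℂ (c : ℂ) := by
  have hinner : ∀ c d, (f c).re * (f d).re + (f c).im * (f d).im
      = (c : ℂ).re * (d : ℂ).re + (c : ℂ).im * (d : ℂ).im := by
    intro c d
    have e1 := congrArg (· ^ 2) (hf c d)
    have e2 := congrArg (· ^ 2) (hn c)
    have e3 := congrArg (· ^ 2) (hn d)
    have e4 := congrArg (· ^ 2) (Circle.norm_coe c)
    have e5 := congrArg (· ^ 2) (Circle.norm_coe d)
    simp only [Complex.sq_norm, Complex.normSq_apply, Complex.sub_re, Complex.sub_im] at e1 e2 e3 e4 e5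
    linarith
  have hre : ∀ c, (f c).re = (c : ℂ).re := fun c => by
    have := hinner c 1
    rw [h1] at this
    simpa using this
  let i : Circle := ⟨Complex.I, mem_sphere_zero_iff_norm.2 Complex.norm_I⟩
  have hi : (i : ℂ) = Complex.I := rfl
  have hi0 : (f i).re = 0 := by rw [hre, hi]; simp
  have hi1 : (f i).im * (f i).im = 1 := by
    have := hinner i i
    rw [hi0, hi] at this
    simpa using this
  have hcross : ∀ c, (f c).im * (f i).im = (c : ℂ).im := fun c => by
    have := hinner c i
    rw [hi0, hi] at this
    simpa using this
  rcases mul_self_eq_one_iff.1 hi1 with h | h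
  · left
    intro c
    refine Complex.ext (hre c) ?_
    have := hcross c
    rwa [h, mul_one] at this
  · right
    intro c
    refine Complex.ext (hre c) ?_
    have := hcross c
    rw [h] at this
    rw [Complex.conj_im]
    linarith

end ComplexNumbers

section RankOneDistances

variable {H H' : Type*} [NormedAddCommGroup H] [InnerProductSpace ℂ H] [CompleteSpace H]
  [NormedAddCommGroup H'] [InnerProductSpace ℂ H'] [CompleteSpace H']

theorem exists_singularPowSum_sub_smul {e v : H →L[ℂ] H} (he : IsMinimalPartialIsometry e)
    (hv : IsMinimalPartialIsometry v) :
    ∃ D : ℝ, ∀ c : ℂ, ‖c‖ = 1 → ∃ t₁ t₂ : ℝ, 0 ≤ t₁ ∧ 0 ≤ t₂ ∧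
      t₁ + t₂ = 2 - 2 * (c * peirceCoeff e v).re ∧ t₁ * t₂ = D ∧
      ∀ p : ℝ, 0 < p → singularPowSum p (e - c • v) = ENNReal.ofReal (t₁ ^ (p / 2) + t₂ ^ (p / 2)) := by
  obtain ⟨ξ₁, η₁, hξ₁, hη₁, rfl⟩ := exists_eq_rankOne he
  obtain ⟨ξ₂, η₂, hξ₂, hη₂, rfl⟩ := exists_eq_rankOne hv
  refine ⟨(1 - ‖⟪ξ₁, ξ₂⟫_ℂ‖ ^ 2) * (1 - ‖⟪η₂, η₁⟫_ℂ‖ ^ 2), fun c hc => ?_⟩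
  obtain ⟨t₁, t₂, h1, h2, h3, h4, h5⟩ :=
    exists_singularPowSum_sub_smul_rankOne hξ₁ hξ₂ hη₁ hη₂ c
  rw [hc] at h3 h4
  rw [peirceCoeff_rankOne hξ₁ hη₁]
  exact ⟨t₁, t₂, h1, h2, by linarith, by linarith, h5⟩

theorem peirceCoeff_conj_symm {e v : H →L[ℂ] H} (he : IsMinimalPartialIsometry e)
    (hv : IsMinimalPartialIsometry v) : peirceCoeff v e = starRingEnd ℂ (peirceCoeff e v) := by
  obtain ⟨ξ₁, η₁, hξ₁, hη₁, rfl⟩ := exists_eq_rankOne he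
  obtain ⟨ξ₂, η₂, hξ₂, hη₂, rfl⟩ := exists_eq_rankOne hv
  rw [peirceCoeff_rankOne hξ₁ hη₁, peirceCoeff_rankOne hξ₂ hη₂, map_mul, inner_conj_symm,
    inner_conj_symm]

theorem peirceCoeff_smul {e : H →L[ℂ] H} (he : IsMinimalPartialIsometry e) (v : H →L[ℂ] H) (c : ℂ) :
    peirceCoeff e (c • v) = c * peirceCoeff e v := by
  refine (existsUnique_peirceTwo_eq_smul he (c • v)).unique
    (peirceTwo_eq_peirceCoeff_smul he _) ?_
  rw [mul_smul, ← peirceTwo_eq_peirceCoeff_smul he, peirceTwo, peirceTwo, mul_smul_comm, smul_mul_assoc]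

/-- The distances from `e` to the multiples of `v` by scalars of modulus one determine the Peirce
coefficient of `v` relative to `e`. -/
theorem re_mul_peirceCoeff_eq {p : ℝ} (hp0 : 0 < p) (hp : p ≠ 2) {e v : H →L[ℂ] H}
    {e' v' : H' →L[ℂ] H'} (he : IsMinimalPartialIsometry e) (hv : IsMinimalPartialIsometry v)
    (he' : IsMinimalPartialIsometry e') (hv' : IsMinimalPartialIsometry v') {f : ℂ → ℂ}
    (hf1 : ∀ c, ‖c‖ = 1 → ‖f c‖ = 1) (hf2 : ∀ c, f (-c) = -f c)
    (h : ∀ c, ‖c‖ = 1 → singularPowSum p (e' - f c • v') = singularPowSum p (e - c • v))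
    {c : ℂ} (hc : ‖c‖ = 1) : (f c * peirceCoeff e' v').re = (c * peirceCoeff e v).re := by
  obtain ⟨D, hD⟩ := exists_singularPowSum_sub_smul he hv
  obtain ⟨D', hD'⟩ := exists_singularPowSum_sub_smul he' hv'
  have hq : 0 < p / 2 := by linarith
  have hq1 : p / 2 ≠ 1 := fun h => hp (by linarith)
  have heq : ∀ {t₁ t₂ s₁ s₂ : ℝ}, 0 ≤ t₁ → 0 ≤ t₂ → 0 ≤ s₁ → 0 ≤ s₂ →
      ENNReal.ofReal (t₁ ^ (p / 2) + t₂ ^ (p / 2)) = ENNReal.ofReal (s₁ ^ (p / 2) + s₂ ^ (p / 2)) →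
      t₁ ^ (p / 2) + t₂ ^ (p / 2) = s₁ ^ (p / 2) + s₂ ^ (p / 2) := by
    intro t₁ t₂ s₁ s₂ h1 h2 h3 h4 h5
    exact (ENNReal.ofReal_eq_ofReal_iff (by positivity) (by positivity)).1 h5
  -- At `c₀` the sum of the squared singular values is `2` for both `c₀` and `-c₀`, so the two
  -- distances coincide.
  obtain ⟨c₀, hc₀, hre⟩ := exists_norm_eq_one_mul_re_eq_zero (peirceCoeff e v)
  have hc₀' : ‖-c₀‖ = 1 := by rwa [norm_neg]
  obtain ⟨t₁, t₂, ht₁, ht₂, hts, htm, ht⟩ := hD c₀ hc₀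
  obtain ⟨r₁, r₂, hr₁, hr₂, hrs, hrm, hr⟩ := hD (-c₀) hc₀'
  obtain ⟨s₁, s₂, hs₁, hs₂, hss, hsm, hs⟩ := hD' (f c₀) (hf1 _ hc₀)
  obtain ⟨u₁, u₂, hu₁, hu₂, hus, hum, hu⟩ := hD' (f (-c₀)) (hf1 _ hc₀')
  have h1 := heq hs₁ hs₂ ht₁ ht₂ (by rw [← hs p hp0, ← ht p hp0, h c₀ hc₀])
  have h2 := heq hu₁ hu₂ hr₁ hr₂ (by rw [← hu p hp0, ← hr p hp0, h (-c₀) hc₀'])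
  rw [neg_mul, Complex.neg_re] at hrs
  rw [hf2, neg_mul, Complex.neg_re] at hus
  have h3 : t₁ ^ (p / 2) + t₂ ^ (p / 2) = r₁ ^ (p / 2) + r₂ ^ (p / 2) :=
    rpow_add_rpow_eq_of_add_eq_of_mul_eq (by linarith) (by linarith)
  -- On the other side the distances for `±f c₀` then coincide too. The product being the same, so
  -- are the sums, hence both equal `2`. Equal sums and equal distances at `c₀` now give equal
  -- products, which is where `p ≠ 2` enters; with equal products the distance at any `c` determines
  -- the sum.
  have h4 := add_eq_add_of_rpow_add_rpow_eq hq hs₁ hs₂ hu₁ hu₂ (by linarith) (by linarith)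
  have h5 := mul_eq_mul_of_rpow_add_rpow_eq hq hq1 hs₁ hs₂ ht₁ ht₂ (by linarith) h1
  obtain ⟨x₁, x₂, hx₁, hx₂, hxs, hxm, hx⟩ := hD c hc
  obtain ⟨y₁, y₂, hy₁, hy₂, hys, hym, hy⟩ := hD' (f c) (hf1 _ hc)
  have h6 := heq hy₁ hy₂ hx₁ hx₂ (by rw [← hy p hp0, ← hx p hp0, h c hc])
  have h7 := add_eq_add_of_rpow_add_rpow_eq hq hy₁ hy₂ hx₁ hx₂ (by linarith) h6
  linarith

end RankOneDistances

end SchattenTingley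

/-! ### Surjective isometries of the unit sphere -/

namespace SchattenTingley

open scoped NNReal InnerProductSpace
open InnerProductSpace

section Sphere

variable {H : Type*} [NormedAddCommGroup H] [InnerProductSpace ℂ H] [CompleteSpace H] {p : ℝ}

theorem SchattenSphere.isCompactOperator (a : SchattenSphere H p) : IsCompactOperator a.1 :=
  a.2.1.1

theorem SchattenSphere.singularPowSum_eq_one (hp : 0 < p) (a : SchattenSphere H p) :
    singularPowSum p a.1 = 1 := by
  have h1 : (singularPowSum p a.1).toReal ^ (1 / p) = 1 := a.2.2
  have h2 : (singularPowSum p a.1).toReal = 1 := by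
    have h3 : (singularPowSum p a.1).toReal ^ (1 / p) = (1 : ℝ) ^ (1 / p) := by
      rw [h1, Real.one_rpow]
    exact (Real.rpow_left_inj ENNReal.toReal_nonneg zero_le_one (by positivity)).1 h3
  rwa [ENNReal.toReal_eq_one_iff] at h2

/-- An operator with unit power sum, as an element of the unit sphere. -/
def SchattenSphere.mk {a : H →L[ℂ] H} (ha : IsCompactOperator a) (h1 : singularPowSum p a = 1) :
    SchattenSphere H p :=
  ⟨a, ⟨ha, by rw [h1]; exact ENNReal.one_lt_top⟩, by rw [schattenNorm, h1]; simp⟩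

theorem IsMinimalPartialIsometry.isCompactOperator {e : H →L[ℂ] H}
    (he : IsMinimalPartialIsometry e) : IsCompactOperator e := by
  obtain ⟨ξ, η, -, -, rfl⟩ := exists_eq_rankOne he
  exact isCompactOperator_rankOne ξ η

theorem IsMinimalPartialIsometry.singularPowSum {e : H →L[ℂ] H}
    (he : IsMinimalPartialIsometry e) (hp : 0 < p) : singularPowSum p e = 1 := by
  obtain ⟨ξ, η, hξ, hη, rfl⟩ := exists_eq_rankOne he
  exact singularPowSum_rankOne hp hξ hη

theorem IsMinimalPartialIsometry.smul {e : H →L[ℂ] H} (he : IsMinimalPartialIsometry e) {c : ℂ}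
    (hc : ‖c‖ = 1) : IsMinimalPartialIsometry (c • e) := by
  obtain ⟨ξ, η, hξ, hη, rfl⟩ := exists_eq_rankOne he
  have : c • rankOne ℂ ξ η = (rankOne ℂ (c • ξ) η : H →L[ℂ] H) := by
    rw [map_smul]; rfl
  rw [this]
  exact isMinimalPartialIsometry_rankOne (by rw [norm_smul, hc, hξ, one_mul]) hη

/-- A minimal partial isometry as an element of the unit sphere. -/
def SchattenSphere.ofMinimal (hp : 0 < p) {e : H →L[ℂ] H} (he : IsMinimalPartialIsometry e) :
    SchattenSphere H p :=
  SchattenSphere.mk he.isCompactOperator (he.singularPowSum hp)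

/-- The antipode of a point of the unit sphere. -/
noncomputable def SchattenSphere.neg (hp : 0 < p) (a : SchattenSphere H p) : SchattenSphere H p :=
  SchattenSphere.mk (isCompactOperator_clm_neg a.isCompactOperator)
    ((singularPowSum_neg hp a.isCompactOperator).trans (a.singularPowSum_eq_one hp))

theorem SchattenSphere.singularPowSum_sub_ne_top (hp : 0 < p) (hp2 : p ≠ 2)
    (a b : SchattenSphere H p) : singularPowSum p (a.1 - b.1) ≠ ∞ := by
  rw [sub_eq_add_neg]
  refine singularPowSum_add_ne_top hp hp2 a.isCompactOperator
    (isCompactOperator_clm_neg b.isCompactOperator) ?_ ?_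
  · rw [a.singularPowSum_eq_one hp]; simp
  · rw [singularPowSum_neg hp b.isCompactOperator, b.singularPowSum_eq_one hp]; simp

/-- A metric description of orthogonality; one direction is additivity of the power sums, the other
the equality case of Clarkson–McCarthy. -/
theorem SchattenSphere.orthogonalTo_iff (hp : 0 < p) (hp2 : p ≠ 2) (a b : SchattenSphere H p) :
    OrthogonalTo a.1 b.1 ↔
      singularPowSum p (a.1 + b.1) = 2 ∧ singularPowSum p (a.1 - b.1) = 2 := by
  have ha := a.isCompactOperator
  have hb := b.isCompactOperator
  have ha1 := a.singularPowSum_eq_one hp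
  have hb1 := b.singularPowSum_eq_one hp
  refine ⟨fun h => ⟨?_, ?_⟩, fun h => orthogonalTo_of_singularPowSum hp hp2 ha hb ha1 hb1 h.1 h.2⟩
  · rw [h.singularPowSum_add hp ha hb, ha1, hb1, one_add_one_eq_two]
  · have h' : OrthogonalTo a.1 (-b.1) := ⟨by simp [h.1], by simp [h.2]⟩
    rw [sub_eq_add_neg, h'.singularPowSum_add hp ha (isCompactOperator_clm_neg hb),
      singularPowSum_neg hp hb, ha1, hb1, one_add_one_eq_two]

theorem not_orthogonalTo_smul_smul {e : H →L[ℂ] H} {c d : ℂ} (hc : c • e ≠ 0) (hd : d • e ≠ 0) :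
    ¬ OrthogonalTo (c • e) (d • e) := by
  intro h
  have h1 := h.1
  rw [star_smul, smul_mul_smul_comm, smul_eq_zero, CStarRing.mul_star_self_eq_zero_iff, mul_eq_zero,
    star_eq_zero] at h1
  rcases h1 with (h1 | h1) | h1
  · exact hc (by rw [h1, zero_smul])
  · exact hd (by rw [h1, zero_smul])
  · exact hc (by rw [h1, smul_zero])

end Sphere

section Isometry

variable {H H' : Type*} [NormedAddCommGroup H] [InnerProductSpace ℂ H] [CompleteSpace H]
  [NormedAddCommGroup H'] [InnerProductSpace ℂ H'] [CompleteSpace H'] {p : ℝ}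
  {Δ : SchattenSphere H p → SchattenSphere H' p}

theorem IsSphereIsometry.singularPowSum_sub (hΔ : IsSphereIsometry Δ) (hp : 0 < p) (hp2 : p ≠ 2)
    (a b : SchattenSphere H p) :
    singularPowSum p ((Δ a).1 - (Δ b).1) = singularPowSum p (a.1 - b.1) := by
  have h1 : (singularPowSum p ((Δ a).1 - (Δ b).1)).toReal ^ (1 / p)
      = (singularPowSum p (a.1 - b.1)).toReal ^ (1 / p) := hΔ a b
  have h2 := (Real.rpow_left_inj ENNReal.toReal_nonneg ENNReal.toReal_nonneg
    (show 1 / p ≠ 0 by positivity)).1 h1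
  exact (ENNReal.toReal_eq_toReal_iff' (SchattenSphere.singularPowSum_sub_ne_top hp hp2 _ _)
    (SchattenSphere.singularPowSum_sub_ne_top hp hp2 _ _)).1 h2

/-- The images of `a` and `-a` are at distance `2`, so strict convexity identifies `Δ a` with the
negative of the image of `-a`. -/
theorem IsSphereIsometry.map_neg (hΔ : IsSphereIsometry Δ) (hp : 1 < p) (hp2 : p ≠ 2)
    (a : SchattenSphere H p) : (Δ (a.neg (by linarith))).1 = -(Δ a).1 := by
  have hp0 : 0 < p := by linarith
  set n := a.neg hp0 with hn
  have h1 : singularPowSum p ((Δ a).1 + -(Δ n).1) = 2 ^ p := by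
    rw [← sub_eq_add_neg, hΔ.singularPowSum_sub hp0 hp2]
    have h2 : a.1 - n.1 = (2 : ℂ) • a.1 := by
      change a.1 - -a.1 = _
      rw [two_smul]; abel
    rw [h2, singularPowSum_smul hp0 a.isCompactOperator, a.singularPowSum_eq_one hp0, mul_one,
      ← ofReal_norm]
    simp
  have h2 := eq_of_singularPowSum_add hp (Δ a).isCompactOperator
    (isCompactOperator_clm_neg (Δ n).isCompactOperator) ((Δ a).singularPowSum_eq_one hp0)
    ((singularPowSum_neg hp0 (Δ n).isCompactOperator).trans ((Δ n).singularPowSum_eq_one hp0)) h1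
  rw [h2, neg_neg]

theorem IsSphereIsometry.singularPowSum_add (hΔ : IsSphereIsometry Δ) (hp : 1 < p) (hp2 : p ≠ 2)
    (a b : SchattenSphere H p) :
    singularPowSum p ((Δ a).1 + (Δ b).1) = singularPowSum p (a.1 + b.1) := by
  have h := hΔ.singularPowSum_sub (by linarith) hp2 a (b.neg (by linarith))
  rw [hΔ.map_neg hp hp2, sub_neg_eq_add] at h
  rw [h]
  change singularPowSum p (a.1 - -b.1) = _
  rw [sub_neg_eq_add]

theorem IsSphereIsometry.orthogonalTo_iff (hΔ : IsSphereIsometry Δ) (hp : 1 < p) (hp2 : p ≠ 2)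
    (a b : SchattenSphere H p) : OrthogonalTo (Δ a).1 (Δ b).1 ↔ OrthogonalTo a.1 b.1 := by
  rw [SchattenSphere.orthogonalTo_iff (by linarith) hp2,
    SchattenSphere.orthogonalTo_iff (by linarith) hp2, hΔ.singularPowSum_add hp hp2,
    hΔ.singularPowSum_sub (by linarith) hp2]

theorem SchattenSphere.ne_zero (hp : 0 < p) (a : SchattenSphere H p) : a.1 ≠ 0 := by
  intro h
  have := a.singularPowSum_eq_one hp
  rw [h, singularPowSum_zero hp] at this
  exact zero_ne_one this

theorem exists_eq_smul_of_orthogonal_imp (hp : 0 < p) {e x : SchattenSphere H p}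
    (he : IsMinimalPartialIsometry e.1)
    (h : ∀ z : SchattenSphere H p, OrthogonalTo z.1 e.1 → OrthogonalTo z.1 x.1) :
    ∃ c : ℂ, x.1 = c • e.1 := by
  obtain ⟨ξ, η, hξ, hη, heq⟩ := exists_eq_rankOne he
  rw [heq]
  refine eq_smul_of_forall_orthogonal hξ hη fun α β hα hβ hαξ hβη => ?_
  have hz := isMinimalPartialIsometry_rankOne hα hβ
  refine (h (SchattenSphere.ofMinimal hp hz) ?_).symm
  change OrthogonalTo (rankOne ℂ α β) e.1
  rw [heq, orthogonalTo_rankOne_iff (by rintro rfl; simp at hξ) (by rintro rfl; simp at hη),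
    star_rankOne, rankOne_apply, rankOne_apply, hβη, hαξ]
  simp

/-- If `Δ e` were not minimal, it would dominate two orthogonal minimal partial isometries. Their
preimages are orthogonal to everything orthogonal to `e`, so both are nonzero multiples of `e`; yet
they are orthogonal to each other. -/
theorem IsSphereIsometry.isMinimalPartialIsometry (hΔ : IsSphereIsometry Δ)
    (hsurj : Function.Surjective Δ) (hp : 1 < p) (hp2 : p ≠ 2) {e : SchattenSphere H p}
    (he : IsMinimalPartialIsometry e.1) : IsMinimalPartialIsometry (Δ e).1 := by
  have hp0 : 0 < p := by linarith
  by_contra hn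
  obtain ⟨x', y', hx', hy', hxy, hz⟩ := exists_orthogonal_pair hp0 (Δ e).isCompactOperator
    ((Δ e).singularPowSum_eq_one hp0) hn
  obtain ⟨x, hx⟩ := hsurj (SchattenSphere.ofMinimal hp0 hx')
  obtain ⟨y, hy⟩ := hsurj (SchattenSphere.ofMinimal hp0 hy')
  have hx1 : (Δ x).1 = x' := by rw [hx]; rfl
  have hy1 : (Δ y).1 = y' := by rw [hy]; rfl
  obtain ⟨c, hc⟩ := exists_eq_smul_of_orthogonal_imp hp0 he (x := x) fun z hze => by
    rw [← hΔ.orthogonalTo_iff hp hp2, hx1]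
    exact (hz _ ((hΔ.orthogonalTo_iff hp hp2 z e).2 hze)).1
  obtain ⟨d, hd⟩ := exists_eq_smul_of_orthogonal_imp hp0 he (x := y) fun z hze => by
    rw [← hΔ.orthogonalTo_iff hp hp2, hy1]
    exact (hz _ ((hΔ.orthogonalTo_iff hp hp2 z e).2 hze)).2
  have hxy' : OrthogonalTo x.1 y.1 := by
    rw [← hΔ.orthogonalTo_iff hp hp2, hx1, hy1]; exact hxy
  have hx0 := x.ne_zero hp0
  have hy0 := y.ne_zero hp0
  rw [hc] at hxy' hx0
  rw [hd] at hxy' hy0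
  exact not_orthogonalTo_smul_smul hx0 hy0 hxy'

/-- `Δ` is linear, respectively conjugate linear, along the circle through `w`. -/
theorem IsSphereIsometry.smul_eq_or (hΔ : IsSphereIsometry Δ) (hsurj : Function.Surjective Δ)
    (hp : 1 < p) (hp2 : p ≠ 2) {w : SchattenSphere H p} (hw : IsMinimalPartialIsometry w.1) :
    (∀ c : Circle, (Δ (c • w)).1 = (c : ℂ) • (Δ w).1) ∨
      ∀ c : Circle, (Δ (c • w)).1 = starRingEnd ℂ (c : ℂ) • (Δ w).1 := by
  have hp0 : 0 < p := by linarith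
  have hw' := hΔ.isMinimalPartialIsometry hsurj hp hp2 hw
  -- Orthogonality to `w` implies orthogonality to `c w`; surjectivity carries this implication over
  -- to the images.
  have hex : ∀ c : Circle, ∃ d : ℂ, (Δ (c • w)).1 = d • (Δ w).1 := by
    intro c
    refine exists_eq_smul_of_orthogonal_imp hp0 hw' fun z' hz' => ?_
    obtain ⟨z, rfl⟩ := hsurj z'
    rw [hΔ.orthogonalTo_iff hp hp2] at hz' ⊢
    change OrthogonalTo z.1 ((c : ℂ) • w.1)
    constructor
    · rw [star_smul, mul_smul_comm, hz'.1, smul_zero]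
    · rw [mul_smul_comm, hz'.2, smul_zero]
  choose f hf using hex
  have hpow : ∀ x y : ℂ, ‖x‖ₑ ^ p = ‖y‖ₑ ^ p → ‖x‖ = ‖y‖ := fun x y h => by
    have h1 : ‖x‖ₑ = ‖y‖ₑ := ENNReal.rpow_left_injective hp0.ne' h
    simpa [enorm_eq_nnnorm, ← NNReal.coe_inj] using h1
  have hN : ∀ d : ℂ, singularPowSum p (d • (Δ w).1) = ‖d‖ₑ ^ p := fun d => by
    rw [singularPowSum_smul hp0 (Δ w).isCompactOperator, (Δ w).singularPowSum_eq_one hp0, mul_one]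
  have hN' : ∀ d : ℂ, singularPowSum p (d • w.1) = ‖d‖ₑ ^ p := fun d => by
    rw [singularPowSum_smul hp0 w.isCompactOperator, w.singularPowSum_eq_one hp0, mul_one]
  have hnorm : ∀ c, ‖f c‖ = 1 := fun c => by
    rw [← norm_one (α := ℂ)]
    refine hpow _ _ ?_
    rw [← hN, ← hf, (Δ (c • w)).singularPowSum_eq_one hp0]
    simp
  have hone : f 1 = 1 := by
    have h1 : (1 : Circle) • w = w := by
      apply Subtype.ext
      change ((1 : Circle) : ℂ) • w.1 = w.1
      simp
    have h2 := hf 1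
    rw [h1] at h2
    have h3 : (f 1 - 1) • (Δ w).1 = 0 := by rw [sub_smul, ← h2, one_smul, sub_self]
    rcases smul_eq_zero.1 h3 with h | h
    · exact sub_eq_zero.1 h
    · exact absurd h ((Δ w).ne_zero hp0)
  have hdist : ∀ c d, ‖f c - f d‖ = ‖(c : ℂ) - d‖ := fun c d => by
    refine hpow _ _ ?_
    rw [← hN, ← hN', sub_smul, ← hf, ← hf, hΔ.singularPowSum_sub hp0 hp2, sub_smul]
    rfl
  rcases isometry_circle_eq_id_or_conj hnorm hone hdist with h | h
  · exact Or.inl fun c => by rw [hf, h]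
  · exact Or.inr fun c => by rw [hf, h]

theorem IsSphereIsometry.peirceCoeff_eq_of_linear (hΔ : IsSphereIsometry Δ)
    (hsurj : Function.Surjective Δ) (hp : 1 < p) (hp2 : p ≠ 2) {e v : SchattenSphere H p}
    (he : IsMinimalPartialIsometry e.1) (hv : IsMinimalPartialIsometry v.1)
    (h : ∀ c : Circle, (Δ (c • v)).1 = (c : ℂ) • (Δ v).1) :
    peirceCoeff (Δ e).1 (Δ v).1 = peirceCoeff e.1 v.1 := by
  have hp0 : 0 < p := by linarith
  refine eq_of_forall_mul_re_eq fun c hc => ?_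
  refine re_mul_peirceCoeff_eq hp0 hp2 he hv (hΔ.isMinimalPartialIsometry hsurj hp hp2 he)
    (hΔ.isMinimalPartialIsometry hsurj hp hp2 hv) (f := fun c => c) (fun c hc => hc)
    (fun c => rfl) (fun c hc => ?_) hc
  obtain ⟨u, rfl⟩ : ∃ u : Circle, (u : ℂ) = c := ⟨⟨c, mem_sphere_zero_iff_norm.2 hc⟩, rfl⟩
  have h2 := hΔ.singularPowSum_sub hp0 hp2 e (u • v)
  rw [h u] at h2
  exact h2

theorem IsSphereIsometry.peirceCoeff_eq_of_conjugate (hΔ : IsSphereIsometry Δ)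
    (hsurj : Function.Surjective Δ) (hp : 1 < p) (hp2 : p ≠ 2) {e v : SchattenSphere H p}
    (he : IsMinimalPartialIsometry e.1) (hv : IsMinimalPartialIsometry v.1)
    (h : ∀ c : Circle, (Δ (c • v)).1 = starRingEnd ℂ (c : ℂ) • (Δ v).1) :
    peirceCoeff (Δ e).1 (Δ v).1 = starRingEnd ℂ (peirceCoeff e.1 v.1) := by
  have hp0 : 0 < p := by linarith
  have key : starRingEnd ℂ (peirceCoeff (Δ e).1 (Δ v).1) = peirceCoeff e.1 v.1 := by
    refine eq_of_forall_mul_re_eq fun c hc => ?_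
    have h0 := re_mul_peirceCoeff_eq hp0 hp2 he hv (hΔ.isMinimalPartialIsometry hsurj hp hp2 he)
      (hΔ.isMinimalPartialIsometry hsurj hp hp2 hv) (f := fun c => starRingEnd ℂ c)
      (fun c hc => by rw [RCLike.norm_conj, hc]) (fun c => _root_.map_neg _ c) (fun c hc => ?_) hc
    · rw [← h0, ← Complex.conj_re, map_mul, Complex.conj_conj]
    · obtain ⟨u, rfl⟩ : ∃ u : Circle, (u : ℂ) = c := ⟨⟨c, mem_sphere_zero_iff_norm.2 hc⟩, rfl⟩
      have h2 := hΔ.singularPowSum_sub hp0 hp2 e (u • v)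
      rw [h u] at h2
      exact h2
  rw [← key, Complex.conj_conj]

/-- The coefficient between `Δ e` and `Δ (c v)` is computed once from the circle of `e` and once
from that of `v`. Comparison makes `c φ_e(v)` real for every `c`, and `c = 1, i` give `φ_e(v) = 0`.
-/
theorem IsSphereIsometry.false_of_linear_of_conjugate (hΔ : IsSphereIsometry Δ)
    (hsurj : Function.Surjective Δ) (hp : 1 < p) (hp2 : p ≠ 2) {e v : SchattenSphere H p}
    (he : IsMinimalPartialIsometry e.1) (hv : IsMinimalPartialIsometry v.1)
    (hlin : ∀ c : Circle, (Δ (c • e)).1 = (c : ℂ) • (Δ e).1)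
    (hconj : ∀ c : Circle, (Δ (c • v)).1 = starRingEnd ℂ (c : ℂ) • (Δ v).1)
    (hne : peirceCoeff e.1 v.1 ≠ 0) : False := by
  have hreal : ∀ c : Circle,
      starRingEnd ℂ ((c : ℂ) * peirceCoeff e.1 v.1) = (c : ℂ) * peirceCoeff e.1 v.1 := by
    intro c
    have hcv : IsMinimalPartialIsometry (c • v).1 := hv.smul (Circle.norm_coe c)
    have hconj' : ∀ d : Circle, (Δ (d • c • v)).1 = starRingEnd ℂ (d : ℂ) • (Δ (c • v)).1 := by
      intro d
      have h1 : d • c • v = (d * c) • v := by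
        apply Subtype.ext
        change (d : ℂ) • (c : ℂ) • v.1 = ((d * c : Circle) : ℂ) • v.1
        rw [smul_smul, Circle.coe_mul]
      rw [h1, hconj, hconj, smul_smul, Circle.coe_mul, map_mul]
    have h1 := hΔ.peirceCoeff_eq_of_conjugate hsurj hp hp2 he hcv hconj'
    have h2 := hΔ.peirceCoeff_eq_of_linear hsurj hp hp2 hcv he hlin
    rw [peirceCoeff_conj_symm (hΔ.isMinimalPartialIsometry hsurj hp hp2 he)
      (hΔ.isMinimalPartialIsometry hsurj hp hp2 hcv), h1, Complex.conj_conj,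
      peirceCoeff_conj_symm he hcv] at h2
    have h3 : peirceCoeff e.1 (c • v).1 = (c : ℂ) * peirceCoeff e.1 v.1 :=
      peirceCoeff_smul he v.1 c
    rw [h3] at h2
    exact h2.symm
  have h1 := hreal 1
  have h2 := hreal ⟨Complex.I, mem_sphere_zero_iff_norm.2 Complex.norm_I⟩
  change starRingEnd ℂ (Complex.I * _) = Complex.I * _ at h2
  rw [Circle.coe_one, one_mul] at h1
  rw [map_mul, h1, Complex.conj_I] at h2
  have h3 : Complex.I * peirceCoeff e.1 v.1 = 0 := by linear_combination (-1 / 2 : ℂ) * h2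
  rcases mul_eq_zero.1 h3 with h | h
  · exact Complex.I_ne_zero h
  · exact hne h

end Isometry

/-- If the two vectors are orthogonal, their normalised sum works; otherwise the first one does. -/
theorem exists_unit_inner_ne_zero {H : Type*} [NormedAddCommGroup H] [InnerProductSpace ℂ H]
    {ξ₁ ξ₂ : H} (h₁ : ‖ξ₁‖ = 1) (h₂ : ‖ξ₂‖ = 1) :
    ∃ ζ : H, ‖ζ‖ = 1 ∧ ⟪ξ₁, ζ⟫_ℂ ≠ 0 ∧ ⟪ζ, ξ₂⟫_ℂ ≠ 0 := by
  have hs : ∀ {ξ : H}, ‖ξ‖ = 1 → ⟪ξ, ξ⟫_ℂ = 1 := fun {ξ} h => by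
    rw [inner_self_eq_norm_sq_to_K, h]; simp
  by_cases h : ⟪ξ₁, ξ₂⟫_ℂ = 0
  · have hi₁ : ⟪ξ₁, ξ₁ + ξ₂⟫_ℂ = 1 := by rw [inner_add_right, hs h₁, h, add_zero]
    have hi₂ : ⟪ξ₁ + ξ₂, ξ₂⟫_ℂ = 1 := by rw [inner_add_left, hs h₂, h, zero_add]
    have hne : ξ₁ + ξ₂ ≠ 0 := fun h0 => by simp [h0] at hi₁
    have hn := norm_ne_zero_iff.2 hne
    refine ⟨((‖ξ₁ + ξ₂‖⁻¹ : ℝ) : ℂ) • (ξ₁ + ξ₂), ?_, ?_, ?_⟩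
    · rw [norm_smul, Complex.norm_real, norm_inv, norm_norm, inv_mul_cancel₀ hn]
    · rw [inner_smul_right, hi₁, mul_one]; simpa using hne
    · rw [inner_smul_left, hi₂, mul_one, Complex.conj_ofReal]; simpa using hne
  · exact ⟨ξ₁, h₁, by rw [hs h₁]; exact one_ne_zero, h⟩

theorem exists_minimal_peirceCoeff_ne_zero {H : Type*} [NormedAddCommGroup H]
    [InnerProductSpace ℂ H] [CompleteSpace H] {e v : H →L[ℂ] H} (he : IsMinimalPartialIsometry e)
    (hv : IsMinimalPartialIsometry v) :
    ∃ w : H →L[ℂ] H, IsMinimalPartialIsometry w ∧ peirceCoeff e w ≠ 0 ∧ peirceCoeff w v ≠ 0 := by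
  obtain ⟨ξ₁, η₁, hξ₁, hη₁, rfl⟩ := exists_eq_rankOne he
  obtain ⟨ξ₂, η₂, hξ₂, hη₂, rfl⟩ := exists_eq_rankOne hv
  obtain ⟨ζ, hζ, hζ₁, hζ₂⟩ := exists_unit_inner_ne_zero hξ₁ hξ₂
  obtain ⟨θ, hθ, hθ₁, hθ₂⟩ := exists_unit_inner_ne_zero hη₂ hη₁
  refine ⟨rankOne ℂ ζ θ, isMinimalPartialIsometry_rankOne hζ hθ, ?_, ?_⟩
  · rw [peirceCoeff_rankOne hξ₁ hη₁]
    exact mul_ne_zero hζ₁ hθ₂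
  · rw [peirceCoeff_rankOne hζ hθ]
    exact mul_ne_zero hζ₂ hθ₁

/-- If both alternatives failed, there would be a linear `e` and a conjugate linear `v`. An
intermediate `w` with nonzero coefficients to both is itself of one of the two types and so clashes
with `e` or with `v`. -/
theorem IsSphereIsometry.homogeneous_or {H H' : Type*} [NormedAddCommGroup H]
    [InnerProductSpace ℂ H] [CompleteSpace H] [NormedAddCommGroup H'] [InnerProductSpace ℂ H']
    [CompleteSpace H'] {p : ℝ} {Δ : SchattenSphere H p → SchattenSphere H' p}
    (hΔ : IsSphereIsometry Δ) (hsurj : Function.Surjective Δ) (hp : 1 < p) (hp2 : p ≠ 2) :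
    IsComplexHomogeneous Δ ∨ IsConjugateHomogeneous Δ := by
  have hp0 : 0 < p := by linarith
  by_contra hc
  rw [not_or, IsComplexHomogeneous, IsConjugateHomogeneous] at hc
  obtain ⟨hc1, hc2⟩ := hc
  push Not at hc1 hc2
  obtain ⟨c, v, hv, hcv⟩ := hc1
  obtain ⟨d, e, he, hde⟩ := hc2
  have hv' := (hΔ.smul_eq_or hsurj hp hp2 hv).resolve_left fun h => hcv (h c)
  have he' := (hΔ.smul_eq_or hsurj hp hp2 he).resolve_right fun h => hde (h d)
  obtain ⟨w, hw, hew, hwv⟩ := exists_minimal_peirceCoeff_ne_zero he hv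
  have hws : IsMinimalPartialIsometry (SchattenSphere.ofMinimal hp0 hw).1 := hw
  rcases hΔ.smul_eq_or hsurj hp hp2 hws with h | h
  · exact hΔ.false_of_linear_of_conjugate hsurj hp hp2 hws hv h hv' hwv
  · exact hΔ.false_of_linear_of_conjugate hsurj hp hp2 he hws he' h hew

end SchattenTingley

theorem corollaryc {H H' : Type*}
    [NormedAddCommGroup H] [InnerProductSpace ℂ H] [CompleteSpace H]
    [NormedAddCommGroup H'] [InnerProductSpace ℂ H'] [CompleteSpace H']
    (p : ℝ) (hp1 : 1 < p) (hp2 : p ≠ 2)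
    (Δ : SchattenTingley.SchattenSphere H p → SchattenTingley.SchattenSphere H' p)
    (hΔ : SchattenTingley.IsSphereIsometry Δ) (hsurj : Function.Surjective Δ) :
    (SchattenTingley.IsComplexHomogeneous Δ ∨ SchattenTingley.IsConjugateHomogeneous Δ) ∧
    (∀ e v : SchattenTingley.SchattenSphere H p,
      SchattenTingley.IsMinimalPartialIsometry e.1 →
      SchattenTingley.IsMinimalPartialIsometry v.1 →
        SchattenTingley.IsMinimalPartialIsometry (Δ e).1 ∧
        (SchattenTingley.IsComplexHomogeneous Δ →
          SchattenTingley.peirceTwo (Δ e).1 (Δ v).1 =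
              SchattenTingley.peirceCoeff e.1 v.1 • (Δ e).1 ∧
          SchattenTingley.peirceCoeff (Δ e).1 (Δ v).1 =
              SchattenTingley.peirceCoeff e.1 v.1) ∧
        (SchattenTingley.IsConjugateHomogeneous Δ →
          SchattenTingley.peirceTwo (Δ e).1 (Δ v).1 =
              starRingEnd ℂ (SchattenTingley.peirceCoeff e.1 v.1) • (Δ e).1 ∧
          SchattenTingley.peirceCoeff (Δ e).1 (Δ v).1 =
              starRingEnd ℂ (SchattenTingley.peirceCoeff e.1 v.1))) := by
  have hp0 : 0 < p := by linarith
  refine ⟨hΔ.homogeneous_or hsurj hp1 hp2, fun e v he hv => ?_⟩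
  have he' := hΔ.isMinimalPartialIsometry hsurj hp1 hp2 he
  refine ⟨he', fun h => ?_, fun h => ?_⟩
  · have h1 := hΔ.peirceCoeff_eq_of_linear hsurj hp1 hp2 he hv fun c => h c v hv
    exact ⟨by rw [SchattenTingley.peirceTwo_eq_peirceCoeff_smul he', h1], h1⟩
  · have h1 := hΔ.peirceCoeff_eq_of_conjugate hsurj hp1 hp2 he hv fun c => h c v hv
    exact ⟨by rw [SchattenTingley.peirceTwo_eq_peirceCoeff_smul he', h1], h1⟩
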